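/- All spaces are over $\mathbb C$. A Leibniz superalgebra is a $\mathbb Z_2$-graded space $L=L_0\oplus L_1$ with a bilinear product satisfying $[L_\alpha,L_\beta]\subseteq L_{\alpha+\beta}$ and $[x,[y,z]]=[[x,y],z]-(-1)^{\alpha\beta}[[x,z],y]$ for $x\in L$, $y\in L_\alpha$, $z\in L_\beta$; isomorphisms are linear bijections that preserve the grading and the product. Put $L^1=L$, $L^{k+1}=[L^k,L]$; the nilindex is the least $s\ge 1$ with $L^s=0$. For $x\in L_0$ let $C_i(x)$ be the descending sequence of the dimensions of the Jordan blocks of $R_x:u\mapsto[u,x]$ on $L_i$; the characteristic sequence of $L$ is $(\max C_0(x)\mid\max C_1(\tilde x))$, the lexicographic maxima being taken separately over $x,\tilde x\in L_0\setminus[L_0,L_0]$. For $n\ge 2$ and complex numbers $\gamma,\beta_{[(n+4)/2]},\dots,\beta_n,\beta$ let $L(\gamma,\beta_{[(n+4)/2]},\dots,\beta_n,\beta)$ be the superalgebra with even basis $x_1,\dots,x_n$, odd basis $y_1,\dots,y_{n+1}$ and products (the omitted ones are zero) $$[x_i,x_1]=x_{i+1},\quad [y_j,x_1]=y_{j+1},\quad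 [x_i,y_1]=\tfrac12y_{i+1}\quad(1\le i,j\le n-1),$$ $$[y_j,y_1]=x_j\ (1\le j\le n),\qquad [y_{n+1},y_{n+1}]=\gamma x_n,$$ $$[x_i,y_{n+1}]=\sum_{k=[(n+4)/2]}^{n+1-i}\beta_ky_{k-1+i}\ \bigl(1\le i\le[\tfrac{n-1}2]\bigr),$$ $$[y_1,y_{n+1}]=-2\sum_{k=[(n+4)/2]}^{n}\beta_kx_{k-1}+\beta x_n,$$ $$[y_j,y_{n+1}]=-2\sum_{k=[(n+4)/2]}^{n+2-j}\beta_kx_{k-2+j}\ \bigl(2\le j\le[\tfrac{n+1}2]\bigr).$$ Let $S_{m,t}=\cos\frac{2\pi m}t+i\sin\frac{2\pi m}t$ for $0\le m\le t-1$, let $\delta=\pm1$, and let $\sqrt[j]{\delta}$ be the principal $j$-th root. For $1\le j\le k$ and $\alpha=(\alpha_1,\dots,\alpha_k)\in\mathbb C^k$ let $V^0_{j,k}(\alpha)$, $V^1_{j,k}(\alpha)$, $V^2_{j,k}(\alpha)\in\mathbb C^k$ be the vectors whose coordinates before the $j$-th are $0$, whose $j$-th coordinate is $1$, and whose $i$-th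 coordinate for $j<i\le k$ is, respectively, $$\delta\,(\sqrt[j]{\delta}\,S_{m,j})^{i}\alpha_i,\qquad S_{m,j}^{\,i}\alpha_i,\qquad S_{m,2j-1}^{\,2i-1}\alpha_i .$$ For $j=k+1$ these three vectors are zero. For $1\le j\le k$ and $1\le s\le k-j$ let $W_{s,j,k}(\alpha)\in\mathbb C^k$ have $j$-th and $(j+s)$-th coordinates $1$, $i$-th coordinate $S_{m,s}^{\,i-j-s}\alpha_i$ for $j+s<i\le k$, and all other coordinates $0$; let $W_{k+1-j,j,k}(\alpha)$ be the $j$-th unit vector. All the vectors obtained from fixed $j$, $s$, $\alpha$ (and $b$ below) by the choices of $m$ ($0\le m<j$ for $V^0,V^1$; $0\le m<2j-1$ for $V^2$; $0\le m<s$ for $W$) and of $\delta\in\{1,-1\}$, with the same $\delta$ in all places of a parameter vector, count as one entry of the list below. For $k+1=j$ the choice of $m$ is immaterial. **Theorem.** Let $n\ge2$ and $m=n+1$. Consider the following list, in which $\alpha$ is an arbitrary complex vector of the appropriate length. If $n=2q-1$: 1. $L(1,\delta b,V^0_{j,q-2}(\alpha),0)$, $b\in\mathbb C$, $b\ne\pm\frac12$,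 $1\le j\le q-1$; 2. $L(1,\delta\frac12,V^0_{j,q-1}(\alpha))$, $1\le j\le q$; 3. $L(0,1,V^1_{j,q-2}(\alpha),0)$, $1\le j\le q-1$; 4. $L(0,0,W_{s,j,q-1}(\alpha))$, $1\le j\le q-1$, $1\le s\le q-j$; 5. $L(0,0,\dots,0)$. If $n=2q$: 1. $L(1,V^2_{j,q-1}(\alpha),0)$, $1\le j\le q$; 2. $L(0,W_{s,j,q}(\alpha))$, $1\le j\le q$, $1\le s\le q+1-j$; 3. $L(0,0,\dots,0)$. Every superalgebra in the list is a Leibniz superalgebra with $\dim L_0=n$, $\dim L_1=m$, characteristic sequence $(n\mid m-1,1)$ and nilindex $n+m$. Two superalgebras in the list are isomorphic if and only if they belong to the same entry. Every Leibniz superalgebra with $\dim L_0=n$, $\dim L_1=m$, characteristic sequence $(n\mid m-1,1)$ and nilindex $n+m$ is isomorphic to a superalgebra of exactly one entry of the list. -/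

import Mathlib

open scoped BigOperators

universe u

/-! ### Leibniz superalgebras over the complex numbers -/

/-- The data of a `ℤ/2`-graded complex vector space `V` with a bilinear product; `part 0` is the
even part `L₀`, `part 1` is the odd part `L₁`. The laws are in `IsLeibnizSuperalgebra`. -/
structure SuperProduct (V : Type*) [AddCommGroup V] [Module ℂ V] where
  part : ZMod 2 → Submodule ℂ V
  bracket : V →ₗ[ℂ] V →ₗ[ℂ] V

namespace SuperProduct

variable {V : Type*} [AddCommGroup V] [Module ℂ V]
variable {V' : Type*} [AddCommGroup V'] [Module ℂ V']

/-- `V = L₀ ⊕ L₁`, the product respects the grading, and the graded Leibniz identity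
`[x,[y,z]] = [[x,y],z] - (-1)^{αβ} [[x,z],y]` holds for all `x`, `y ∈ L_α`, `z ∈ L_β`. -/
structure IsLeibnizSuperalgebra (L : SuperProduct V) : Prop where
  internal : DirectSum.IsInternal L.part
  bracket_mem : ∀ (a b : ZMod 2) (x y : V), x ∈ L.part a → y ∈ L.part b →
    L.bracket x y ∈ L.part (a + b)
  leibniz : ∀ (a b : ZMod 2) (x y z : V), y ∈ L.part a → z ∈ L.part b →
    L.bracket x (L.bracket y z) =
      L.bracket (L.bracket x y) z - (-1 : ℂ) ^ (a.val * b.val) • L.bracket (L.bracket x z) y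

/-- Isomorphism: a linear bijection of degree zero that respects the products. -/
def Isomorphic (L : SuperProduct V) (L' : SuperProduct V') : Prop :=
  ∃ f : V ≃ₗ[ℂ] V',
    (∀ (a : ZMod 2) (x : V), x ∈ L.part a → f x ∈ L'.part a) ∧
    ∀ x y : V, f (L.bracket x y) = L'.bracket (f x) (f y)

/-- The descending central sequence: `L^1 = L`, `L^{k+1} = [L^k, L]` (span of the products).
The value at `0` is a convention and is never used. -/
def central (L : SuperProduct V) : ℕ → Submodule ℂ V
  | 0 => ⊤
  | 1 => ⊤
  | k + 2 => Submodule.map₂ L.bracket (central L (k + 1)) ⊤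

/-- `L` is nilpotent with index of nilpotency `N`, the least `s ≥ 1` with `L^s = 0`. -/
def HasNilindex (L : SuperProduct V) (N : ℕ) : Prop :=
  IsLeast {s : ℕ | 1 ≤ s ∧ L.central s = ⊥} N

/-- The right multiplication `R_x : u ↦ [u, x]`. -/
def rightMul (L : SuperProduct V) (x : V) : V →ₗ[ℂ] V := L.bracket.flip x

end SuperProduct

/-- `W` is `f`-invariant, `f` is nilpotent on `W`, and `l` is the descending sequence of the
dimensions of the Jordan blocks of `f` on `W`: there is a basis of `W` made of chains
`b_{i,0} ↦ b_{i,1} ↦ ⋯ ↦ b_{i,l_i-1} ↦ 0`. -/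
def HasJordanType {V : Type*} [AddCommGroup V] [Module ℂ V] (f : V →ₗ[ℂ] V)
    (W : Submodule ℂ V) (l : List ℕ) : Prop :=
  l.Pairwise (· ≥ ·) ∧ (∀ k ∈ l, 0 < k) ∧
  ∃ b : Module.Basis (Σ i : Fin l.length, Fin (l.get i)) ℂ W,
    ∀ (i : Fin l.length) (k : Fin (l.get i)),
      f (b ⟨i, k⟩ : W) =
        if h : (k : ℕ) + 1 < l.get i then ((b ⟨i, ⟨(k : ℕ) + 1, h⟩⟩ : W) : V) else 0

/-- `c` is the greatest element of the set `S` in the lexicographic order. -/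
def IsLexGreatest (S : Set (List ℕ)) (c : List ℕ) : Prop :=
  c ∈ S ∧ ∀ l ∈ S, l = c ∨ List.Lex (· < ·) l c

namespace SuperProduct

variable {V : Type*} [AddCommGroup V] [Module ℂ V]

/-- The sequences `C_a(x)` of dimensions of the Jordan blocks of `R_x` on `L_a`, where `x` runs
through `L₀ \ [L₀, L₀]`. -/
def jordanTypes (L : SuperProduct V) (a : ZMod 2) : Set (List ℕ) :=
  {l | ∃ x ∈ L.part 0, x ∉ Submodule.map₂ L.bracket (L.part 0) (L.part 0) ∧
    HasJordanType (L.rightMul x) (L.part a) l}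

/-- The characteristic sequence of `L` is `(c₀ | c₁)`. -/
def HasCharSeq (L : SuperProduct V) (c₀ c₁ : List ℕ) : Prop :=
  IsLexGreatest (L.jordanTypes 0) c₀ ∧ IsLexGreatest (L.jordanTypes 1) c₁

/-- `L` is a Leibniz superalgebra with `dim L₀ = n`, `dim L₁ = m`, characteristic sequence
`(n | m - 1, 1)` and nilindex `n + m`. -/
structure InClass (L : SuperProduct V) (n m : ℕ) : Prop where
  isLeibniz : L.IsLeibnizSuperalgebra
  finrank_even : Module.finrank ℂ (L.part 0) = n
  finrank_odd : Module.finrank ℂ (L.part 1) = m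
  charSeq : L.HasCharSeq [n] [m - 1, 1]
  nilindex : L.HasNilindex (n + m)

end SuperProduct

/-! ### The superalgebras `L(γ, β_{[(n+4)/2]}, …, β_n, β)` -/

namespace LeibFamily

/-- Index set of the basis `x_1, …, x_n` (left summand), `y_1, …, y_{n+1}` (right summand). -/
abbrev Idx (n : ℕ) : Type := Fin n ⊕ Fin (n + 1)

/-- The underlying space, of dimension `n + (n + 1)`. -/
abbrev Space (n : ℕ) : Type := Idx n → ℂ

/-- The basis vector `x_k`, `1 ≤ k ≤ n` (zero for other `k`). -/
def X (n k : ℕ) : Space n :=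
  Sum.elim (fun i => if (i : ℕ) + 1 = k then 1 else 0) (fun _ => 0)

/-- The basis vector `y_k`, `1 ≤ k ≤ n + 1` (zero for other `k`). -/
def Y (n k : ℕ) : Space n :=
  Sum.elim (fun _ => 0) (fun j => if (j : ℕ) + 1 = k then 1 else 0)

/-- `[x_i, x_k]`. -/
def mulXX (n i k : ℕ) : Space n :=
  if k = 1 ∧ i ≤ n - 1 then X n (i + 1) else 0

/-- `[y_j, x_k]`. -/
def mulYX (n j k : ℕ) : Space n :=
  if k = 1 ∧ j ≤ n - 1 then Y n (j + 1) else 0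

/-- `[x_i, y_l]`, where `b k` stands for `β_k`. -/
noncomputable def mulXY (n : ℕ) (b : ℕ → ℂ) (i l : ℕ) : Space n :=
  if l = 1 ∧ i ≤ n - 1 then (1 / 2 : ℂ) • Y n (i + 1)
  else if l = n + 1 ∧ i ≤ (n - 1) / 2 then
    ∑ k ∈ Finset.Icc ((n + 4) / 2) (n + 1 - i), b k • Y n (k - 1 + i)
  else 0

/-- `[y_j, y_l]`, where `b k` stands for `β_k`. -/
noncomputable def mulYY (n : ℕ) (γ : ℂ) (b : ℕ → ℂ) (β : ℂ) (j l : ℕ) : Space n :=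
  if l = 1 ∧ j ≤ n then X n j
  else if l = n + 1 ∧ j = n + 1 then γ • X n n
  else if l = n + 1 ∧ j = 1 then
    (-2 : ℂ) • (∑ k ∈ Finset.Icc ((n + 4) / 2) n, b k • X n (k - 1)) + β • X n n
  else if l = n + 1 ∧ 2 ≤ j ∧ j ≤ (n + 1) / 2 then
    (-2 : ℂ) • (∑ k ∈ Finset.Icc ((n + 4) / 2) (n + 2 - j), b k • X n (k - 2 + j))
  else 0

/-- The multiplication table on the basis. -/
noncomputable def table (n : ℕ) (γ : ℂ) (b : ℕ → ℂ) (β : ℂ) : Idx n → Idx n → Space n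
  | Sum.inl i, Sum.inl k => mulXX n (i + 1) (k + 1)
  | Sum.inr j, Sum.inl k => mulYX n (j + 1) (k + 1)
  | Sum.inl i, Sum.inr l => mulXY n b (i + 1) (l + 1)
  | Sum.inr j, Sum.inr l => mulYY n γ b β (j + 1) (l + 1)

/-- The superalgebra `L(γ, β_{[(n+4)/2]}, …, β_n, β)`, with `β_k = b k`. Only the values `b k`
with `[(n+4)/2] ≤ k ≤ n` enter. The even part is the span of the `x_i`, the odd part that of
the `y_j`. -/
noncomputable def algebra (n : ℕ) (γ : ℂ) (b : ℕ → ℂ) (β : ℂ) : SuperProduct (Space n) where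
  part a := if a = 0 then Submodule.span ℂ (Set.range fun i : Fin n => X n (i + 1))
    else Submodule.span ℂ (Set.range fun j : Fin (n + 1) => Y n (j + 1))
  bracket := (Pi.basisFun ℂ (Idx n)).constr ℂ fun s =>
    (Pi.basisFun ℂ (Idx n)).constr ℂ fun t => table n γ b β s t

/-- `L(p)` for a parameter vector `p = (γ, β_{[(n+4)/2]}, …, β_n, β)`, whose entries are numbered
`p 0, p 1, …, p [(n+1)/2]`. -/
noncomputable def L (n : ℕ) (p : ℕ → ℂ) : SuperProduct (Space n) :=
  algebra n (p 0) (fun k => p (k + 1 - (n + 4) / 2)) (p ((n + 1) / 2))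

/-! ### Normalised parameter vectors

A `k`-dimensional vector is written as a function `v : ℕ → ℂ`, with coordinates
`v 1, …, v k` and with value zero elsewhere. -/

/-- `S_{m,t} = cos (2πm/t) + i sin (2πm/t) = exp (2πim/t)`. -/
noncomputable def S (m t : ℕ) : ℂ :=
  Complex.exp (2 * (Real.pi : ℂ) * Complex.I * ((m : ℂ) / (t : ℂ)))

/-- `V⁰_{j,k}(α)` with sign `δ`; `δ ^ (1 / j)` is the principal `j`-th root of `δ`.
For `j = k + 1` this is the zero vector, and likewise for `V¹`, `V²`. -/
noncomputable def V0 (δ : ℂ) (m j k : ℕ) (α : ℕ → ℂ) (i : ℕ) : ℂ :=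
  if k < i ∨ i < j then 0
  else if i = j then 1
  else δ * (δ ^ (1 / (j : ℂ)) * S m j) ^ i * α i

/-- `V¹_{j,k}(α)`. -/
noncomputable def V1 (m j k : ℕ) (α : ℕ → ℂ) (i : ℕ) : ℂ :=
  if k < i ∨ i < j then 0
  else if i = j then 1
  else S m j ^ i * α i

/-- `V²_{j,k}(α)`. -/
noncomputable def V2 (m j k : ℕ) (α : ℕ → ℂ) (i : ℕ) : ℂ :=
  if k < i ∨ i < j then 0
  else if i = j then 1
  else S m (2 * j - 1) ^ (2 * i - 1) * α i

/-- `W_{s,k}` applied to a vector with first nonzero coordinate number `j`, equal to one: the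
result has a second coordinate one in position `j + s`, and only zeros between the two. For
`s = k + 1 - j` it is the `j`-th unit vector. -/
noncomputable def W (m s j k : ℕ) (α : ℕ → ℂ) (i : ℕ) : ℂ :=
  if k < i ∨ i < j then 0
  else if i = j then 1
  else if i < j + s then 0
  else if i = j + s then 1
  else S m s ^ (i - (j + s)) * α i

/-- The parameter vector `(g, c, v)`. -/
def pvec2 (g c : ℂ) (v : ℕ → ℂ) : ℕ → ℂ
  | 0 => g
  | 1 => c
  | i + 2 => v (i + 1)

/-- The parameter vector `(g, v)`. -/
def pvec1 (g : ℂ) (v : ℕ → ℂ) : ℕ → ℂ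
  | 0 => g
  | i + 1 => v (i + 1)

/-! ### The list

One entry of the list is the finite set of the parameter vectors that arise from fixed `j`, `s`
and `α` by the choices of the root of unity (number `m`) and of the sign `δ`. -/

/-- The list for `n = 2q - 1`. -/
def oddList (q : ℕ) : Set (Set (ℕ → ℂ)) :=
  {C | ∃ (b : ℂ) (j : ℕ) (α : ℕ → ℂ), b ≠ 1 / 2 ∧ b ≠ -(1 / 2) ∧ 1 ≤ j ∧ j ≤ q - 1 ∧
    C = {p | ∃ (δ : ℂ) (m : ℕ), (δ = 1 ∨ δ = -1) ∧ m < j ∧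
      p = pvec2 1 (δ * b) (V0 δ m j (q - 2) α)}} ∪
  {C | ∃ (j : ℕ) (α : ℕ → ℂ), 1 ≤ j ∧ j ≤ q ∧
    C = {p | ∃ (δ : ℂ) (m : ℕ), (δ = 1 ∨ δ = -1) ∧ m < j ∧
      p = pvec2 1 (δ * (1 / 2)) (V0 δ m j (q - 1) α)}} ∪
  {C | ∃ (j : ℕ) (α : ℕ → ℂ), 1 ≤ j ∧ j ≤ q - 1 ∧
    C = {p | ∃ m : ℕ, m < j ∧ p = pvec2 0 1 (V1 m j (q - 2) α)}} ∪
  {C | ∃ (j s : ℕ) (α : ℕ → ℂ), 1 ≤ j ∧ j ≤ q - 1 ∧ 1 ≤ s ∧ s ≤ q - j ∧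
    C = {p | ∃ m : ℕ, m < s ∧ p = pvec2 0 0 (W m s j (q - 1) α)}} ∪
  {{fun _ => 0}}

/-- The list for `n = 2q`. -/
def evenList (q : ℕ) : Set (Set (ℕ → ℂ)) :=
  {C | ∃ (j : ℕ) (α : ℕ → ℂ), 1 ≤ j ∧ j ≤ q ∧
    C = {p | ∃ m : ℕ, m < 2 * j - 1 ∧ p = pvec1 1 (V2 m j (q - 1) α)}} ∪
  {C | ∃ (j s : ℕ) (α : ℕ → ℂ), 1 ≤ j ∧ j ≤ q ∧ 1 ≤ s ∧ s ≤ q + 1 - j ∧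
    C = {p | ∃ m : ℕ, m < s ∧ p = pvec1 0 (W m s j q α)}} ∪
  {{fun _ => 0}}

/-- The list for `n`: `oddList q` if `n = 2q - 1`, `evenList q` if `n = 2q`. -/
noncomputable def list (n : ℕ) : Set (Set (ℕ → ℂ)) :=
  open Classical in if Odd n then oddList ((n + 1) / 2) else evenList (n / 2)

end LeibFamily

/-! Write R_u for right multiplication by u. A superalgebra of the class is generated by two odd
elements y, y'. The vectors y, R_y y, …, R_y^{2n-1} y together with y' form a basis, and [y',y] = 0,
[y,y'] = P(R_y) y with P odd, [y',y'] = g R_y^{2n-1} y. The Leibniz identity gives R_{[y,y]} = 2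
R_y², makes right multiplication by R_y^i y vanish for i ≥ 2, and, because [y',y] = 0, makes R_{y'}
anticommute with R_y. Hence the cyclic part is ℂ[X]/(X^{2n}), where R_y is multiplication by X and
R_{y'} is f(X) ↦ f(-X) P(X). Since [y',y'] acts as zero, R_{y'}² = 0, so X^{2n} divides P² and X^n
divides P. The scalar g and the coefficients of P in the odd degrees from n to 2n - 1 therefore
determine the superalgebra (`IsPresentedBy.isomorphic`), and the given family realises all of them
(`LeibFamily.isPresentedBy`).

The hard step is to find y (`IsEvenGenerator.exists_bracket_self`). The characteristic sequence
yields an even x for which L_0 is cyclic under R_x. If no odd square had a component along x, every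
odd y would satisfy R_y² = 0. Nilindex 2n + 1 in dimension 2n + 1 forces L/L² to be a plane and all
later quotients of the central sequence to be lines; the chain y, [y,x], [[y,x],x], … followed to
the place where it drops out of its level then makes two consecutive terms of the sequence equal, a
contradiction.

A change of generators is essentially z = A y + B y', z' = D y'. As R_z² = A² R_y², the numbers A
and D only rescale the parameters, while B moves only the last coefficient of P, by a multiple of g
(n even) or of g - q_0² (n odd), where q_0 is the lowest coefficient (`IsPresentedBy.paramRel`,
`IsPresentedBy.of_paramRel`). Isomorphism thus becomes an explicit equivalence of parameter vectors.
To normalise, B clears the last coordinate whenever its multiplier is nonzero, and the scalings make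
the leading coordinates one. What remains is a root of unity and, in some cases, a sign. Each entry
of the list is precisely the set of normal vectors in one equivalence class, which gives both
irredundancy and completeness (`rel_iff_eq`, `exists_mem_list`). -/

/-! ### Cyclic subspaces as images of polynomials -/

open Polynomial in
/-- Vectors of the cyclic subspace of an endomorphism, in terms of polynomials. -/
noncomputable def cyclicMap {V : Type*} [AddCommGroup V] [Module ℂ V] (b : V →ₗ[ℂ] V) (y : V) :
    ℂ[X] →ₗ[ℂ] V :=
  LinearMap.applyₗ y ∘ₗ (aeval (R := ℂ) b).toLinearMap

section Cyclic

open Polynomial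

variable {V : Type*} [AddCommGroup V] [Module ℂ V] (b : V →ₗ[ℂ] V) (y : V)

theorem cyclicMap_apply (f : ℂ[X]) : cyclicMap b y f = aeval b f y := rfl

theorem cyclicMap_mul (f g : ℂ[X]) : cyclicMap b y (f * g) = aeval b f (cyclicMap b y g) := by
  simp [cyclicMap_apply]

theorem cyclicMap_X_pow_mul (k : ℕ) (f : ℂ[X]) :
    cyclicMap b y (X ^ k * f) = (b ^ k) (cyclicMap b y f) := by
  simp [cyclicMap_mul]

theorem cyclicMap_X_mul (f : ℂ[X]) : cyclicMap b y (X * f) = b (cyclicMap b y f) := by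
  simp [cyclicMap_mul]

theorem cyclicMap_X_pow (k : ℕ) : cyclicMap b y (X ^ k) = (b ^ k) y := by
  simp [cyclicMap_apply]

theorem cyclicMap_one : cyclicMap b y 1 = y := by simp [cyclicMap_apply]

theorem cyclicMap_C_mul (c : ℂ) (f : ℂ[X]) : cyclicMap b y (C c * f) = c • cyclicMap b y f := by
  rw [← smul_eq_C_mul, map_smul]

theorem cyclicMap_eq_zero_of_dvd {N : ℕ} (h : (b ^ N) y = 0) {f : ℂ[X]} (hf : X ^ N ∣ f) :
    cyclicMap b y f = 0 := by
  obtain ⟨g, rfl⟩ := hf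
  rw [mul_comm, cyclicMap_mul, cyclicMap_X_pow, h, map_zero]

/-- If d is the order of f, applying b^(N-1-d) leaves only the lowest coefficient of f, times the
nonzero vector b^(N-1) y. Together with the preceding lemma, the annihilator of y is the ideal
(X^N). -/
theorem dvd_of_cyclicMap_eq_zero {N : ℕ} (h : (b ^ N) y = 0) (h' : (b ^ (N - 1)) y ≠ 0) {f : ℂ[X]}
    (hf : cyclicMap b y f = 0) : X ^ N ∣ f := by
  rw [X_pow_dvd_iff]
  intro d
  induction d using Nat.strong_induction_on with
  | _ d ih =>
    intro hd
    have hdvd : X ^ d ∣ f := X_pow_dvd_iff.2 fun e he => ih e he (he.trans hd)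
    obtain ⟨g, rfl⟩ := hdvd
    have h1 : (b ^ (N - 1 - d)) (cyclicMap b y (X ^ d * g)) = 0 := by rw [hf, map_zero]
    rw [← cyclicMap_X_pow_mul, ← mul_assoc, ← pow_add, Nat.sub_add_cancel (by omega)] at h1
    have h2 : X ^ (N - 1) * g = C (g.coeff 0) * X ^ (N - 1) + X ^ N * g.divX := by
      conv_lhs => rw [← divX_mul_X_add g]
      have : X ^ N = X ^ (N - 1) * (X : ℂ[X]) := by rw [← pow_succ]; congr 1; omega
      rw [this]; ring
    rw [h2, map_add, cyclicMap_C_mul, cyclicMap_X_pow,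
      cyclicMap_eq_zero_of_dvd b y h (dvd_mul_right _ _), add_zero] at h1
    rw [coeff_X_pow_mul', if_pos le_rfl, Nat.sub_self]
    exact (smul_eq_zero.1 h1).resolve_right h'

/-- On a cyclic nilpotent module the kernel of b is the line of the last chain vector. -/
theorem cyclicMap_eq_smul_of_apply_eq_zero {N : ℕ} (hN : 0 < N) (h : (b ^ N) y = 0)
    (h' : (b ^ (N - 1)) y ≠ 0) {f : ℂ[X]} (hf : b (cyclicMap b y f) = 0) :
    X ^ (N - 1) ∣ f ∧ cyclicMap b y f = f.coeff (N - 1) • (b ^ (N - 1)) y := by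
  have hXN : X ^ N = X ^ (N - 1) * (X : ℂ[X]) := by rw [← pow_succ]; congr 1; omega
  rw [← cyclicMap_X_mul] at hf
  have e1 := dvd_of_cyclicMap_eq_zero b y h h' hf
  rw [hXN, mul_comm, mul_dvd_mul_iff_left X_ne_zero] at e1
  obtain ⟨r, rfl⟩ := e1
  have e2 : X ^ (N - 1) * r = C (r.coeff 0) * X ^ (N - 1) + X ^ N * r.divX := by
    conv_lhs => rw [← divX_mul_X_add r]
    rw [hXN]; ring
  refine ⟨dvd_mul_right _ _, ?_⟩
  rw [coeff_X_pow_mul', if_pos le_rfl, Nat.sub_self, e2, map_add,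
    cyclicMap_eq_zero_of_dvd b y h (dvd_mul_right _ _), add_zero, cyclicMap_C_mul, cyclicMap_X_pow]

end Cyclic

/-! ### Consequences of the graded Leibniz identity -/

namespace SuperProduct

section General

variable {V : Type*} [AddCommGroup V] [Module ℂ V] {L : SuperProduct V}

@[simp] theorem rightMul_apply (x u : V) : L.rightMul x u = L.bracket u x := rfl

namespace IsLeibnizSuperalgebra

theorem isCompl (h : L.IsLeibnizSuperalgebra) : IsCompl (L.part 0) (L.part 1) :=
  (DirectSum.isInternal_submodule_iff_isCompl L.part (i := 0) (j := 1) (by decide)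
    (Set.eq_univ_of_forall (by decide)).symm).1 h.internal

theorem exists_add (h : L.IsLeibnizSuperalgebra) (v : V) :
    ∃ v₀ ∈ L.part 0, ∃ v₁ ∈ L.part 1, v₀ + v₁ = v := by
  have : v ∈ L.part 0 ⊔ L.part 1 := by rw [h.isCompl.sup_eq_top]; trivial
  exact Submodule.mem_sup.1 this

theorem eq_zero_of_mem (h : L.IsLeibnizSuperalgebra) {v : V} (h0 : v ∈ L.part 0)
    (h1 : v ∈ L.part 1) : v = 0 :=
  Submodule.disjoint_def.1 h.isCompl.disjoint v h0 h1

theorem eq_and_eq (h : L.IsLeibnizSuperalgebra) {u u' v v' : V} (hu : u ∈ L.part 0)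
    (hu' : u' ∈ L.part 0) (hv : v ∈ L.part 1) (hv' : v' ∈ L.part 1) (e : u + v = u' + v') :
    u = u' ∧ v = v' := by
  have e' : u - u' = v' - v := by
    rw [sub_eq_sub_iff_add_eq_add, e, add_comm]
  have h0 := h.eq_zero_of_mem (sub_mem hu hu') (e' ▸ sub_mem hv' hv)
  exact ⟨sub_eq_zero.1 h0, (sub_eq_zero.1 (e' ▸ h0)).symm⟩

theorem mem00 (h : L.IsLeibnizSuperalgebra) {x y : V} (hx : x ∈ L.part 0) (hy : y ∈ L.part 0) :
    L.bracket x y ∈ L.part 0 := h.bracket_mem 0 0 x y hx hy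

theorem mem01 (h : L.IsLeibnizSuperalgebra) {x y : V} (hx : x ∈ L.part 0) (hy : y ∈ L.part 1) :
    L.bracket x y ∈ L.part 1 := h.bracket_mem 0 1 x y hx hy

theorem mem10 (h : L.IsLeibnizSuperalgebra) {x y : V} (hx : x ∈ L.part 1) (hy : y ∈ L.part 0) :
    L.bracket x y ∈ L.part 1 := h.bracket_mem 1 0 x y hx hy

theorem mem11 (h : L.IsLeibnizSuperalgebra) {x y : V} (hx : x ∈ L.part 1) (hy : y ∈ L.part 1) :
    L.bracket x y ∈ L.part 0 := h.bracket_mem 1 1 x y hx hy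

theorem leibniz_even_left (h : L.IsLeibnizSuperalgebra) (x : V) {y : V} (z : V)
    (hy : y ∈ L.part 0) :
    L.bracket x (L.bracket y z) = L.bracket (L.bracket x y) z - L.bracket (L.bracket x z) y := by
  obtain ⟨z₀, h0, z₁, h1, rfl⟩ := h.exists_add z
  have e0 := h.leibniz 0 0 x y z₀ hy h0
  have e1 := h.leibniz 0 1 x y z₁ hy h1
  simp only [ZMod.val_zero, zero_mul, pow_zero, one_smul] at e0 e1
  simp only [map_add, LinearMap.add_apply, e0, e1]
  abel

theorem leibniz_even_right (h : L.IsLeibnizSuperalgebra) (x y : V) {z : V}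
    (hz : z ∈ L.part 0) :
    L.bracket x (L.bracket y z) = L.bracket (L.bracket x y) z - L.bracket (L.bracket x z) y := by
  obtain ⟨z₀, h0, z₁, h1, rfl⟩ := h.exists_add y
  have e0 := h.leibniz 0 0 x z₀ z h0 hz
  have e1 := h.leibniz 1 0 x z₁ z h1 hz
  simp only [ZMod.val_zero, mul_zero, pow_zero, one_smul] at e0 e1
  simp only [map_add, LinearMap.add_apply, e0, e1]
  abel

theorem leibniz_odd (h : L.IsLeibnizSuperalgebra) (x : V) {y z : V} (hy : y ∈ L.part 1)
    (hz : z ∈ L.part 1) :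
    L.bracket x (L.bracket y z) = L.bracket (L.bracket x y) z + L.bracket (L.bracket x z) y := by
  have e1 := h.leibniz 1 1 x y z hy hz
  have : (1 : ZMod 2).val * (1 : ZMod 2).val = 1 := by decide
  rw [this] at e1
  simpa using e1

theorem bracket_sq (h : L.IsLeibnizSuperalgebra) (u : V) {y : V} (hy : y ∈ L.part 1) :
    L.bracket u (L.bracket y y) = (2 : ℂ) • L.bracket (L.bracket u y) y := by
  rw [h.leibniz_odd u hy hy, two_smul]

/-- Leibniz identity for the even element [y,y], whose right multiplication is 2 R_y², divided by
two. -/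
theorem bracket_rightMul_sq (h : L.IsLeibnizSuperalgebra) {y : V} (hy : y ∈ L.part 1) (u v : V) :
    L.bracket u (L.bracket (L.bracket v y) y) =
      L.bracket (L.bracket (L.bracket u v) y) y - L.bracket (L.bracket (L.bracket u y) y) v := by
  have e := h.leibniz_even_right u v (h.mem11 hy hy)
  simp only [h.bracket_sq _ hy, map_smul, LinearMap.smul_apply, ← smul_sub] at e
  exact smul_right_injective V (two_ne_zero (α := ℂ)) e

/-- With v = R_y^k y, `bracket_rightMul_sq` expresses right multiplication by R_y^(k+2) y as the
commutator of R_v with R_y². It vanishes for k = 0 and k = 1 because R_v is R_y or 2 R_y², and for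
larger k because R_v is zero by induction. -/
theorem bracket_pow (h : L.IsLeibnizSuperalgebra) {y : V} (hy : y ∈ L.part 1) (u : V) {i : ℕ}
    (hi : 2 ≤ i) : L.bracket u ((L.rightMul y ^ i) y) = 0 := by
  induction i using Nat.strong_induction_on generalizing u with
  | _ i ih =>
    obtain ⟨k, rfl⟩ := Nat.exists_eq_add_of_le' hi
    rw [pow_succ', pow_succ', Module.End.mul_apply, Module.End.mul_apply, rightMul_apply,
      rightMul_apply, h.bracket_rightMul_sq hy]
    match k, ih with
    | 0, _ => simp
    | 1, _ => simp [h.bracket_sq _ hy]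
    | k + 2, ih =>
      rw [ih (k + 2) (by omega) _ (by omega), ih (k + 2) (by omega) _ (by omega)]
      simp

theorem pow_mem_even (h : L.IsLeibnizSuperalgebra) {y : V} (hy : y ∈ L.part 1) (i : ℕ) :
    (L.rightMul y ^ (2 * i)) y ∈ L.part 1 ∧ (L.rightMul y ^ (2 * i + 1)) y ∈ L.part 0 := by
  induction i with
  | zero => exact ⟨by simpa using hy, by simpa using h.mem11 hy hy⟩
  | succ i ih =>
    have h1 : (L.rightMul y ^ (2 * (i + 1))) y ∈ L.part 1 := by
      rw [show 2 * (i + 1) = (2 * i + 1) + 1 by ring, pow_succ', Module.End.mul_apply]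
      exact h.mem01 ih.2 hy
    refine ⟨h1, ?_⟩
    rw [pow_succ', Module.End.mul_apply]
    exact h.mem11 h1 hy

end IsLeibnizSuperalgebra

end General

-- Moving R_{y'} past f(R_y) turns it into f(-R_y), and what is left is R_{y'} y = P(R_y) y.
open Polynomial in
theorem bracket_cyclicMap_of_anticomm {V : Type*} [AddCommGroup V] [Module ℂ V]
    {L : SuperProduct V} {y y' : V} {P : ℂ[X]}
    (h : ∀ u, L.bracket (L.bracket u y) y' = -L.bracket (L.bracket u y') y)
    (hP : L.bracket y y' = cyclicMap (L.rightMul y) y P) (f : ℂ[X]) :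
    L.bracket (cyclicMap (L.rightMul y) y f) y' =
      cyclicMap (L.rightMul y) y (f.comp (-X) * P) := by
  induction f using Polynomial.induction_on with
  | C a => rw [C_comp, cyclicMap_C_mul, ← hP, ← mul_one (C a), cyclicMap_C_mul,
      cyclicMap_one, map_smul, LinearMap.smul_apply]
  | add p r hp hr => simp only [map_add, LinearMap.add_apply, add_comp, add_mul, hp, hr]
  | monomial k a ih =>
    have e : C a * X ^ (k + 1) = X * (C a * X ^ k) := by ring
    rw [e, cyclicMap_X_mul, rightMul_apply, h, ih, ← rightMul_apply, ← cyclicMap_X_mul,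
      mul_comp X, X_comp, mul_comp, ← map_neg]
    congr 1; ring

/-! ### Odd polynomials with exponents between n and 2n - 1 -/

open Polynomial in
/-- The odd polynomial with coefficients `q 0, q 1, …` in degrees `2 [n/2] + 1 + 2 i`. -/
noncomputable def oddPoly (n : ℕ) (q : ℕ → ℂ) : ℂ[X] :=
  ∑ i ∈ Finset.range ((n + 1) / 2), C (q i) * X ^ (2 * (n / 2) + 1 + 2 * i)

section OddPoly

open Polynomial

variable (n : ℕ) (q : ℕ → ℂ)

theorem oddPoly_comp_neg : (oddPoly n q).comp (-X) = -oddPoly n q := by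
  simp only [oddPoly, ← Finset.sum_neg_distrib]
  rw [← coe_compRingHom_apply, map_sum]
  refine Finset.sum_congr rfl fun i _ => ?_
  rw [coe_compRingHom_apply, mul_comp, C_comp, X_pow_comp, Odd.neg_pow ⟨n / 2 + i, by ring⟩]; ring

theorem X_pow_dvd_oddPoly {k : ℕ} (hk : k ≤ 2 * (n / 2) + 1) : X ^ k ∣ oddPoly n q :=
  Finset.dvd_sum fun i _ => (pow_dvd_pow _ (by omega)).mul_left _

/-- All exponents are at least n. This is the reason for R_{y'}² = 0. -/
theorem X_pow_dvd_oddPoly_mul (q' : ℕ → ℂ) : X ^ (2 * n) ∣ oddPoly n q * oddPoly n q' := by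
  rw [two_mul, pow_add]
  exact mul_dvd_mul (X_pow_dvd_oddPoly n q (by omega)) (X_pow_dvd_oddPoly n q' (by omega))

theorem coeff_oddPoly {k : ℕ} (hk : k < 2 * n) :
    (oddPoly n q).coeff k =
      if Odd k ∧ n ≤ k then q ((k - (2 * (n / 2) + 1)) / 2) else 0 := by
  rw [oddPoly, finsetSum_coeff]
  simp only [coeff_C_mul_X_pow]
  split_ifs with h
  · obtain ⟨⟨m, rfl⟩, h2⟩ := h
    rw [Finset.sum_eq_single (m - n / 2)]
    · rw [if_pos (by omega)]
      congr 1; omega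
    · intro i _ hi
      rw [if_neg (by omega)]
    · intro hm
      rw [Finset.mem_range] at hm
      omega
  · refine Finset.sum_eq_zero fun i _ => if_neg ?_
    rintro rfl
    exact h ⟨⟨n / 2 + i, by ring⟩, by omega⟩

/-- The exponents 2 [n/2] + 1 + 2 i with i < [(n+1)/2] are exactly the odd numbers from n to 2n - 1,
for either parity of n. -/
theorem X_pow_dvd_sub_oddPoly {P : ℂ[X]} (hP : ∀ k, Even k → P.coeff k = 0) (hn : X ^ n ∣ P) :
    X ^ (2 * n) ∣ P - oddPoly n fun i => P.coeff (2 * (n / 2) + 1 + 2 * i) := by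
  rw [X_pow_dvd_iff]
  intro k hk
  rw [coeff_sub, coeff_oddPoly n _ hk]
  split_ifs with h
  · obtain ⟨⟨m, rfl⟩, h2⟩ := h
    rw [sub_eq_zero]
    congr 1; omega
  · rw [sub_zero]
    rcases Nat.even_or_odd k with h1 | h1
    · exact hP k h1
    · exact X_pow_dvd_iff.1 hn k (by by_contra h2; exact h ⟨h1, by omega⟩)

end OddPoly

/-! ### Presentations by two odd generators -/

/-- `L` is generated by the odd elements `y`, `y'`, and its multiplication is determined by the
scalars `g`, `q 0, q 1, …` through the action of `R_y` and `R_{y'}` on the generators. -/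
structure IsPresentedBy {V : Type*} [AddCommGroup V] [Module ℂ V] (L : SuperProduct V) (n : ℕ)
    (g : ℂ) (q : ℕ → ℂ) (y y' : V) : Prop where
  isLeibniz : L.IsLeibnizSuperalgebra
  finrank_eq : Module.finrank ℂ V = 2 * n + 1
  mem : y ∈ L.part 1
  mem' : y' ∈ L.part 1
  ne_zero : y' ≠ 0
  bracket_eq_zero : L.bracket y' y = 0
  pow_eq_zero : (L.rightMul y ^ (2 * n)) y = 0
  pow_ne_zero : (L.rightMul y ^ (2 * n - 1)) y ≠ 0
  bracket_left : L.bracket y y' = cyclicMap (L.rightMul y) y (oddPoly n q)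
  bracket_right : L.bracket y' y' = g • (L.rightMul y ^ (2 * n - 1)) y

namespace IsPresentedBy

open Polynomial

variable {V : Type*} [AddCommGroup V] [Module ℂ V] {L : SuperProduct V} {n : ℕ} {g : ℂ}
  {q : ℕ → ℂ} {y y' : V}

theorem anticomm (h : L.IsPresentedBy n g q y y') (u : V) :
    L.bracket (L.bracket u y) y' = -L.bracket (L.bracket u y') y := by
  have e := h.isLeibniz.leibniz_odd u h.mem' h.mem
  rw [h.bracket_eq_zero, map_zero] at e
  exact eq_neg_of_add_eq_zero_right e.symm

theorem bracket_cyclicMap (h : L.IsPresentedBy n g q y y') (f : ℂ[X]) :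
    L.bracket (cyclicMap (L.rightMul y) y f) y' =
      cyclicMap (L.rightMul y) y (f.comp (-X) * oddPoly n q) :=
  bracket_cyclicMap_of_anticomm h.anticomm h.bracket_left f

theorem cyclicMap_eq_zero_iff (h : L.IsPresentedBy n g q y y') {f : ℂ[X]} :
    cyclicMap (L.rightMul y) y f = 0 ↔ X ^ (2 * n) ∣ f :=
  ⟨dvd_of_cyclicMap_eq_zero _ _ h.pow_eq_zero h.pow_ne_zero,
    cyclicMap_eq_zero_of_dvd _ _ h.pow_eq_zero⟩

theorem pos (h : L.IsPresentedBy n g q y y') : 0 < n := by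
  rcases Nat.eq_zero_or_pos n with rfl | h0
  · have h1 := h.pow_eq_zero
    have h2 := h.pow_ne_zero
    simp at h1 h2
    exact absurd h1 h2
  · exact h0

/-- R_y kills y', so it kills the polynomial part, which is then a multiple of R_y^(2n-1) y. That
vector is even and y' is odd, so both terms vanish separately. -/
theorem indep (h : L.IsPresentedBy n g q y y') {f : ℂ[X]} {c : ℂ}
    (e : cyclicMap (L.rightMul y) y f + c • y' = 0) : X ^ (2 * n) ∣ f ∧ c = 0 := by
  have hn := h.pos
  obtain ⟨e1, e2⟩ := cyclicMap_eq_smul_of_apply_eq_zero _ _ (by omega) h.pow_eq_zero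
    h.pow_ne_zero (f := f) (by
      rw [eq_neg_of_add_eq_zero_left e]
      simp [h.bracket_eq_zero])
  rw [e2] at e
  have hm := (h.isLeibniz.pow_mem_even h.mem (n - 1)).2
  rw [show 2 * (n - 1) + 1 = 2 * n - 1 by omega] at hm
  obtain ⟨z1, z2⟩ := h.isLeibniz.eq_and_eq (Submodule.smul_mem _ (f.coeff (2 * n - 1)) hm) (zero_mem _)
    (Submodule.smul_mem _ c h.mem') (zero_mem _) (by rw [e, zero_add])
  have hr := (smul_eq_zero.1 z1).resolve_right h.pow_ne_zero
  refine ⟨?_, (smul_eq_zero.1 z2).resolve_right h.ne_zero⟩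
  rw [← h.cyclicMap_eq_zero_iff, e2, hr, zero_smul]

/-- The parametrisation of the space by a polynomial and a scalar. -/
noncomputable def paramMap (L : SuperProduct V) (y y' : V) : ℂ[X] × ℂ →ₗ[ℂ] V :=
  (cyclicMap (L.rightMul y) y).coprod (LinearMap.toSpanSingleton ℂ V y')

theorem paramMap_apply (f : ℂ[X]) (c : ℂ) :
    paramMap L y y' (f, c) = cyclicMap (L.rightMul y) y f + c • y' := by
  simp [paramMap]

theorem paramMap_eq_zero_iff (h : L.IsPresentedBy n g q y y') (p : ℂ[X] × ℂ) :
    paramMap L y y' p = 0 ↔ X ^ (2 * n) ∣ p.1 ∧ p.2 = 0 := by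
  obtain ⟨f, c⟩ := p
  rw [paramMap_apply]
  refine ⟨h.indep, fun ⟨h1, h2⟩ => ?_⟩
  rw [h.cyclicMap_eq_zero_iff.2 h1, show c = 0 from h2]; simp

/-- Restricted to polynomials of degree below 2n the map is injective between spaces of the same
dimension 2n + 1. -/
theorem paramMap_surjective (h : L.IsPresentedBy n g q y y') :
    Function.Surjective (paramMap L y y') := by
  let ψ : (Fin (2 * n) → ℂ) × ℂ →ₗ[ℂ] V := paramMap L y y' ∘ₗ
    LinearMap.prodMap ((degreeLT ℂ (2 * n)).subtype ∘ₗ (degreeLTEquiv ℂ (2 * n)).symm.toLinearMap)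
      LinearMap.id
  have hinj : Function.Injective ψ := by
    rw [← LinearMap.ker_eq_bot, LinearMap.ker_eq_bot']
    rintro ⟨v, c⟩ hv
    have hv' := (h.paramMap_eq_zero_iff _).1 hv
    obtain ⟨h1, h2⟩ := hv'
    simp only [LinearMap.prodMap_apply, LinearMap.id_apply] at h1 h2
    have h3 : (((degreeLTEquiv ℂ (2 * n)).symm v : degreeLT ℂ (2 * n)) : ℂ[X]) = 0 := by
      by_contra h0
      have hd := mem_degreeLT.1 ((degreeLTEquiv ℂ (2 * n)).symm v).2
      have := degree_le_of_dvd h1 h0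
      rw [degree_X_pow] at this
      exact absurd hd (not_lt.2 this)
    have h4 : v = 0 := by
      have : (degreeLTEquiv ℂ (2 * n)).symm v = 0 := Subtype.ext h3
      simpa using this
    rw [h4, h2]; rfl
  have : Module.Finite ℂ V := Module.finite_of_finrank_pos (by rw [h.finrank_eq]; omega)
  have hsurj := (LinearMap.injective_iff_surjective_of_finrank_eq_finrank
    (by rw [h.finrank_eq]; simp)).1 hinj
  intro v
  obtain ⟨w, hw⟩ := hsurj v
  exact ⟨_, hw⟩

theorem exists_eq (h : L.IsPresentedBy n g q y y') (v : V) :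
    ∃ (f : ℂ[X]) (c : ℂ), v = cyclicMap (L.rightMul y) y f + c • y' := by
  obtain ⟨⟨f, c⟩, rfl⟩ := h.paramMap_surjective v
  exact ⟨f, c, paramMap_apply f c⟩

/-- By `bracket_pow` only y and R_y y = [y,y] act from the right, the latter as 2 R_y². -/
theorem bracket_cyclicMap_right (h : L.IsPresentedBy n g q y y') (u : V) (f : ℂ[X]) :
    L.bracket u (cyclicMap (L.rightMul y) y f) =
      f.coeff 0 • L.bracket u y + (2 * f.coeff 1) • L.bracket (L.bracket u y) y := by
  have e : f = C (f.coeff 0) * X ^ 0 + C (f.coeff 1) * X ^ 1 + X ^ 2 * f.divX.divX := by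
    conv_lhs => rw [← divX_mul_X_add f, ← divX_mul_X_add f.divX, coeff_divX]
    ring
  have hz : ∀ r : ℂ[X], L.bracket u (cyclicMap (L.rightMul y) y (X ^ 2 * r)) = 0 := by
    intro r
    induction r using Polynomial.induction_on' with
    | add p r hp hr => rw [mul_add, map_add, map_add, hp, hr, add_zero]
    | monomial k a =>
      rw [← C_mul_X_pow_eq_monomial, mul_left_comm, ← pow_add, cyclicMap_C_mul, cyclicMap_X_pow,
        map_smul, h.isLeibniz.bracket_pow h.mem _ (by omega), smul_zero]
  conv_lhs => rw [e]
  rw [map_add, map_add, map_add, map_add, hz, cyclicMap_C_mul, cyclicMap_C_mul, cyclicMap_X_pow,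
    cyclicMap_X_pow, pow_zero, pow_one, Module.End.one_apply, rightMul_apply, map_smul, map_smul,
    h.isLeibniz.bracket_sq _ h.mem, add_zero, smul_smul, mul_comm]

theorem bracket_eq (h : L.IsPresentedBy n g q y y') (u : V) (f : ℂ[X]) (c : ℂ) :
    L.bracket u (cyclicMap (L.rightMul y) y f + c • y') =
      f.coeff 0 • L.bracket u y + (2 * f.coeff 1) • L.bracket (L.bracket u y) y +
        c • L.bracket u y' := by
  rw [map_add, h.bracket_cyclicMap_right, map_smul]

theorem cyclicMap_mem_even (h : L.IsPresentedBy n g q y y') (f : ℂ[X]) :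
    cyclicMap (L.rightMul y) y (X * expand ℂ 2 f) ∈ L.part 0 := by
  induction f using Polynomial.induction_on' with
  | add p r hp hr => rw [map_add, mul_add, map_add]; exact add_mem hp hr
  | monomial k a =>
    rw [expand_monomial, ← C_mul_X_pow_eq_monomial, mul_left_comm, ← pow_succ', mul_comm k 2, cyclicMap_C_mul, cyclicMap_X_pow]
    exact Submodule.smul_mem _ _ (h.isLeibniz.pow_mem_even h.mem k).2

theorem cyclicMap_mem_odd (h : L.IsPresentedBy n g q y y') (f : ℂ[X]) :
    cyclicMap (L.rightMul y) y (expand ℂ 2 f) ∈ L.part 1 := by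
  induction f using Polynomial.induction_on' with
  | add p r hp hr => rw [map_add, map_add]; exact add_mem hp hr
  | monomial k a =>
    rw [expand_monomial, ← C_mul_X_pow_eq_monomial, mul_comm k 2,
      cyclicMap_C_mul, cyclicMap_X_pow]
    exact Submodule.smul_mem _ _ (h.isLeibniz.pow_mem_even h.mem k).1

theorem exists_expand (f : ℂ[X]) : ∃ r s : ℂ[X], f = expand ℂ 2 r + X * expand ℂ 2 s := by
  induction f using Polynomial.induction_on' with
  | add p r hp hr =>
    obtain ⟨a, b, rfl⟩ := hp
    obtain ⟨c, d, rfl⟩ := hr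
    exact ⟨a + c, b + d, by simp only [map_add]; ring⟩
  | monomial k a =>
    rcases Nat.even_or_odd' k with ⟨m, rfl | rfl⟩
    · exact ⟨monomial m a, 0, by simp [expand_monomial, mul_comm]⟩
    · refine ⟨0, monomial m a, ?_⟩
      rw [expand_monomial, map_zero, zero_add, X_mul_monomial, mul_comm m 2]

theorem mem_even_iff (h : L.IsPresentedBy n g q y y') {v : V} :
    v ∈ L.part 0 ↔ ∃ f, v = cyclicMap (L.rightMul y) y (X * expand ℂ 2 f) := by
  refine ⟨fun hv => ?_, fun ⟨f, hf⟩ => hf ▸ h.cyclicMap_mem_even f⟩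
  obtain ⟨f, c, rfl⟩ := h.exists_eq v
  obtain ⟨r, s, rfl⟩ := exists_expand f
  refine ⟨s, (h.isLeibniz.eq_and_eq hv (h.cyclicMap_mem_even s) (zero_mem _)
    (add_mem (h.cyclicMap_mem_odd r) (Submodule.smul_mem _ c h.mem')) ?_).1⟩
  rw [map_add]; abel

theorem mem_odd_iff (h : L.IsPresentedBy n g q y y') {v : V} :
    v ∈ L.part 1 ↔ ∃ (f : ℂ[X]) (c : ℂ), v = cyclicMap (L.rightMul y) y (expand ℂ 2 f) + c • y' := by
  refine ⟨fun hv => ?_, fun ⟨f, c, hf⟩ =>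
    hf ▸ add_mem (h.cyclicMap_mem_odd f) (Submodule.smul_mem _ c h.mem')⟩
  obtain ⟨f, c, rfl⟩ := h.exists_eq v
  obtain ⟨r, s, rfl⟩ := exists_expand f
  refine ⟨r, c, (h.isLeibniz.eq_and_eq (zero_mem _) (h.cyclicMap_mem_even s) hv
    (add_mem (h.cyclicMap_mem_odd r) (Submodule.smul_mem _ c h.mem')) ?_).2⟩
  rw [map_add]; abel

/-- Superalgebras with the same presentation are isomorphic. -/
theorem isomorphic (h : L.IsPresentedBy n g q y y') {V₂ : Type*} [AddCommGroup V₂] [Module ℂ V₂]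
    {L₂ : SuperProduct V₂} {z z' : V₂} (h₂ : L₂.IsPresentedBy n g q z z') : L.Isomorphic L₂ := by
  -- Both kernels consist of the pairs (f, 0) with X^(2n) dividing f, so both spaces are the same
  -- quotient.
  have hker : LinearMap.ker (paramMap L y y') = LinearMap.ker (paramMap L₂ z z') := by
    ext p
    rw [LinearMap.mem_ker, LinearMap.mem_ker, h.paramMap_eq_zero_iff, h₂.paramMap_eq_zero_iff]
  let f : V ≃ₗ[ℂ] V₂ :=
    ((paramMap L y y').quotKerEquivOfSurjective h.paramMap_surjective).symm ≪≫ₗ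
      (Submodule.quotEquivOfEq _ _ hker) ≪≫ₗ
      ((paramMap L₂ z z').quotKerEquivOfSurjective h₂.paramMap_surjective)
  have hf : ∀ p : ℂ[X] × ℂ, f (paramMap L y y' p) = paramMap L₂ z z' p := by
    intro p
    simp [f]
  have hf' : ∀ (p : ℂ[X]), f (cyclicMap (L.rightMul y) y p) = cyclicMap (L₂.rightMul z) z p := by
    intro p
    simpa [paramMap_apply] using hf (p, 0)
  have hf2 : f y' = z' := by simpa [paramMap_apply] using hf (0, 1)
  -- By `bracket_eq` every product is expressed through R_y and R_{y'}, so compatibility with these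
  -- two operators suffices.
  have hb : ∀ u, f (L.bracket u y) = L₂.bracket (f u) z := by
    intro u
    obtain ⟨p, c, rfl⟩ := h.exists_eq u
    simp only [map_add, map_smul, LinearMap.add_apply, LinearMap.smul_apply, h.bracket_eq_zero,
      hf', hf2, h₂.bracket_eq_zero]
    rw [← rightMul_apply, ← cyclicMap_X_mul, hf', cyclicMap_X_mul, rightMul_apply]
    simp
  have hd : ∀ u, f (L.bracket u y') = L₂.bracket (f u) z' := by
    intro u
    obtain ⟨p, c, rfl⟩ := h.exists_eq u
    simp only [map_add, map_smul, LinearMap.add_apply, LinearMap.smul_apply, h.bracket_cyclicMap,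
      hf', hf2, h₂.bracket_cyclicMap, h.bracket_right, h₂.bracket_right, ← cyclicMap_X_pow]
  refine ⟨f, fun a x hx => ?_, fun u v => ?_⟩
  · fin_cases a
    · obtain ⟨p, rfl⟩ := h.mem_even_iff.1 hx
      exact h₂.mem_even_iff.2 ⟨p, hf' _⟩
    · obtain ⟨p, c, rfl⟩ := h.mem_odd_iff.1 hx
      exact h₂.mem_odd_iff.2 ⟨p, c, by rw [map_add, map_smul, hf', hf2]⟩
  · obtain ⟨p, c, rfl⟩ := h.exists_eq v
    rw [h.bracket_eq, map_add f (cyclicMap _ _ _), map_smul f c y', hf', hf2, h₂.bracket_eq]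
    simp only [map_add, map_smul, hb, hd]

end IsPresentedBy

end SuperProduct

/-! ### Jordan types and their lexicographic comparison -/

section JordanType

variable {V : Type*} [AddCommGroup V] [Module ℂ V] {f : V →ₗ[ℂ] V} {W : Submodule ℂ V}

theorem HasJordanType.sum_eq {l : List ℕ} (h : HasJordanType f W l) :
    l.sum = Module.finrank ℂ W := by
  obtain ⟨-, -, b, -⟩ := h
  rw [Module.finrank_eq_card_basis b, Fintype.card_sigma]
  simp

theorem HasJordanType.pow_apply_basis {l : List ℕ}
    {b : Module.Basis (Σ i : Fin l.length, Fin (l.get i)) ℂ W}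
    (hb : ∀ (i : Fin l.length) (k : Fin (l.get i)), f (b ⟨i, k⟩ : W) =
      if h : (k : ℕ) + 1 < l.get i then ((b ⟨i, ⟨(k : ℕ) + 1, h⟩⟩ : W) : V) else 0)
    (i : Fin l.length) (k : Fin (l.get i)) (j : ℕ) :
    (f ^ j) (b ⟨i, k⟩ : W) =
      if h : (k : ℕ) + j < l.get i then ((b ⟨i, ⟨(k : ℕ) + j, h⟩⟩ : W) : V) else 0 := by
  induction j with
  | zero => simp
  | succ j ih =>
    rw [pow_succ', Module.End.mul_apply, ih]
    by_cases h1 : (k : ℕ) + j < l.get i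
    · rw [dif_pos h1, hb]
      rfl
    · rw [dif_neg h1, dif_neg (by omega), map_zero]

theorem HasJordanType.le_of_pow_eq_zero {l : List ℕ} (h : HasJordanType f W l) {N : ℕ}
    (hN : ∀ w ∈ W, (f ^ N) w = 0) {k : ℕ} (hk : k ∈ l) : k ≤ N := by
  obtain ⟨-, hpos, b, hb⟩ := h
  obtain ⟨i, rfl⟩ := List.mem_iff_get.1 hk
  by_contra hlt
  have h1 := pow_apply_basis hb i ⟨0, hpos _ hk⟩ N
  rw [hN _ (b _).2, dif_pos (by simpa using hlt)] at h1
  exact b.ne_zero _ (Subtype.ext h1.symm)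

theorem HasJordanType.pow_eq_zero {l : List ℕ} (h : HasJordanType f W l) {N : ℕ}
    (hN : ∀ k ∈ l, k ≤ N) {w : V} (hw : w ∈ W) : (f ^ N) w = 0 := by
  obtain ⟨-, -, b, hb⟩ := h
  have : (f ^ N) ∘ₗ W.subtype = 0 := b.ext fun ⟨i, k⟩ => by
    rw [LinearMap.comp_apply, Submodule.subtype_apply, pow_apply_basis hb,
      dif_neg (by have := hN _ (List.get_mem l i); omega)]
    rfl
  exact LinearMap.congr_fun this ⟨w, hw⟩

theorem hasJordanType_singleton {n : ℕ} (hn : 0 < n) (v : ℕ → V) (hv : ∀ i, v i ∈ W)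
    (hli : LinearIndependent ℂ fun i : Fin n => v i)
    (hsp : W ≤ Submodule.span ℂ (Set.range fun i : Fin n => v i))
    (hf : ∀ i, f (v i) = v (i + 1)) (h0 : v n = 0) : HasJordanType f W [n] := by
  refine ⟨by simp, by simpa using hn, ?_⟩
  have hlt : ∀ s : Σ i : Fin [n].length, Fin ([n].get i), (s.2 : ℕ) < n := by
    rintro ⟨i, k⟩
    fin_cases i
    exact k.2
  let w : (Σ i : Fin [n].length, Fin ([n].get i)) → W := fun s => ⟨v s.2, hv _⟩
  have hwli : LinearIndependent ℂ w := by
    refine LinearIndependent.of_comp W.subtype ?_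
    refine hli.comp (fun s => ⟨s.2, hlt s⟩) ?_
    rintro ⟨i, k⟩ ⟨i', k'⟩ e
    fin_cases i; fin_cases i'
    have : k = k' := Fin.ext (Fin.mk.inj_iff.1 e)
    rw [this]
  have hwsp : ⊤ ≤ Submodule.span ℂ (Set.range w) := by
    rintro ⟨x, hx⟩ -
    have h1 := hsp hx
    have h2 : (Set.range fun i : Fin n => v i) ⊆ W.subtype '' Set.range w := by
      rintro _ ⟨i, rfl⟩
      exact ⟨w ⟨0, i⟩, ⟨_, rfl⟩, rfl⟩
    have h3 := Submodule.span_mono h2 h1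
    rw [← Submodule.map_span] at h3
    obtain ⟨x', hx', e⟩ := h3
    have : x' = ⟨x, hx⟩ := Subtype.ext e
    exact this ▸ hx'
  refine ⟨Module.Basis.mk hwli hwsp, fun i k => ?_⟩
  fin_cases i
  simp only [Module.Basis.mk_apply]
  split_ifs with hk
  · exact hf _
  · have hk2 : (k : ℕ) + 1 = n := le_antisymm k.2 (not_lt.1 hk)
    rw [show ((w ⟨⟨0, by simp⟩, k⟩ : W) : V) = v k from rfl]
    change f (v k) = 0
    rw [hf, hk2, h0]

theorem hasJordanType_pair_one {n : ℕ} (hn : 0 < n) (v : ℕ → V) (hv : ∀ i, v i ∈ W) {v' : V}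
    (hv' : v' ∈ W) (hli : LinearIndependent ℂ fun o : Option (Fin n) => o.elim v' fun i => v i)
    (hsp : W ≤ Submodule.span ℂ (Set.range fun o : Option (Fin n) => o.elim v' fun i => v i))
    (hf : ∀ i, f (v i) = v (i + 1)) (h0 : v n = 0) (hf' : f v' = 0) :
    HasJordanType f W [n, 1] := by
  refine ⟨by simpa using Nat.succ_le_of_lt hn, by simpa using hn, ?_⟩
  let e : (Σ i : Fin [n, 1].length, Fin ([n, 1].get i)) → Option (Fin n) := fun s =>
    match s with
    | ⟨⟨0, _⟩, k⟩ => some k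
    | ⟨⟨_ + 1, _⟩, _⟩ => none
  have he : Function.Injective e := by
    rintro ⟨i, k⟩ ⟨i', k'⟩ h
    fin_cases i <;> fin_cases i'
    · have : k = k' := by simpa [e] using h
      rw [this]
    · simp [e] at h
    · simp [e] at h
    · have : k = k' := @Subsingleton.elim (Fin 1) _ k k'
      rw [this]
  let w : (Σ i : Fin [n, 1].length, Fin ([n, 1].get i)) → W := fun s =>
    ⟨(e s).elim v' fun i => v i, by
      rcases e s with _ | i
      · exact hv'
      · exact hv _⟩
  have hwli : LinearIndependent ℂ w := by
    refine LinearIndependent.of_comp W.subtype ?_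
    exact hli.comp e he
  have hwsp : ⊤ ≤ Submodule.span ℂ (Set.range w) := by
    rintro ⟨x, hx⟩ -
    have h1 := hsp hx
    have h2 : (Set.range fun o : Option (Fin n) => o.elim v' fun i => v i) ⊆
        W.subtype '' Set.range w := by
      rintro _ ⟨o, rfl⟩
      rcases o with _ | i
      · let j : Σ i : Fin [n, 1].length, Fin ([n, 1].get i) := ⟨⟨1, by simp⟩, (0 : Fin 1)⟩
        exact ⟨w j, ⟨j, rfl⟩, rfl⟩
      · let j : Σ i : Fin [n, 1].length, Fin ([n, 1].get i) := ⟨⟨0, by simp⟩, i⟩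
        exact ⟨w j, ⟨j, rfl⟩, rfl⟩
    have h3 := Submodule.span_mono h2 h1
    rw [← Submodule.map_span] at h3
    obtain ⟨x', hx', e⟩ := h3
    have : x' = ⟨x, hx⟩ := Subtype.ext e
    exact this ▸ hx'
  refine ⟨Module.Basis.mk hwli hwsp, fun i k => ?_⟩
  simp only [Module.Basis.mk_apply]
  fin_cases i
  · split_ifs with hk
    · exact hf _
    · have hk2 : (k : ℕ) + 1 = n := le_antisymm k.2 (not_lt.1 hk)
      change f (v k) = 0
      rw [hf, hk2, h0]
  · rw [dif_neg]
    · exact hf'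
    · have : (k : ℕ) < 1 := k.2
      change ¬ (k : ℕ) + 1 < 1
      omega

theorem eq_nil_of_sum_eq_zero {l : List ℕ} (hpos : ∀ k ∈ l, 0 < k) (hs : l.sum = 0) : l = [] := by
  rcases l with _ | ⟨k, l⟩
  · rfl
  · have := hpos k (by simp)
    simp at hs; omega

theorem eq_or_lex_singleton {l : List ℕ} {n : ℕ} (hn : 0 < n) (hpos : ∀ k ∈ l, 0 < k)
    (hs : l.sum = n) : l = [n] ∨ List.Lex (· < ·) l [n] := by
  rcases l with _ | ⟨k, l⟩
  · simp at hs; omega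
  · rw [List.sum_cons] at hs
    rcases Nat.lt_or_ge k n with h | h
    · exact Or.inr (List.Lex.rel h)
    · have := eq_nil_of_sum_eq_zero (l := l) (fun k hk => hpos k (by simp [hk])) (by omega)
      subst this
      left; simp at hs; rw [hs]

/-- The bound on the parts excludes [n + 1], which would be larger; a first part equal to n leaves a
remainder of sum one. -/
theorem eq_or_lex_pair_one {l : List ℕ} {n : ℕ} (hpos : ∀ k ∈ l, 0 < k)
    (hle : ∀ k ∈ l, k ≤ n) (hs : l.sum = n + 1) :
    l = [n, 1] ∨ List.Lex (· < ·) l [n, 1] := by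
  rcases l with _ | ⟨k, l⟩
  · simp at hs
  · rw [List.sum_cons] at hs
    rcases Nat.lt_or_ge k n with h | h
    · exact Or.inr (List.Lex.rel h)
    · have hk := hle k (by simp)
      have hkn : k = n := le_antisymm hk h
      have hs' : l.sum = 1 := by omega
      rcases eq_or_lex_singleton one_pos (fun k hk => hpos k (by simp [hk])) hs' with rfl | h1
      · left; rw [hkn]
      · rw [hkn]; exact Or.inr (List.Lex.cons h1)

end JordanType

/-! ### Presented superalgebras belong to the class -/

namespace SuperProduct.IsPresentedBy

open Polynomial

variable {V : Type*} [AddCommGroup V] [Module ℂ V] {L : SuperProduct V} {n : ℕ} {g : ℂ}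
  {q : ℕ → ℂ} {y y' : V}

theorem pow_apply_eq_zero (h : L.IsPresentedBy n g q y y') (u : V) :
    (L.rightMul y ^ (2 * n)) u = 0 := by
  have hn := h.pos
  obtain ⟨f, c, rfl⟩ := h.exists_eq u
  rw [map_add, ← cyclicMap_X_pow_mul, h.cyclicMap_eq_zero_iff.2 (dvd_mul_right _ _), map_smul,
    show 2 * n = (2 * n - 1) + 1 by omega, pow_succ, Module.End.mul_apply, rightMul_apply,
    h.bracket_eq_zero]
  simp

/-- The subspace spanned by the iterated images of `y` from the `k`-th on. -/
noncomputable def tail (L : SuperProduct V) (y : V) (k : ℕ) : Submodule ℂ V :=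
  (((Ideal.span {(X : ℂ[X]) ^ k}).restrictScalars ℂ)).map (cyclicMap (L.rightMul y) y)

theorem mem_tail {k : ℕ} {v : V} :
    v ∈ tail L y k ↔ ∃ f, X ^ k ∣ f ∧ cyclicMap (L.rightMul y) y f = v := by
  simp [tail, Ideal.mem_span_singleton]

/-- Right multiplication raises the X-adic order: y multiplies by X, [y,y] by 2 X², and y' by P
after X ↦ -X, with X dividing P. -/
theorem bracket_mem_tail (h : L.IsPresentedBy n g q y y') {k : ℕ} {u : V}
    (hu : u ∈ tail L y k) (v : V) : L.bracket u v ∈ tail L y (k + 1) := by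
  obtain ⟨_, ⟨f, rfl⟩, rfl⟩ := mem_tail.1 hu
  obtain ⟨r, c, rfl⟩ := h.exists_eq v
  rw [h.bracket_eq, h.bracket_cyclicMap, ← rightMul_apply, ← rightMul_apply, ← cyclicMap_X_mul,
    ← cyclicMap_X_mul]
  refine add_mem (add_mem (Submodule.smul_mem _ _ (mem_tail.2 ⟨_, ?_, rfl⟩))
    (Submodule.smul_mem _ _ (mem_tail.2 ⟨_, ?_, rfl⟩)))
    (Submodule.smul_mem _ _ (mem_tail.2 ⟨_, ?_, rfl⟩))
  · exact ⟨f, by ring⟩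
  · exact ⟨X * f, by ring⟩
  · rw [mul_comp, X_pow_comp, pow_succ]
    refine mul_dvd_mul (Dvd.dvd.mul_right ⟨(-1) ^ k, ?_⟩ _) ?_
    · rw [neg_pow, mul_comm]
    · simpa using X_pow_dvd_oddPoly n q (k := 1) (by omega)

theorem central_eq (h : L.IsPresentedBy n g q y y') (k : ℕ) :
    L.central (k + 2) = tail L y (k + 1) := by
  have hn := h.pos
  have hle : ∀ k, tail L y k ≤ L.central (k + 1) := by
    intro k
    induction k with
    | zero => exact le_top
    | succ k ih =>
      intro v hv
      obtain ⟨_, ⟨f, rfl⟩, rfl⟩ := mem_tail.1 hv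
      rw [pow_succ', mul_assoc, cyclicMap_X_mul]
      exact Submodule.apply_mem_map₂ _ (ih (mem_tail.2 ⟨_, dvd_mul_right _ _, rfl⟩)) trivial
  refine le_antisymm ?_ (hle _)
  induction k with
  | zero =>
    refine Submodule.map₂_le.2 fun u _ v _ => ?_
    obtain ⟨f, c, rfl⟩ := h.exists_eq u
    rw [map_add, LinearMap.add_apply]
    refine add_mem (h.bracket_mem_tail (k := 0) (mem_tail.2 ⟨f, by simp, rfl⟩) v) ?_
    rw [map_smul, LinearMap.smul_apply]
    refine Submodule.smul_mem _ _ ?_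
    obtain ⟨r, c, rfl⟩ := h.exists_eq v
    -- From the left, y' contributes only its square, which lies in degree 2n - 1 ≥ 1.
    rw [h.bracket_eq, h.bracket_eq_zero, h.bracket_right]
    simp only [map_zero, LinearMap.zero_apply, smul_zero, zero_add]
    rw [← cyclicMap_X_pow]
    exact Submodule.smul_mem _ _ (Submodule.smul_mem _ _
      (mem_tail.2 ⟨_, pow_dvd_pow _ (by omega), rfl⟩))
  | succ k ih =>
    exact Submodule.map₂_le.2 fun u hu v _ => h.bracket_mem_tail (ih hu) v

theorem hasNilindex (h : L.IsPresentedBy n g q y y') :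
    L.HasNilindex (n + (n + 1)) := by
  have hn := h.pos
  have hy : y ≠ 0 := by
    rintro rfl
    exact h.pow_ne_zero (map_zero _)
  refine ⟨⟨by omega, ?_⟩, fun s hs => ?_⟩
  · rw [show n + (n + 1) = (2 * n - 1) + 2 by omega, h.central_eq, eq_bot_iff]
    intro v hv
    obtain ⟨f, hf, rfl⟩ := mem_tail.1 hv
    rw [show 2 * n - 1 + 1 = 2 * n by omega] at hf
    exact h.cyclicMap_eq_zero_iff.2 hf
  · obtain ⟨h1, h2⟩ := hs
    match s, h1, h2 with
    | 1, _, h2 =>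
      have h3 : y ∈ L.central 1 := Submodule.mem_top (R := ℂ)
      rw [h2] at h3
      exact absurd h3 hy
    | k + 2, _, h2 =>
      rw [h.central_eq] at h2
      have h3 : cyclicMap (L.rightMul y) y (X ^ (k + 1)) ∈ tail L y (k + 1) :=
        mem_tail.2 ⟨_, dvd_rfl, rfl⟩
      rw [h2, Submodule.mem_bot, h.cyclicMap_eq_zero_iff] at h3
      by_contra hlt
      have := X_pow_dvd_iff.1 h3 (k + 1) (by omega)
      simp at this

/-- An even vector has no constant coefficient, so only its linear one acts. In particular no even
element can have a Jordan block longer than n. -/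
theorem rightMul_even (h : L.IsPresentedBy n g q y y') {x : V} (hx : x ∈ L.part 0) :
    ∃ c : ℂ, L.rightMul x = c • L.rightMul y ^ 2 := by
  obtain ⟨f, rfl⟩ := h.mem_even_iff.1 hx
  refine ⟨2 * (X * expand ℂ 2 f).coeff 1, LinearMap.ext fun u => ?_⟩
  rw [rightMul_apply, h.bracket_cyclicMap_right]
  simp [pow_two]

theorem rightMul_even_pow (h : L.IsPresentedBy n g q y y') {x : V} (hx : x ∈ L.part 0) (u : V) :
    (L.rightMul x ^ n) u = 0 := by
  obtain ⟨c, hc⟩ := h.rightMul_even hx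
  rw [hc, _root_.smul_pow, ← pow_mul, LinearMap.smul_apply, h.pow_apply_eq_zero, smul_zero]

/-- Serves both parities: j = 1 with c = 0 for the even chain, j = 0 for the odd chain together with
y'. -/
theorem sum_eq_zero_imp (h : L.IsPresentedBy n g q y y') (j : ℕ) (hj : j ≤ 1) (t : Fin n → ℂ)
    (c : ℂ) (e : ∑ i, t i • (L.rightMul y ^ (2 * (i : ℕ) + j)) y + c • y' = 0) :
    (∀ i, t i = 0) ∧ c = 0 := by
  have e' : cyclicMap (L.rightMul y) y (∑ i, C (t i) * X ^ (2 * (i : ℕ) + j)) + c • y' = 0 := by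
    rw [← e, map_sum]
    simp only [cyclicMap_C_mul, cyclicMap_X_pow]
  obtain ⟨h1, h2⟩ := h.indep e'
  refine ⟨fun i => ?_, h2⟩
  have h3 := X_pow_dvd_iff.1 h1 (2 * (i : ℕ) + j) (by omega)
  rw [finsetSum_coeff, Finset.sum_eq_single i] at h3
  · simpa using h3
  · intro k _ hk
    rw [coeff_C_mul_X_pow, if_neg (fun hh => hk (Fin.ext (by omega)))]
  · simp

theorem even_le_span (h : L.IsPresentedBy n g q y y') :
    L.part 0 ≤ Submodule.span ℂ
      (Set.range fun i : Fin n => (L.rightMul y ^ (2 * (i : ℕ) + 1)) y) := by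
  intro v hv
  obtain ⟨f, rfl⟩ := h.mem_even_iff.1 hv
  clear hv
  induction f using Polynomial.induction_on' with
  | add p r hp hr => rw [map_add, mul_add, map_add]; exact add_mem hp hr
  | monomial k a =>
    rw [expand_monomial, ← C_mul_X_pow_eq_monomial, mul_left_comm, ← pow_succ', cyclicMap_C_mul,
      mul_comm k 2]
    refine Submodule.smul_mem _ _ ?_
    rcases Nat.lt_or_ge k n with hk | hk
    · rw [cyclicMap_X_pow]
      exact Submodule.subset_span ⟨⟨k, hk⟩, rfl⟩
    · rw [h.cyclicMap_eq_zero_iff.2 (pow_dvd_pow _ (by omega))]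
      exact zero_mem _

theorem odd_le_span (h : L.IsPresentedBy n g q y y') :
    L.part 1 ≤ Submodule.span ℂ
      (Set.range fun o : Option (Fin n) => o.elim y' fun i => (L.rightMul y ^ (2 * (i : ℕ))) y) := by
  intro v hv
  obtain ⟨f, c, rfl⟩ := h.mem_odd_iff.1 hv
  clear hv
  refine add_mem ?_ (Submodule.smul_mem _ _ (Submodule.subset_span ⟨none, rfl⟩))
  induction f using Polynomial.induction_on' with
  | add p r hp hr => rw [map_add, map_add]; exact add_mem hp hr
  | monomial k a =>
    rw [expand_monomial, ← C_mul_X_pow_eq_monomial, cyclicMap_C_mul, mul_comm k 2]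
    refine Submodule.smul_mem _ _ ?_
    rcases Nat.lt_or_ge k n with hk | hk
    · rw [cyclicMap_X_pow]
      exact Submodule.subset_span ⟨some ⟨k, hk⟩, rfl⟩
    · rw [h.cyclicMap_eq_zero_iff.2 (pow_dvd_pow _ (by omega))]
      exact zero_mem _

theorem hasJordanType_even (h : L.IsPresentedBy n g q y y') {x : V}
    (hx : L.rightMul x = L.rightMul y ^ 2) : HasJordanType (L.rightMul x) (L.part 0) [n] := by
  refine hasJordanType_singleton h.pos (fun i => (L.rightMul y ^ (2 * i + 1)) y)
    (fun i => (h.isLeibniz.pow_mem_even h.mem i).2) ?_ h.even_le_span (fun i => ?_) ?_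
  · rw [Fintype.linearIndependent_iff]
    intro t ht
    exact (h.sum_eq_zero_imp 1 le_rfl t 0 (by simpa using ht)).1
  · rw [hx, ← Module.End.mul_apply, ← pow_add]
    congr 2; ring
  · rw [pow_succ', Module.End.mul_apply, h.pow_eq_zero, map_zero]

theorem hasJordanType_odd (h : L.IsPresentedBy n g q y y') {x : V}
    (hx : L.rightMul x = L.rightMul y ^ 2) : HasJordanType (L.rightMul x) (L.part 1) [n, 1] := by
  refine hasJordanType_pair_one h.pos (fun i => (L.rightMul y ^ (2 * i)) y)
    (fun i => (h.isLeibniz.pow_mem_even h.mem i).1) h.mem' ?_ h.odd_le_span (fun i => ?_)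
    h.pow_eq_zero ?_
  · rw [Fintype.linearIndependent_iff]
    intro t ht
    rw [Fintype.sum_option] at ht
    obtain ⟨h1, h2⟩ := h.sum_eq_zero_imp 0 zero_le_one (fun i => t (some i)) (t none)
      (by simpa [add_comm] using ht)
    rintro (_ | i)
    · exact h2
    · exact h1 i
  · rw [hx, ← Module.End.mul_apply, ← pow_add]
    congr 2; ring
  · rw [hx, pow_two, Module.End.mul_apply, rightMul_apply y y', h.bracket_eq_zero, map_zero]

theorem finrank_even (h : L.IsPresentedBy n g q y y') : Module.finrank ℂ (L.part 0) = n := by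
  have hx : L.rightMul ((1 / 2 : ℂ) • L.bracket y y) = L.rightMul y ^ 2 := by
    ext u
    simp [h.isLeibniz.bracket_sq _ h.mem, pow_two, smul_smul]
  rw [← (h.hasJordanType_even hx).sum_eq]; simp

theorem finrank_odd (h : L.IsPresentedBy n g q y y') : Module.finrank ℂ (L.part 1) = n + 1 := by
  have hx : L.rightMul ((1 / 2 : ℂ) • L.bracket y y) = L.rightMul y ^ 2 := by
    ext u
    simp [h.isLeibniz.bracket_sq _ h.mem, pow_two, smul_smul]
  rw [← (h.hasJordanType_odd hx).sum_eq]; simp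

/-- Even elements act as multiples of R_y², so products of two of them have X-adic order at least
two, whereas [y,y] has order one. -/
theorem bracket_self_notMem (h : L.IsPresentedBy n g q y y') :
    (1 / 2 : ℂ) • L.bracket y y ∉ Submodule.map₂ L.bracket (L.part 0) (L.part 0) := by
  have hn := h.pos
  have hle : Submodule.map₂ L.bracket (L.part 0) (L.part 0) ≤ tail L y 2 := by
    refine Submodule.map₂_le.2 fun u hu v hv => ?_
    obtain ⟨f, rfl⟩ := h.mem_even_iff.1 hu
    obtain ⟨r, rfl⟩ := h.mem_even_iff.1 hv
    rw [h.bracket_cyclicMap_right, mul_coeff_zero, coeff_X_zero, zero_mul, zero_smul, zero_add,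
      ← rightMul_apply, ← rightMul_apply, ← cyclicMap_X_mul, ← cyclicMap_X_mul]
    exact Submodule.smul_mem _ _ (mem_tail.2 ⟨_, ⟨X * expand ℂ 2 f, by ring⟩, rfl⟩)
  intro hmem
  obtain ⟨f, hf, e⟩ := mem_tail.1 (hle hmem)
  have e2 : cyclicMap (L.rightMul y) y (f - C (1 / 2) * X ^ 1) = 0 := by
    rw [map_sub, e, cyclicMap_C_mul, cyclicMap_X_pow]; simp
  rw [h.cyclicMap_eq_zero_iff] at e2
  have h1 := X_pow_dvd_iff.1 e2 1 (by omega)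
  have h2 := X_pow_dvd_iff.1 hf 1 (by omega)
  rw [coeff_sub, h2, coeff_C_mul_X_pow] at h1
  norm_num at h1

theorem inClass (h : L.IsPresentedBy n g q y y') : L.InClass n (n + 1) := by
  have hx : L.rightMul ((1 / 2 : ℂ) • L.bracket y y) = L.rightMul y ^ 2 := by
    ext u
    simp [h.isLeibniz.bracket_sq _ h.mem, pow_two, smul_smul]
  have hx0 : (1 / 2 : ℂ) • L.bracket y y ∈ L.part 0 :=
    Submodule.smul_mem _ _ (h.isLeibniz.mem11 h.mem h.mem)
  refine ⟨h.isLeibniz, h.finrank_even, h.finrank_odd, ⟨⟨?_, ?_⟩, ⟨?_, ?_⟩⟩, h.hasNilindex⟩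
  · exact ⟨_, hx0, h.bracket_self_notMem, h.hasJordanType_even hx⟩
  · rintro l ⟨x, -, -, hl⟩
    exact eq_or_lex_singleton h.pos hl.2.1 (by rw [hl.sum_eq, h.finrank_even])
  · exact ⟨_, hx0, h.bracket_self_notMem, h.hasJordanType_odd hx⟩
  · rintro l ⟨x, hx, -, hl⟩
    rw [Nat.add_sub_cancel]
    exact eq_or_lex_pair_one hl.2.1
      (fun k hk => hl.le_of_pow_eq_zero (fun w _ => h.rightMul_even_pow hx w) hk)
      (by rw [hl.sum_eq, h.finrank_odd])

end SuperProduct.IsPresentedBy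

/-! ### Generators of a superalgebra of the class -/

namespace SuperProduct

open Polynomial

variable {V : Type*} [AddCommGroup V] [Module ℂ V] {L : SuperProduct V} {n : ℕ}

/-- The even part is generated by `x`, with `R_x` nilpotent of order `n`, and acting nontrivially
on the odd part. -/
structure IsEvenGenerator (L : SuperProduct V) (n : ℕ) (x : V) : Prop where
  mem : x ∈ L.part 0
  exists_eq : ∀ v ∈ L.part 0, ∃ c : ℂ, ∃ w ∈ L.part 0, v = c • x + L.bracket w x
  bracket_bracket : ∀ u, ∀ w ∈ L.part 0, L.bracket u (L.bracket w x) = 0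
  pow_eq_zero : ∀ v, (L.rightMul x ^ n) v = 0
  pow_ne_zero : (L.rightMul x ^ (n - 1)) x ≠ 0
  exists_ne_zero : ∃ v ∈ L.part 1, L.bracket v x ≠ 0

theorem cyclicMap_rightMul_mem (hL : L.IsLeibnizSuperalgebra) {x e : V} (hx : x ∈ L.part 0)
    {a : ZMod 2} (he : e ∈ L.part a) (f : ℂ[X]) : cyclicMap (L.rightMul x) e f ∈ L.part a := by
  induction f using Polynomial.induction_on' with
  | add p r hp hr => rw [map_add]; exact add_mem hp hr
  | monomial k c =>
    rw [← C_mul_X_pow_eq_monomial, cyclicMap_C_mul, cyclicMap_X_pow]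
    refine Submodule.smul_mem _ _ ?_
    induction k with
    | zero => simpa using he
    | succ k ih =>
      rw [pow_succ', Module.End.mul_apply]
      have := hL.bracket_mem a 0 _ _ ih hx
      rwa [add_zero] at this

theorem cyclicMap_eq (b : V →ₗ[ℂ] V) (y : V) (f : ℂ[X]) :
    cyclicMap b y f = f.coeff 0 • y + b (cyclicMap b y f.divX) := by
  conv_lhs => rw [← divX_mul_X_add f]
  rw [map_add, mul_comm, cyclicMap_X_mul, add_comm, ← mul_one (C _), cyclicMap_C_mul, cyclicMap_one]

/-- Right multiplication by [x,x] is a commutator of R_x with itself, hence zero, and inductively so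
is that by every R_x^i x with i ≥ 1. Modulo such terms, [w,x] can be replaced by R_x^(k+1) w' for
arbitrarily large k, and R_x is nilpotent on the even part. -/
theorem bracket_bracket_of_generates (hL : L.IsLeibnizSuperalgebra) {x : V} (hx : x ∈ L.part 0)
    (hgen : ∀ v ∈ L.part 0, ∃ c : ℂ, ∃ w ∈ L.part 0, v = c • x + L.bracket w x)
    (hpow : ∀ v ∈ L.part 0, (L.rightMul x ^ n) v = 0) (u : V) {w : V} (hw : w ∈ L.part 0) :
    L.bracket u (L.bracket w x) = 0 := by
  have h1 : ∀ i u, L.bracket u ((L.rightMul x ^ (i + 1)) x) = 0 := by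
    intro i
    induction i with
    | zero => intro u; simp [hL.leibniz_even_left u x hx]
    | succ i ih =>
      intro u
      rw [pow_succ', Module.End.mul_apply, rightMul_apply, hL.leibniz_even_right u _ hx, ih, ih]
      simp
  have h2 : ∀ k, ∃ w' ∈ L.part 0,
      ∀ u, L.bracket u (L.bracket w x) = L.bracket u ((L.rightMul x ^ (k + 1)) w') := by
    intro k
    induction k with
    | zero => exact ⟨w, hw, fun u => by simp⟩
    | succ k ih =>
      obtain ⟨w', hw', e⟩ := ih
      obtain ⟨c, w'', hw'', rfl⟩ := hgen w' hw'
      refine ⟨w'', hw'', fun u => ?_⟩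
      rw [e, map_add, map_add, map_smul, map_smul, h1, smul_zero, zero_add, ← rightMul_apply x w'',
        ← Module.End.mul_apply (L.rightMul x ^ _), ← pow_succ]
  obtain ⟨w', hw', e⟩ := h2 n
  rw [e, pow_succ', Module.End.mul_apply, hpow _ hw', map_zero, map_zero]

/-- The block [n] yields x outside [L_0, L_0] with L_0 cyclic under R_x; such an x is itself a
cyclic vector. The odd characteristic sequence may come from another element x', but R_{x'} is a
nonzero multiple of R_x, so its Jordan blocks control R_x on the odd part as well. -/
theorem InClass.exists_isEvenGenerator {m : ℕ} (h : L.InClass n (m + 1)) (hn : 2 ≤ n)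
    (hm : m ≤ n) (hm2 : 2 ≤ m) : ∃ x, L.IsEvenGenerator n x := by
  have hL := h.isLeibniz
  obtain ⟨x, hx, hxn, hJ⟩ := h.charSeq.1.1
  have hpow0 : ∀ v ∈ L.part 0, (L.rightMul x ^ n) v = 0 := fun v hv =>
    hJ.pow_eq_zero (by simp) hv
  obtain ⟨-, -, b, hb⟩ := hJ
  let i0 : Fin [n].length := ⟨0, by simp⟩
  let k0 : Fin ([n].get i0) := ⟨0, by change 0 < n; omega⟩
  set e : V := ((b ⟨i0, k0⟩ : L.part 0) : V) with he
  have he0 : e ∈ L.part 0 := (b ⟨i0, k0⟩).2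
  have hbe : ∀ s, ((b s : L.part 0) : V) = (L.rightMul x ^ (s.2 : ℕ)) e := by
    rintro ⟨i, k⟩
    have : i = i0 := by ext; have := i.2; simp [i0]
    subst this
    rw [he, HasJordanType.pow_apply_basis hb, dif_pos (by simpa [k0] using k.2)]
    congr 3
    ext; simp [k0]
  have hcyc : ∀ v ∈ L.part 0, ∃ f : ℂ[X], v = cyclicMap (L.rightMul x) e f := by
    intro v hv
    refine ⟨∑ s, C (b.repr ⟨v, hv⟩ s) * X ^ (s.2 : ℕ), ?_⟩
    rw [map_sum]
    simp only [cyclicMap_C_mul, cyclicMap_X_pow, ← hbe]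
    have := congrArg (L.part 0).subtype (b.sum_repr ⟨v, hv⟩)
    rw [map_sum] at this
    exact this.symm
  have hne : (L.rightMul x ^ (n - 1)) e ≠ 0 := by
    let k1 : Fin ([n].get i0) := ⟨n - 1, by change n - 1 < n; omega⟩
    have := hbe ⟨i0, k1⟩
    intro h0
    exact b.ne_zero ⟨i0, k1⟩ (Subtype.ext (this.trans h0))
  obtain ⟨f, hf⟩ := hcyc x hx
  have hf' := cyclicMap_eq (L.rightMul x) e f
  rw [← hf] at hf'
  -- Otherwise x would lie in the image of R_x on L_0, hence in [L_0, L_0].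
  have hf0 : f.coeff 0 ≠ 0 := by
    intro h0
    rw [h0, zero_smul, zero_add] at hf'
    refine hxn (hf' ▸ ?_)
    exact Submodule.apply_mem_map₂ _ (cyclicMap_rightMul_mem hL hx he0 _) hx
  have hgen : ∀ v ∈ L.part 0, ∃ c : ℂ, ∃ w ∈ L.part 0, v = c • x + L.bracket w x := by
    intro v hv
    obtain ⟨r, rfl⟩ := hcyc v hv
    refine ⟨r.coeff 0 / f.coeff 0, cyclicMap (L.rightMul x) e r.divX -
      (r.coeff 0 / f.coeff 0) • cyclicMap (L.rightMul x) e f.divX,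
      sub_mem (cyclicMap_rightMul_mem hL hx he0 _)
        (Submodule.smul_mem _ _ (cyclicMap_rightMul_mem hL hx he0 _)), ?_⟩
    rw [← rightMul_apply, map_sub, map_smul, cyclicMap_eq _ _ r]
    have : (r.coeff 0 / f.coeff 0) • x = r.coeff 0 • e +
        (r.coeff 0 / f.coeff 0) • L.rightMul x (cyclicMap (L.rightMul x) e f.divX) := by
      conv_lhs => rw [hf']
      rw [smul_add, smul_smul, div_mul_cancel₀ _ hf0]
    rw [this]; abel
  have hbb : ∀ u, ∀ w ∈ L.part 0, L.bracket u (L.bracket w x) = 0 := fun u w hw =>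
    bracket_bracket_of_generates hL hx hgen hpow0 u hw
  obtain ⟨x', hx', -, hJ'⟩ := h.charSeq.2.1
  rw [Nat.add_sub_cancel] at hJ'
  obtain ⟨c, w, hw, rfl⟩ := hgen x' hx'
  have hR : L.rightMul (c • x + L.bracket w x) = c • L.rightMul x := by
    ext u; simp [hbb u w hw]
  rw [hR] at hJ'
  have hpow1 : ∀ v ∈ L.part 1, ((c • L.rightMul x) ^ n) v = 0 := fun v hv =>
    hJ'.pow_eq_zero (by simpa using ⟨hm, by omega⟩) hv
  obtain ⟨-, -, b', hb'⟩ := hJ'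
  let j0 : Fin [m, 1].length := ⟨0, by simp⟩
  let l0 : Fin ([m, 1].get j0) := ⟨0, by change 0 < m; omega⟩
  have hb0 := hb' j0 l0
  rw [dif_pos (by change 0 + 1 < m; omega)] at hb0
  have hne1 : (c • L.rightMul x) (b' ⟨j0, l0⟩ : L.part 1) ≠ 0 := by
    rw [hb0]
    exact fun h0 => b'.ne_zero _ (Subtype.ext h0)
  -- The block of length m ≥ 2 makes the right multiplication by x' nonzero on the odd part.
  have hc : c ≠ 0 := by
    rintro rfl
    simp at hne1
  refine ⟨x, hx, hgen, hbb, fun v => ?_, ?_, _, (b' ⟨j0, l0⟩).2, fun h0 => hne1 ?_⟩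
  · obtain ⟨v₀, h0, v₁, h1, rfl⟩ := hL.exists_add v
    have h2 := hpow1 v₁ h1
    rw [_root_.smul_pow, LinearMap.smul_apply] at h2
    rw [map_add, hpow0 _ h0, (smul_eq_zero.1 h2).resolve_left (pow_ne_zero _ hc), add_zero]
  · have hx2 : (L.rightMul x ^ (n - 1)) x =
        cyclicMap (L.rightMul x) e (X ^ (n - 1) * f) := by
      rw [cyclicMap_X_pow_mul, ← hf]
    have : X ^ (n - 1) * f = C (f.coeff 0) * X ^ (n - 1) + X ^ n * f.divX := by
      conv_lhs => rw [← divX_mul_X_add f]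
      have : X ^ n = X ^ (n - 1) * (X : ℂ[X]) := by rw [← pow_succ]; congr 1; omega
      rw [this]; ring
    rw [hx2, this, map_add, cyclicMap_C_mul, cyclicMap_X_pow,
      cyclicMap_eq_zero_of_dvd _ _ (hpow0 e he0) (dvd_mul_right _ _), add_zero]
    exact smul_ne_zero hf0 hne
  · rw [LinearMap.smul_apply, rightMul_apply, h0, smul_zero]

theorem InClass.finrank_eq {m : ℕ} (h : L.InClass n m) (hn : 0 < n) (hm : 0 < m) :
    Module.finrank ℂ V = n + m := by
  have h0 : Module.Finite ℂ (L.part 0) :=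
    Module.finite_of_finrank_pos (by rw [h.finrank_even]; exact hn)
  have h1 : Module.Finite ℂ (L.part 1) :=
    Module.finite_of_finrank_pos (by rw [h.finrank_odd]; exact hm)
  have hV : Module.Finite ℂ V := by
    have : Module.Finite ℂ (⊤ : Submodule ℂ V) := by
      rw [← h.isLeibniz.isCompl.sup_eq_top]; infer_instance
    exact Module.Finite.equiv Submodule.topEquiv
  rw [← Submodule.finrank_add_eq_of_isCompl h.isLeibniz.isCompl, h.finrank_even, h.finrank_odd]

theorem finrank_le_of_cyclicMap_surjective {b : V →ₗ[ℂ] V} {y : V} {N : ℕ}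
    (hN : (b ^ N) y = 0) (hs : Function.Surjective (cyclicMap b y)) : Module.finrank ℂ V ≤ N := by
  have hs' : Function.Surjective (cyclicMap b y ∘ₗ (degreeLT ℂ N).subtype) := by
    intro v
    obtain ⟨f, rfl⟩ := hs v
    refine ⟨⟨f %ₘ X ^ N, mem_degreeLT.2 ?_⟩, ?_⟩
    · have := degree_modByMonic_lt f (monic_X_pow (R := ℂ) N)
      rwa [degree_X_pow] at this
    · conv_rhs => rw [← modByMonic_add_div f (X ^ N), map_add,
        cyclicMap_eq_zero_of_dvd b y hN (dvd_mul_right _ _), add_zero]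
      rfl
  have e := (degreeLTEquiv ℂ N).finrank_eq
  have : Module.Finite ℂ (degreeLT ℂ N) := Module.Finite.equiv (degreeLTEquiv ℂ N).symm
  have h := LinearMap.finrank_le_finrank_of_surjective hs'
  rw [e] at h
  simpa using h

/-- As [w₀,x] acts as zero, [y,y] acts as t R_x, so R_x = (2/t) R_y². The chain of y therefore has
length exactly 2n, and the dimension leaves room for one further odd vector. Correcting that vector
to y' with [y',y] = 0 gives the relations. -/
theorem IsEvenGenerator.exists_isPresentedBy {x y w₀ : V} {t : ℂ} (hx : L.IsEvenGenerator n x)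
    (hL : L.IsLeibnizSuperalgebra) (hn : 2 ≤ n) (hV : Module.finrank ℂ V = 2 * n + 1)
    (hy : y ∈ L.part 1) (ht : t ≠ 0) (hw₀ : w₀ ∈ L.part 0)
    (e : L.bracket y y = t • x + L.bracket w₀ x) : ∃ g q y', L.IsPresentedBy n g q y y' := by
  set b := L.rightMul y with hb
  have hbx : ∀ u, L.bracket u x = (2 / t) • b (b u) := by
    intro u
    have h1 := hL.bracket_sq u hy
    rw [e, map_add, hx.bracket_bracket _ _ hw₀, add_zero, map_smul] at h1
    rw [div_eq_inv_mul, mul_smul]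
    exact (eq_inv_smul_iff₀ ht).2 h1
  have hR : L.rightMul x = (2 / t) • b ^ 2 := by
    ext u; rw [rightMul_apply, hbx, pow_two]; rfl
  have ht2 : (2 / t) ≠ 0 := div_ne_zero two_ne_zero ht
  have hpow : ∀ u, (b ^ (2 * n)) u = 0 := by
    intro u
    have h1 := hx.pow_eq_zero u
    rw [hR, _root_.smul_pow, LinearMap.smul_apply, ← pow_mul] at h1
    exact (smul_eq_zero.1 h1).resolve_left (_root_.pow_ne_zero _ ht2)
  -- R_x^(n-1) kills [w₀,x] but not t x, so it does not kill [y,y].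
  have hpow' : (b ^ (2 * n - 1)) y ≠ 0 := by
    have h1 : (L.rightMul x ^ (n - 1)) (b y) ≠ 0 := by
      rw [hb, rightMul_apply, e, map_add, map_smul]
      rw [← rightMul_apply x w₀, ← Module.End.mul_apply, ← pow_succ, Nat.sub_add_cancel (by omega),
        hx.pow_eq_zero, add_zero]
      exact smul_ne_zero ht hx.pow_ne_zero
    intro h0
    apply h1
    rw [hR, _root_.smul_pow, LinearMap.smul_apply, ← pow_mul, ← Module.End.mul_apply, ← pow_succ,
      show 2 * (n - 1) + 1 = 2 * n - 1 by omega, h0, smul_zero]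
  have hgen : ∀ v ∈ L.part 0, ∃ c : ℂ, ∃ w ∈ L.part 0, v = c • b y + b (b w) := by
    intro v hv
    obtain ⟨c, w, hw, rfl⟩ := hx.exists_eq v hv
    refine ⟨c / t, (2 / t) • w - (c / t * (2 / t)) • w₀, sub_mem (Submodule.smul_mem _ _ hw)
      (Submodule.smul_mem _ _ hw₀), ?_⟩
    rw [hb, rightMul_apply y y, e, ← hb, hbx, hbx, smul_add, smul_smul, div_mul_cancel₀ _ ht]
    simp only [map_sub, map_smul, smul_smul]
    abel
  have hcyc : ∀ v ∈ L.part 0, ∃ f : ℂ[X], v = cyclicMap b y (X * expand ℂ 2 f) := by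
    -- Iterating `hgen` pushes the remainder into the image of R_y^(2k), which is zero for k = n.
    have h1 : ∀ k, ∀ v ∈ L.part 0, ∃ f : ℂ[X], ∃ w ∈ L.part 0,
        v = cyclicMap b y (X * expand ℂ 2 f) + (b ^ (2 * k)) w := by
      intro k
      induction k with
      | zero => exact fun v hv => ⟨0, v, hv, by simp⟩
      | succ k ih =>
        intro v hv
        obtain ⟨c, w, hw, rfl⟩ := hgen v hv
        obtain ⟨f, w', hw', e'⟩ := ih w hw
        refine ⟨C c + X * f, w', hw', ?_⟩
        have h2 : X * expand ℂ 2 (C c + X * f) = C c * X + X * (X * (X * expand ℂ 2 f)) := by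
          simp; ring
        rw [h2, map_add, cyclicMap_C_mul, cyclicMap_X_mul, cyclicMap_X_mul b y (X * _), add_assoc,
          show 2 * (k + 1) = 2 * k + 1 + 1 by ring, pow_succ', pow_succ', Module.End.mul_apply,
          Module.End.mul_apply, ← map_add, ← map_add, ← e', ← pow_one X, cyclicMap_X_pow, pow_one]
    intro v hv
    obtain ⟨f, w, -, e'⟩ := h1 n v hv
    exact ⟨f, by rw [e', hpow, add_zero]⟩
  have hodd : ∀ f : ℂ[X], cyclicMap b y (expand ℂ 2 f) ∈ L.part 1 := by
    intro f
    induction f using Polynomial.induction_on' with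
    | add p r hp hr => rw [map_add, map_add]; exact add_mem hp hr
    | monomial k a =>
      rw [expand_monomial, ← C_mul_X_pow_eq_monomial, cyclicMap_C_mul, cyclicMap_X_pow,
        mul_comm k 2]
      exact Submodule.smul_mem _ _ (hL.pow_mem_even hy k).1
  -- Without such a z, y would be cyclic for R_y and the dimension would be at most 2n.
  obtain ⟨z, hz, hzS⟩ : ∃ z ∈ L.part 1, z ∉ LinearMap.range (cyclicMap b y) := by
    by_contra! hcon
    have hs : Function.Surjective (cyclicMap b y) := by
      intro v
      obtain ⟨v₀, h0, v₁, h1, rfl⟩ := hL.exists_add v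
      obtain ⟨f, rfl⟩ := hcyc v₀ h0
      obtain ⟨f', rfl⟩ := hcon v₁ h1
      exact ⟨_, map_add _ _ _⟩
    have := finrank_le_of_cyclicMap_surjective (hpow y) hs
    omega
  obtain ⟨f, hf⟩ := hcyc _ (hL.mem11 hz hy)
  -- If [z,y] = R_y f(R_y²) y, subtracting f(R_y²) y annihilates the product with y.
  set y' := z - cyclicMap b y (expand ℂ 2 f) with hy'
  have hy'1 : y' ∈ L.part 1 := sub_mem hz (hodd f)
  have hy'0 : y' ≠ 0 := by
    intro h0
    exact hzS ⟨_, (sub_eq_zero.1 h0).symm⟩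
  have hby' : L.bracket y' y = 0 := by
    rw [← rightMul_apply, ← hb, hy', map_sub, ← cyclicMap_X_mul, ← hf, hb, rightMul_apply, sub_self]
  have hanti : ∀ u, L.bracket (L.bracket u y) y' = -L.bracket (L.bracket u y') y := by
    intro u
    have e := hL.leibniz_odd u hy'1 hy
    rw [hby', map_zero] at e
    exact eq_neg_of_add_eq_zero_right e.symm
  obtain ⟨r, hr⟩ := hcyc _ (hL.mem11 hy'1 hy'1)
  -- Anticommutation gives [[y',y'],y] = -[[y',y],y'] = 0, so [y',y'] lies on the last line of the
  -- chain.
  have hr' : b (cyclicMap b y (X * expand ℂ 2 r)) = 0 := by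
    rw [← hr, hb, rightMul_apply, ← neg_eq_zero, ← hanti, hby', map_zero, LinearMap.zero_apply]
  obtain ⟨-, hr2⟩ := cyclicMap_eq_smul_of_apply_eq_zero b y (by omega) (hpow y) hpow' hr'
  rw [← hr] at hr2
  obtain ⟨p, hp⟩ := hcyc _ (hL.mem11 hy hy'1)
  have hdd : ∀ u, L.bracket (L.bracket u y') y' = 0 := by
    intro u
    have h1 := hL.bracket_sq u hy'1
    rw [hr2, map_smul, hb, hL.bracket_pow hy _ (by omega), smul_zero] at h1
    exact (smul_eq_zero.1 h1.symm).resolve_left two_ne_zero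
  -- For odd P, R_{y'}² y corresponds to P(-X) P(X) = -P², and R_{y'}² = 0 because [y',y'] acts as
  -- zero.
  have hP2 : X ^ (2 * n) ∣ (X * expand ℂ 2 p) ^ 2 := by
    refine dvd_of_cyclicMap_eq_zero b y (hpow y) hpow' ?_
    have h1 := hdd y
    rw [hp, hb, bracket_cyclicMap_of_anticomm hanti hp, ← hb] at h1
    have h2 : (X * expand ℂ 2 p).comp (-X) = -(X * expand ℂ 2 p) := by
      rw [mul_comp, X_comp, expand_eq_comp_X_pow, comp_assoc, X_pow_comp, neg_sq, neg_mul]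
    rw [h2, neg_mul, map_neg, neg_eq_zero, ← pow_two] at h1
    exact h1
  have hP : X ^ n ∣ X * expand ℂ 2 p := by
    rw [mul_comm 2 n, pow_mul] at hP2
    exact (IsIntegrallyClosed.pow_dvd_pow_iff two_ne_zero).1 hP2
  have hPe : ∀ k, Even k → (X * expand ℂ 2 p).coeff k = 0 := by
    rintro k hk
    rcases k with _ | k
    · simp
    · rw [coeff_X_mul, coeff_expand (by norm_num), if_neg]
      rintro ⟨j, rfl⟩
      exact absurd hk (by simp)
  have hsub := X_pow_dvd_sub_oddPoly n hPe hP
  refine ⟨_, fun i => (X * expand ℂ 2 p).coeff (2 * (n / 2) + 1 + 2 * i), y', hL, hV, hy, hy'1,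
    hy'0, hby', hpow y, hpow', ?_, hr2⟩
  rw [hp, ← sub_eq_zero, ← map_sub]
  exact cyclicMap_eq_zero_of_dvd _ _ (hpow y) hsub

end SuperProduct

/-! ### The central sequence and maximal nilindex -/

namespace SuperProduct

variable {V : Type*} [AddCommGroup V] [Module ℂ V] {L : SuperProduct V} {n : ℕ}

theorem bracket_mem_central_succ {k : ℕ} (hk : 1 ≤ k) {u : V} (hu : u ∈ L.central k) (v : V) :
    L.bracket u v ∈ L.central (k + 1) := by
  obtain ⟨k, rfl⟩ := Nat.exists_eq_add_of_le' hk
  exact Submodule.apply_mem_map₂ _ hu trivial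

theorem central_succ_le {k : ℕ} (hk : 1 ≤ k) : L.central (k + 1) ≤ L.central k := by
  induction k, hk using Nat.le_induction with
  | base => exact le_top
  | succ k hk ih =>
    obtain ⟨k, rfl⟩ := Nat.exists_eq_add_of_le' hk
    exact Submodule.map₂_le_map₂_left ih

namespace IsLeibnizSuperalgebra

/-- The central sequence consists of graded subspaces. This is what allows the signed Leibniz
identity and parity arguments to be applied inside it. -/
theorem exists_add_central (h : L.IsLeibnizSuperalgebra) (k : ℕ) :
    L.central k ≤ L.central k ⊓ L.part 0 ⊔ L.central k ⊓ L.part 1 := by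
  match k with
  | 0 =>
    intro v _
    obtain ⟨v₀, h0, v₁, h1, rfl⟩ := h.exists_add v
    exact add_mem (Submodule.mem_sup_left ⟨trivial, h0⟩) (Submodule.mem_sup_right ⟨trivial, h1⟩)
  | 1 =>
    intro v _
    obtain ⟨v₀, h0, v₁, h1, rfl⟩ := h.exists_add v
    exact add_mem (Submodule.mem_sup_left ⟨trivial, h0⟩) (Submodule.mem_sup_right ⟨trivial, h1⟩)
  | k + 2 =>
    refine Submodule.map₂_le.2 fun u hu v _ => ?_
    obtain ⟨u₀, hu0, u₁, hu1, rfl⟩ := Submodule.mem_sup.1 (h.exists_add_central (k + 1) hu)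
    obtain ⟨v₀, hv0, v₁, hv1, rfl⟩ := h.exists_add v
    simp only [map_add, LinearMap.add_apply]
    have hc0 : ∀ w, L.bracket u₀ w ∈ L.central (k + 2) := fun w =>
      bracket_mem_central_succ (by omega) hu0.1 w
    have hc1 : ∀ w, L.bracket u₁ w ∈ L.central (k + 2) := fun w =>
      bracket_mem_central_succ (by omega) hu1.1 w
    exact add_mem (add_mem (Submodule.mem_sup_left ⟨hc0 _, h.mem00 hu0.2 hv0⟩)
      (Submodule.mem_sup_right ⟨hc1 _, h.mem10 hu1.2 hv0⟩))
      (add_mem (Submodule.mem_sup_right ⟨hc0 _, h.mem01 hu0.2 hv1⟩)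
      (Submodule.mem_sup_left ⟨hc1 _, h.mem11 hu1.2 hv1⟩))

theorem mem_central_of_add (h : L.IsLeibnizSuperalgebra) {k : ℕ} {u v : V} (hu : u ∈ L.part 0)
    (hv : v ∈ L.part 1) (huv : u + v ∈ L.central k) : u ∈ L.central k ∧ v ∈ L.central k := by
  obtain ⟨u', hu', v', hv', e⟩ := Submodule.mem_sup.1 (h.exists_add_central k huv)
  obtain ⟨rfl, rfl⟩ := h.eq_and_eq hu'.2 hu hv'.2 hv e
  exact ⟨hu'.1, hv'.1⟩

/-- The Leibniz identity turns [u,[v,w]] into a combination of [[u,v],w] and [[u,w],v], both covered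
by the inductive hypothesis on the right index. -/
theorem bracket_mem_central (h : L.IsLeibnizSuperalgebra) {i j : ℕ} (hi : 1 ≤ i) (hj : 1 ≤ j)
    {u v : V} (hu : u ∈ L.central i) (hv : v ∈ L.central j) :
    L.bracket u v ∈ L.central (i + j) := by
  induction j, hj using Nat.le_induction generalizing i u v with
  | base => exact bracket_mem_central_succ hi hu v
  | succ j hj ih =>
    obtain ⟨k, rfl⟩ := Nat.exists_eq_add_of_le' hj
    have hle : L.central (k + 1 + 1) ≤ (L.central (i + (k + 1 + 1))).comap (L.bracket u) := by
      refine Submodule.map₂_le.2 fun v hv w _ => ?_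
      rw [Submodule.mem_comap]
      obtain ⟨v₀, hv0, v₁, hv1, rfl⟩ := Submodule.mem_sup.1 (h.exists_add_central (k + 1) hv)
      obtain ⟨w₀, hw0, w₁, hw1, rfl⟩ := h.exists_add w
      have h1 : ∀ z ∈ L.central (k + 1), ∀ w, L.bracket (L.bracket u z) w ∈
          L.central (i + (k + 1 + 1)) := fun z hz w =>
        bracket_mem_central_succ (by omega) (ih hi hu hz) w
      have h2 : ∀ z ∈ L.central (k + 1), ∀ w, L.bracket (L.bracket u w) z ∈
          L.central (i + (k + 1 + 1)) := fun z hz w => by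
        have := ih (i := i + 1) (by omega) (bracket_mem_central_succ hi hu w) hz
        rwa [show i + 1 + (k + 1) = i + (k + 1 + 1) by ring] at this
      simp only [map_add, LinearMap.add_apply]
      rw [h.leibniz_even_left u w₀ hv0.2, h.leibniz_even_left u w₁ hv0.2,
        h.leibniz_even_right u v₁ hw0, h.leibniz_odd u hv1.2 hw1]
      exact add_mem (add_mem (sub_mem (h1 _ hv0.1 _) (h2 _ hv0.1 _))
        (sub_mem (h1 _ hv1.1 _) (h2 _ hv1.1 _)))
        (add_mem (sub_mem (h1 _ hv0.1 _) (h2 _ hv0.1 _))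
        (add_mem (h1 _ hv1.1 _) (h2 _ hv1.1 _)))
    exact hle hv

end IsLeibnizSuperalgebra

/-- Once two consecutive terms agree the sequence is constant, so it would already be zero at k,
against minimality of N. -/
theorem HasNilindex.central_lt {N : ℕ} (h : L.HasNilindex N) {k : ℕ} (hk : 1 ≤ k) (hkN : k < N) :
    L.central (k + 1) < L.central k := by
  refine lt_of_le_of_ne (central_succ_le hk) fun e => ?_
  have h1 : ∀ j, k ≤ j → L.central j = L.central k := by
    intro j hj
    induction j, hj using Nat.le_induction with
    | base => rfl
    | succ j hj ih =>
      obtain ⟨i, rfl⟩ := Nat.exists_eq_add_of_le' hk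
      obtain ⟨j, rfl⟩ := Nat.exists_eq_add_of_le' (hk.trans hj)
      change Submodule.map₂ L.bracket (L.central (j + 1)) ⊤ = _
      rw [ih]
      exact e
  have h2 := h1 N hkN.le
  rw [h.1.2] at h2
  have := h.2 ⟨hk, h2.symm⟩
  omega

theorem exists_sub_smul_mem [FiniteDimensional ℂ V] {S T : Submodule ℂ V} (hST : S ≤ T) {u : V}
    (hu : u ∈ T) (hu' : u ∉ S) (hf : Module.finrank ℂ T ≤ Module.finrank ℂ S + 1) {v : V}
    (hv : v ∈ T) : ∃ c : ℂ, v - c • u ∈ S := by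
  have hlt : S < S ⊔ Submodule.span ℂ {u} :=
    lt_of_le_of_ne le_sup_left fun e => hu' (e ▸ Submodule.mem_sup_right
      (Submodule.mem_span_singleton_self u))
  have h1 := Submodule.finrank_lt_finrank_of_lt hlt
  have hle : S ⊔ Submodule.span ℂ {u} ≤ T :=
    sup_le hST ((Submodule.span_singleton_le_iff_mem _ _).2 hu)
  have e := Submodule.eq_of_le_of_finrank_le hle (by omega)
  rw [← e] at hv
  obtain ⟨s, hs, w, hw, rfl⟩ := Submodule.mem_sup.1 hv
  obtain ⟨c, rfl⟩ := Submodule.mem_span_singleton.1 hw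
  exact ⟨c, by simpa using hs⟩

section Filtration

variable {x y : V} {N : ℕ}

/-- Replacing the left factor by a multiple of u and the right one by a combination of x and y costs
only terms in L^{k+2}, by `bracket_mem_central`. -/
theorem exists_sub_mem_central_succ (hL : L.IsLeibnizSuperalgebra)
    (hgen : ∀ v, ∃ c c' : ℂ, v - c • x - c' • y ∈ L.central 2) {k : ℕ} (hk : 1 ≤ k) {u : V}
    (hu : u ∈ L.central k) (huk : ∀ v ∈ L.central k, ∃ c : ℂ, v - c • u ∈ L.central (k + 1))
    {v : V} (hv : v ∈ L.central (k + 1)) :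
    ∃ c c' : ℂ, v - c • L.bracket u x - c' • L.bracket u y ∈ L.central (k + 2) := by
  have hle : L.central (k + 1) ≤
      Submodule.span ℂ {L.bracket u x, L.bracket u y} ⊔ L.central (k + 2) := by
    obtain ⟨i, rfl⟩ := Nat.exists_eq_add_of_le' hk
    refine Submodule.map₂_le.2 fun v hv w _ => ?_
    obtain ⟨c, hc⟩ := huk v hv
    obtain ⟨d, d', hd⟩ := hgen w
    have e : L.bracket v w = c • (d • L.bracket u x + d' • L.bracket u y) +
        (L.bracket (v - c • u) w + c • L.bracket u (w - d • x - d' • y)) := by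
      simp only [map_sub, map_smul, LinearMap.sub_apply, LinearMap.smul_apply]
      module
    rw [e]
    exact add_mem (Submodule.mem_sup_left (Submodule.smul_mem _ _
      (Submodule.mem_span_pair.2 ⟨d, d', rfl⟩)))
      (Submodule.mem_sup_right (add_mem (bracket_mem_central_succ (by omega) hc w)
        (Submodule.smul_mem _ _ (hL.bracket_mem_central (by omega) (by omega) hu hd))))
  obtain ⟨s, hs, t, ht, rfl⟩ := Submodule.mem_sup.1 (hle hv)
  obtain ⟨c, c', rfl⟩ := Submodule.mem_span_pair.1 hs
  exact ⟨c, c', by convert ht using 1; abel⟩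

/-- The source of contradictions below: if both products sink, the central sequence stagnates before
reaching zero. -/
theorem not_bracket_mem_central (hL : L.IsLeibnizSuperalgebra) (hN : L.HasNilindex N)
    (hgen : ∀ v, ∃ c c' : ℂ, v - c • x - c' • y ∈ L.central 2) {k : ℕ} (hk : 1 ≤ k)
    (hkN : k + 1 < N) {u : V}
    (hu : u ∈ L.central k) (huk : ∀ v ∈ L.central k, ∃ c : ℂ, v - c • u ∈ L.central (k + 1))
    (hx : L.bracket u x ∈ L.central (k + 2)) (hy : L.bracket u y ∈ L.central (k + 2)) : False := by
  refine (hN.central_lt (k := k + 1) (by omega) hkN).not_ge fun v hv => ?_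
  obtain ⟨c, c', h⟩ := exists_sub_mem_central_succ hL hgen hk hu huk hv
  have := add_mem (add_mem h (Submodule.smul_mem _ c' hy)) (Submodule.smul_mem _ c hx)
  simpa using this

/-- The analogue for L²/L³, where L/L² needs two generators: of the four products of generators,
only [x,y] survives. -/
theorem exists_sub_mem_central_three (hL : L.IsLeibnizSuperalgebra)
    (hgen : ∀ v, ∃ c c' : ℂ, v - c • x - c' • y ∈ L.central 2)
    (hxx : L.bracket x x ∈ L.central 3) (hyx : L.bracket y x ∈ L.central 3)
    (hyy : L.bracket y y ∈ L.central 3) {v : V} (hv : v ∈ L.central 2) :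
    ∃ c : ℂ, v - c • L.bracket x y ∈ L.central 3 := by
  have hle : L.central 2 ≤ Submodule.span ℂ {L.bracket x y} ⊔ L.central 3 := by
    refine Submodule.map₂_le.2 fun v _ w _ => ?_
    obtain ⟨c, c', hc⟩ := hgen v
    obtain ⟨d, d', hd⟩ := hgen w
    have e : L.bracket v w = (c * d') • L.bracket x y + ((c * d) • L.bracket x x +
        (c' * d) • L.bracket y x + (c' * d') • L.bracket y y +
        L.bracket (v - c • x - c' • y) w + c • L.bracket x (w - d • x - d' • y) +
        c' • L.bracket y (w - d • x - d' • y)) := by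
      simp only [map_sub, map_smul, LinearMap.sub_apply, LinearMap.smul_apply]
      module
    rw [e]
    have h3 : ∀ z, L.bracket z (w - d • x - d' • y) ∈ L.central 3 := fun z =>
      hL.bracket_mem_central (i := 1) (j := 2) le_rfl (by omega) (Submodule.mem_top) hd
    refine add_mem (Submodule.mem_sup_left (Submodule.smul_mem _ _
      (Submodule.mem_span_singleton_self _))) (Submodule.mem_sup_right ?_)
    exact add_mem (add_mem (add_mem (add_mem (add_mem (Submodule.smul_mem _ _ hxx)
      (Submodule.smul_mem _ _ hyx)) (Submodule.smul_mem _ _ hyy))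
      (bracket_mem_central_succ (by omega) hc w)) (Submodule.smul_mem _ _ (h3 _)))
      (Submodule.smul_mem _ _ (h3 _))
  obtain ⟨s, hs, t, ht, rfl⟩ := Submodule.mem_sup.1 (hle hv)
  obtain ⟨c, rfl⟩ := Submodule.mem_span_singleton.1 hs
  exact ⟨c, by simpa using ht⟩

end Filtration

/-! ### An odd square with a component along the even generator -/

namespace IsEvenGenerator

variable {x : V}

/-- If no odd square involves `x`, then neither does any product of two elements. -/
theorem exists_eq_bracket (hL : L.IsLeibnizSuperalgebra) (hx : L.IsEvenGenerator n x)
    (hsq : ∀ y ∈ L.part 1, ∃ w ∈ L.part 0, L.bracket y y = L.bracket w x) {y z : V}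
    (hy : y ∈ L.part 1) (hz : z ∈ L.part 1) :
    ∃ w ∈ L.part 0, L.bracket y z = L.bracket w x := by
  have h0 : ∀ y ∈ L.part 1, ∀ u, L.bracket (L.bracket u y) y = 0 := by
    intro y hy u
    obtain ⟨w, hw, e⟩ := hsq y hy
    have h1 := hL.bracket_sq u hy
    rw [e, hx.bracket_bracket _ _ hw] at h1
    exact (smul_eq_zero.1 h1.symm).resolve_left two_ne_zero
  -- Polarisation of R_y² = 0 gives R_z R_y + R_y R_z = 0.
  have h1 : ∀ u, L.bracket u (L.bracket y z) = 0 := by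
    intro u
    rw [hL.leibniz_odd u hy hz]
    have h2 := h0 (y + z) (add_mem hy hz) u
    simpa [h0 y hy, h0 z hz, add_comm] using h2
  obtain ⟨c, w, hw, e⟩ := hx.exists_eq _ (hL.mem11 hy hz)
  -- An x-component of [y,z] would act nontrivially on this v.
  obtain ⟨v, -, hv⟩ := hx.exists_ne_zero
  have h2 := h1 v
  rw [e, map_add, map_smul, hx.bracket_bracket _ _ hw, add_zero] at h2
  rw [(smul_eq_zero.1 h2).resolve_right hv, zero_smul, zero_add] at e
  exact ⟨w, hw, e⟩

/-- Otherwise R_y² = 0 for every odd y. By maximality of the nilindex L/L² is spanned by x and one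
odd y, and each later quotient is a line, which is spanned by an even or by an odd vector. First
[x,x] is shown to lie in L³, then [y,x] is shown not to. Finally the chain R_x^i y is followed up to
its last index r outside L^{i+2}. Past this point the line is spanned by z = [R_x^r y, y]; [z,y] =
0, and evaluating [y, R_x^{r+1} y] in two ways forces [z,x] into the next term but one, so the
sequence stagnates. -/
theorem exists_bracket_self (hx : L.IsEvenGenerator n x) (hL : L.IsLeibnizSuperalgebra)
    (hn : 2 ≤ n) (hV : Module.finrank ℂ V = 2 * n + 1) (hN : L.HasNilindex (2 * n + 1)) :
    ∃ y ∈ L.part 1, ∃ t : ℂ, ∃ w ∈ L.part 0, t ≠ 0 ∧ L.bracket y y = t • x + L.bracket w x := by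
  by_contra! hcon
  have hFD : FiniteDimensional ℂ V := Module.finite_of_finrank_pos (by omega)
  have hsq' : ∀ y ∈ L.part 1, ∃ w ∈ L.part 0, L.bracket y y = L.bracket w x := by
    intro y hy
    obtain ⟨c, w, hw, e⟩ := hx.exists_eq _ (hL.mem11 hy hy)
    by_cases hc : c = 0
    · exact ⟨w, hw, by rw [e, hc, zero_smul, zero_add]⟩
    · exact absurd e (hcon y hy c w hw hc)
  have hodd : ∀ y ∈ L.part 1, ∀ z ∈ L.part 1, ∃ w ∈ L.part 0, L.bracket y z = L.bracket w x :=
    fun y hy z hz => exists_eq_bracket hL hx hsq' hy hz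
  have hsq : ∀ y ∈ L.part 1, ∀ u, L.bracket (L.bracket u y) y = 0 := by
    intro y hy u
    obtain ⟨w, hw, e⟩ := hsq' y hy
    have h1 := hL.bracket_sq u hy
    rw [e, hx.bracket_bracket _ _ hw] at h1
    exact (smul_eq_zero.1 h1.symm).resolve_left two_ne_zero
  have hbot : ∀ {v}, v ∈ L.central (2 * n + 1) → v = 0 := by
    intro v hv
    rwa [hN.1.2, Submodule.mem_bot] at hv
  -- a generator in the odd part
  obtain ⟨y, hy, hy2⟩ : ∃ y ∈ L.part 1, y ∉ L.central 2 := by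
    by_contra! hall
    -- If L_1 ⊆ L², then L_1 ⊆ L^k implies L² ⊆ L_0 + L^{k+1}, whence L_1 ⊆ L^{k+1}. The odd part
    -- would sink to zero, although R_x is nonzero on it.
    have h1 : ∀ k, 1 ≤ k → L.part 1 ≤ L.central k := by
      intro k hk
      induction k, hk using Nat.le_induction with
      | base => exact le_top
      | succ k hk ih =>
        intro v hv
        have h2 : L.central 2 ≤ L.part 0 ⊔ L.central (k + 1) := by
          refine Submodule.map₂_le.2 fun u _ w _ => ?_
          obtain ⟨u₀, hu0, u₁, hu1, rfl⟩ := hL.exists_add u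
          obtain ⟨w₀, hw0, w₁, hw1, rfl⟩ := hL.exists_add w
          simp only [map_add, LinearMap.add_apply]
          refine add_mem (add_mem (Submodule.mem_sup_left (hL.mem00 hu0 hw0))
            (Submodule.mem_sup_right (bracket_mem_central_succ hk (ih hu1) _)))
            (add_mem (Submodule.mem_sup_right ?_) (Submodule.mem_sup_left (hL.mem11 hu1 hw1)))
          rw [add_comm]
          exact hL.bracket_mem_central le_rfl hk Submodule.mem_top (ih hw1)
        obtain ⟨p, hp, c, hc, e⟩ := Submodule.mem_sup.1 (h2 (hall v hv))
        refine (hL.mem_central_of_add (u := -p) (neg_mem hp) hv ?_).2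
        rw [← e]; simpa using hc
    obtain ⟨v, hv, hvx⟩ := hx.exists_ne_zero
    have := hbot (h1 _ (by omega) hv)
    rw [this] at hvx
    simp at hvx
  -- Even elements of L² come from [L_0, x] alone: products of odd vectors have no x-component by
  -- assumption.
  have hC2 : L.central 2 ≤ (L.part 0).map (L.rightMul x) ⊔ L.part 1 := by
    refine Submodule.map₂_le.2 fun u _ w _ => ?_
    obtain ⟨u₀, hu0, u₁, hu1, rfl⟩ := hL.exists_add u
    obtain ⟨w₀, hw0, w₁, hw1, rfl⟩ := hL.exists_add w
    simp only [map_add, LinearMap.add_apply]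
    refine add_mem (add_mem (Submodule.mem_sup_left ?_) (Submodule.mem_sup_right (hL.mem10 hu1 hw0)))
      (add_mem (Submodule.mem_sup_right (hL.mem01 hu0 hw1)) (Submodule.mem_sup_left ?_))
    · obtain ⟨c, w, hw, rfl⟩ := hx.exists_eq w₀ hw0
      refine ⟨c • u₀, Submodule.smul_mem _ _ hu0, ?_⟩
      rw [map_add, hx.bracket_bracket _ _ hw]; simp
    · obtain ⟨w, hw, e⟩ := hodd u₁ hu1 w₁ hw1
      exact ⟨w, hw, e.symm⟩
  have hC2' : ∀ v ∈ L.part 0, v ∈ L.central 2 → ∃ w ∈ L.part 0, v = L.bracket w x := by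
    intro v hv hv2
    obtain ⟨p, ⟨w, hw, rfl⟩, p', hp', e⟩ := Submodule.mem_sup.1 (hC2 hv2)
    refine ⟨w, hw, ?_⟩
    exact (hL.eq_and_eq (hL.mem00 hw hx.mem) hv hp' (zero_mem _) (by rw [add_zero]; exact e)).1.symm
  have hx2 : x ∉ L.central 2 := by
    intro h
    obtain ⟨w, hw, e⟩ := hC2' x hx.mem h
    have h1 : (L.rightMul x ^ (n - 1)) (L.bracket w x) = 0 := by
      rw [← rightMul_apply, ← Module.End.mul_apply, ← pow_succ, Nat.sub_add_cancel (by omega),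
        hx.pow_eq_zero]
    rw [← e] at h1
    exact hx.pow_ne_zero h1
  -- dimensions of the central sequence
  have hxy : y ∉ L.central 2 ⊔ Submodule.span ℂ {x} := by
    intro h
    obtain ⟨c, hc, s, hs, e⟩ := Submodule.mem_sup.1 h
    obtain ⟨t, rfl⟩ := Submodule.mem_span_singleton.1 hs
    refine hy2 (hL.mem_central_of_add (u := -(t • x)) (neg_mem (Submodule.smul_mem _ _ hx.mem))
      hy ?_).2
    rw [← e]; simpa using hc
  have hlt1 : L.central 2 < L.central 2 ⊔ Submodule.span ℂ {x} :=
    lt_of_le_of_ne le_sup_left fun e => hx2 (e ▸ Submodule.mem_sup_right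
      (Submodule.mem_span_singleton_self x))
  have hlt2 : L.central 2 ⊔ Submodule.span ℂ {x} < ⊤ :=
    lt_of_le_of_ne le_top fun e => hxy (e ▸ Submodule.mem_top)
  have hf1 := Submodule.finrank_lt_finrank_of_lt hlt1
  have hf2 := Submodule.finrank_lt_finrank_of_lt hlt2
  have hVtop : Module.finrank ℂ (⊤ : Submodule ℂ V) = 2 * n + 1 := by rw [finrank_top, hV]
  rw [hVtop] at hf2
  -- The codimension of L² is at least two and every later step is strict, which bounds dimensions
  -- from above; counting strict steps up from L^{2n+1} = 0 bounds them from below. Together each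
  -- L^k/L^{k+1} with k ≥ 2 is a line.
  have hup : ∀ j, j + 2 ≤ 2 * n + 1 → Module.finrank ℂ (L.central (j + 2)) + (j + 2) ≤ 2 * n + 1 := by
    intro j
    induction j with
    | zero => intro _; rw [zero_add]; omega
    | succ j ih =>
      intro hj
      have h1 := ih (by omega)
      have h2 := Submodule.finrank_lt_finrank_of_lt
        (hN.central_lt (k := j + 2) (by omega) (by omega))
      rw [show j + 1 + 2 = j + 2 + 1 by ring]
      omega
  have hlow : ∀ j, j ≤ 2 * n → j ≤ Module.finrank ℂ (L.central (2 * n + 1 - j)) := by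
    intro j
    induction j with
    | zero => intro _; omega
    | succ j ih =>
      intro hj
      have h1 := ih (by omega)
      have h2 := Submodule.finrank_lt_finrank_of_lt
        (hN.central_lt (k := 2 * n + 1 - (j + 1)) (by omega) (by omega))
      rw [show 2 * n + 1 - (j + 1) + 1 = 2 * n + 1 - j by omega] at h2
      omega
  have hquot : ∀ k, 2 ≤ k → k < 2 * n + 1 → ∀ u ∈ L.central k, u ∉ L.central (k + 1) →
      ∀ v ∈ L.central k, ∃ c : ℂ, v - c • u ∈ L.central (k + 1) := by
    intro k hk hkN u hu hu' v hv
    refine exists_sub_smul_mem (central_succ_le (by omega)) hu hu' ?_ hv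
    have h1 := hup (k - 2) (by omega)
    have h2 := hlow (2 * n + 1 - (k + 1)) (by omega)
    rw [show k - 2 + 2 = k by omega] at h1
    rw [show 2 * n + 1 - (2 * n + 1 - (k + 1)) = k + 1 by omega] at h2
    omega
  have hgen : ∀ v, ∃ c c' : ℂ, v - c • x - c' • y ∈ L.central 2 := by
    intro v
    have h2 := hlow (2 * n - 1) (by omega)
    rw [show 2 * n + 1 - (2 * n - 1) = 2 by omega] at h2
    obtain ⟨c', h⟩ := exists_sub_smul_mem hlt2.le (u := y) Submodule.mem_top hxy (by omega)
      (v := v) Submodule.mem_top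
    obtain ⟨l, hl, s, hs, e⟩ := Submodule.mem_sup.1 h
    obtain ⟨c, rfl⟩ := Submodule.mem_span_singleton.1 hs
    refine ⟨c, c', ?_⟩
    rw [sub_right_comm, ← e]; simpa using hl
  have h2mem : ∀ u v, L.bracket u v ∈ L.central 2 := fun u v =>
    bracket_mem_central_succ (k := 1) le_rfl Submodule.mem_top v
  have hcomm : ∀ u z, L.bracket u (L.bracket z x) =
      L.bracket (L.bracket u z) x - L.bracket (L.bracket u x) z := fun u z =>
    hL.leibniz_even_right u z hx.mem
  -- the square of `x` lies deeper
  have hxx : L.bracket x x ∈ L.central 3 := by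
    by_contra hxx
    have hq := hquot 2 le_rfl (by omega) _ (h2mem x x) hxx
    -- Here L²/L³ is spanned by the even [x,x], so the odd vector [x,y] has zero class.
    have hxy3 : L.bracket x y ∈ L.central 3 := by
      obtain ⟨c, hc⟩ := hq _ (h2mem x y)
      rw [sub_eq_neg_add] at hc
      exact (hL.mem_central_of_add (neg_mem (Submodule.smul_mem _ _ (hL.mem00 hx.mem hx.mem)))
        (hL.mem01 hx.mem hy) hc).2
    have hmem : ∀ i, (L.rightMul x ^ i) x ∈ L.central (i + 1) := by
      intro i
      induction i with
      | zero => exact Submodule.mem_top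
      | succ i ih =>
        rw [pow_succ', Module.End.mul_apply]
        exact bracket_mem_central_succ (by omega) ih _
    -- With [·,y] always one level too deep along the chain of x, all lines L^{i+2}/L^{i+3} are
    -- spanned by the even vectors R_x^{i+1} x.
    have hb : ∀ i, L.bracket ((L.rightMul x ^ i) x) y ∈ L.central (i + 3) := by
      intro i
      induction i with
      | zero => simpa using hxy3
      | succ i ih =>
        have e := hL.leibniz_even_left ((L.rightMul x ^ i) x) y hx.mem
        rw [pow_succ', Module.End.mul_apply, rightMul_apply, ← sub_add_cancel (L.bracket _ y)
          (L.bracket (L.bracket ((L.rightMul x ^ i) x) y) x), ← e]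
        refine add_mem ?_ (bracket_mem_central_succ (by omega) ih _)
        have := hL.bracket_mem_central (by omega) (by omega) (hmem i) hxy3
        rwa [show i + 1 + 3 = i + 1 + 3 from rfl] at this
    have hspan : ∀ i, ∀ v ∈ L.central (i + 2),
        ∃ c : ℂ, v - c • (L.rightMul x ^ (i + 1)) x ∈ L.central (i + 3) := by
      intro i
      induction i with
      | zero => simpa using hq
      | succ i ih =>
        intro v hv
        obtain ⟨c, c', h⟩ := exists_sub_mem_central_succ hL hgen (k := i + 2) (by omega)
          (hmem (i + 1)) ih hv
        refine ⟨c, ?_⟩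
        have := add_mem h (Submodule.smul_mem _ c' (hb (i + 1)))
        rw [sub_add_cancel] at this
        rw [pow_succ', Module.End.mul_apply]
        exact this
    have heven : ∀ i, L.central 2 ≤ L.part 0 ⊔ L.central (i + 2) := by
      intro i
      induction i with
      | zero => exact le_sup_right
      | succ i ih =>
        refine ih.trans (sup_le le_sup_left fun v hv => ?_)
        obtain ⟨c, hc⟩ := hspan i v hv
        have := add_mem (Submodule.mem_sup_right (S := L.part 0) hc) (Submodule.mem_sup_left
          (T := L.central (i + 3)) (Submodule.smul_mem _ c
            (by
              have := cyclicMap_rightMul_mem hL hx.mem hx.mem (Polynomial.X ^ (i + 1))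
              rwa [cyclicMap_X_pow] at this)))
        rwa [sub_add_cancel] at this
    -- Then L² is contained in L_0, contradicting a nonzero odd product [v,x].
    obtain ⟨v, hv, hvx⟩ := hx.exists_ne_zero
    have h1 := heven (2 * n - 1) (h2mem v x)
    rw [show 2 * n - 1 + 2 = 2 * n + 1 by omega, hN.1.2, sup_bot_eq] at h1
    exact hvx (hL.eq_zero_of_mem h1 (hL.mem10 hv hx.mem))
  have heven3 : ∀ v ∈ L.part 0, v ∈ L.central 2 → v ∈ L.central 3 := by
    intro v hv hv2
    obtain ⟨w, hw, rfl⟩ := hC2' v hv hv2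
    obtain ⟨c, w', hw', rfl⟩ := hx.exists_eq w hw
    rw [map_add, map_smul, LinearMap.add_apply, LinearMap.smul_apply]
    exact add_mem (Submodule.smul_mem _ _ hxx) (bracket_mem_central_succ (by omega) (h2mem _ _) _)
  -- In the first case [x,y] alone spans L²/L³, while [[x,y],y] = 0 and [[x,y],x] = [x,[y,x]] +
  -- [[x,x],y] lies in L⁴.
  by_cases hyx : L.bracket y x ∈ L.central 3
  · refine not_bracket_mem_central hL hN hgen (k := 2) (by omega) (by omega) (h2mem x y)
      (fun v hv => exists_sub_mem_central_three hL hgen hxx hyx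
        (heven3 _ (hL.mem11 hy hy) (h2mem y y)) hv) ?_ (by rw [hsq y hy]; exact zero_mem _)
    rw [← sub_add_cancel (L.bracket (L.bracket x y) x) (L.bracket (L.bracket x x) y), ← hcomm]
    exact add_mem (hL.bracket_mem_central (i := 1) (j := 3) le_rfl (by omega) Submodule.mem_top hyx)
      (bracket_mem_central_succ (by omega) hxx _)
  -- the chain starting at `y`
  set a := L.rightMul x with ha
  have hym : ∀ i, (a ^ i) y ∈ L.central (i + 1) := by
    intro i
    induction i with
    | zero => exact Submodule.mem_top
    | succ i ih =>
      rw [pow_succ', Module.End.mul_apply]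
      exact bracket_mem_central_succ (by omega) ih _
  have hyo : ∀ i, (a ^ i) y ∈ L.part 1 := by
    intro i
    have := cyclicMap_rightMul_mem hL hx.mem hy (Polynomial.X ^ i)
    rwa [cyclicMap_X_pow] at this
  have hys : ∀ i, (a ^ (i + 1)) y = L.bracket ((a ^ i) y) x := by
    intro i
    rw [pow_succ', Module.End.mul_apply, ha, rightMul_apply]
  have hex : ∃ i, (a ^ i) y ∈ L.central (i + 2) := ⟨n, by rw [hx.pow_eq_zero]; exact zero_mem _⟩
  classical
  -- r is the last index before the chain first drops below its level. It is at least one because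
  -- neither y ∈ L² nor [y,x] ∈ L³ holds.
  obtain ⟨r, hr1, hrn, hr, hrlt⟩ : ∃ r, 1 ≤ r ∧ r + 1 ≤ n ∧ (a ^ (r + 1)) y ∈ L.central (r + 3) ∧
      ∀ i ≤ r, (a ^ i) y ∉ L.central (i + 2) := by
    have hle : Nat.find hex ≤ n := Nat.find_le (by rw [hx.pow_eq_zero]; exact zero_mem _)
    have hspec := Nat.find_spec hex
    have h0 : Nat.find hex ≠ 0 := by
      intro h; rw [h] at hspec; exact hy2 (by simpa using hspec)
    have h1 : Nat.find hex ≠ 1 := by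
      intro h; rw [h] at hspec; exact hyx (by simpa [ha] using hspec)
    refine ⟨Nat.find hex - 1, by omega, by omega, ?_, fun i hi => Nat.find_min hex (by omega)⟩
    rw [Nat.sub_add_cancel (by omega), show Nat.find hex - 1 + 3 = Nat.find hex + 2 by omega]
    exact hspec
  -- The lines L^{j+2}/L^{j+3} with j < r are spanned by odd vectors, so even vectors pass through
  -- to the next term.
  have hev : ∀ j, j ≤ r → ∀ v ∈ L.part 0, v ∈ L.central 2 → v ∈ L.central (j + 2) := by
    intro j
    induction j with
    | zero => exact fun _ v _ hv2 => hv2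
    | succ j ih =>
      intro hj v hv hv2
      have h1 := ih (by omega) v hv hv2
      obtain ⟨c, hc⟩ := hquot (j + 2) (by omega) (by omega) _ (hym (j + 1)) (hrlt _ hj) v h1
      rw [sub_eq_add_neg] at hc
      exact (hL.mem_central_of_add hv (neg_mem (Submodule.smul_mem _ _ (hyo _))) hc).1
  set z := L.bracket ((a ^ r) y) y with hz
  have hquot_r : ∀ v ∈ L.central (r + 1), ∃ c : ℂ, v - c • (a ^ r) y ∈ L.central (r + 2) :=
    hquot (r + 1) (by omega) (by omega) _ (hym r) (hrlt r le_rfl)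
  have hzspan : ∀ v ∈ L.central (r + 2), ∃ c : ℂ, v - c • z ∈ L.central (r + 3) := by
    intro v hv
    obtain ⟨c, c', h⟩ := exists_sub_mem_central_succ hL hgen (by omega) (hym r) hquot_r hv
    refine ⟨c', ?_⟩
    rw [← hys] at h
    have := add_mem h (Submodule.smul_mem _ c hr)
    rwa [sub_right_comm, sub_add_cancel] at this
  have heven2 : ∀ i j, L.bracket ((a ^ i) y) ((a ^ j) y) ∈ L.central (r + 2) := fun i j =>
    hev r le_rfl _ (hL.mem11 (hyo i) (hyo j)) (h2mem _ _)
  -- Moving one R_x from the left factor to the right one changes the sign, modulo a product [even,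
  -- x] that lies one level deeper.
  have hT : ∀ k ≤ r, L.bracket ((a ^ (r - k)) y) ((a ^ k) y) - (-1 : ℂ) ^ k • z ∈
      L.central (r + 3) := by
    intro k
    induction k with
    | zero => intro _; simp [hz]
    | succ k ih =>
      intro hk
      have h1 := ih (by omega)
      rw [show r - k = r - (k + 1) + 1 by omega, hys] at h1
      rw [hys k, hcomm]
      have h2 := sub_mem (bracket_mem_central_succ (by omega) (heven2 (r - (k + 1)) k) x) h1
      convert h2 using 1
      rw [pow_succ]
      module
  -- One level up the correction terms no longer vanish: each move adds a copy of ±[z,x], so k of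
  -- them accumulate. The start k = 0 is negligible because R_x^{r+1} y has dropped.
  have hU : ∀ k ≤ r + 1, L.bracket ((a ^ (r + 1 - k)) y) ((a ^ k) y) +
      ((-1 : ℂ) ^ k * k) • L.bracket z x ∈ L.central (r + 4) := by
    intro k
    induction k with
    | zero =>
      intro _
      simpa using bracket_mem_central_succ (k := r + 3) (by omega) hr y
    | succ k ih =>
      intro hk
      have h1 := ih (by omega)
      rw [show r + 1 - k = r - k + 1 by omega, hys] at h1
      have h2 := bracket_mem_central_succ (k := r + 3) (by omega) (hT k (by omega)) x
      rw [hys k, hcomm, show r + 1 - (k + 1) = r - k by omega]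
      have h3 := sub_mem h2 h1
      convert h3 using 1
      simp only [map_sub, map_smul, LinearMap.sub_apply, LinearMap.smul_apply]
      rw [pow_succ]
      push_cast
      module
  -- At k = r + 1 the dropped vector is the right factor, so (r + 1)[z,x] is negligible, and r + 1
  -- is invertible.
  have hzx : L.bracket z x ∈ L.central (r + 4) := by
    have h1 := hU (r + 1) le_rfl
    have h2 : L.bracket ((a ^ (r + 1 - (r + 1))) y) ((a ^ (r + 1)) y) ∈ L.central (r + 4) := by
      have := hL.bracket_mem_central (i := 1) le_rfl (by omega) (Submodule.mem_top)
        (u := (a ^ (r + 1 - (r + 1))) y) hr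
      rwa [show 1 + (r + 3) = r + 4 by ring] at this
    rw [Submodule.add_mem_iff_right _ h2] at h1
    refine (Submodule.smul_mem_iff _ (mul_ne_zero (_root_.pow_ne_zero _ (by norm_num)) ?_)).1 h1
    exact_mod_cast Nat.succ_ne_zero r
  exact not_bracket_mem_central hL hN hgen (k := r + 2) (by omega) (by omega)
    (heven2 r 0) (by simpa [hz] using hzspan) hzx (by rw [pow_zero, Module.End.one_apply, hsq y hy]; exact zero_mem _)

end IsEvenGenerator

theorem InClass.exists_isPresentedBy (h : L.InClass n (n + 1)) (hn : 2 ≤ n) :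
    ∃ g q y y', L.IsPresentedBy n g q y y' := by
  obtain ⟨x, hx⟩ := h.exists_isEvenGenerator hn le_rfl hn
  have hV : Module.finrank ℂ V = 2 * n + 1 := by
    rw [h.finrank_eq (by omega) (by omega)]; ring
  have hN := h.nilindex
  rw [show n + (n + 1) = 2 * n + 1 by ring] at hN
  obtain ⟨y, hy, t, w, hw, ht, e⟩ := hx.exists_bracket_self h.isLeibniz hn hV hN
  obtain ⟨g, q, y', hp⟩ := hx.exists_isPresentedBy h.isLeibniz hn hV hy ht hw e
  exact ⟨g, q, y, y', hp⟩

end SuperProduct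

/-! ### The multiplication table of the family -/

namespace LeibFamily

variable {n : ℕ}

theorem X_eq_basisFun (i : Fin n) : X n (i + 1) = Pi.basisFun ℂ (Idx n) (Sum.inl i) := by
  ext s
  rcases s with k | k
  · simp [X, Pi.single_apply, Fin.ext_iff]
  · simp [X]

theorem Y_eq_basisFun (j : Fin (n + 1)) : Y n (j + 1) = Pi.basisFun ℂ (Idx n) (Sum.inr j) := by
  ext s
  rcases s with k | k
  · simp [Y]
  · simp [Y, Pi.single_apply, Fin.ext_iff]

theorem X_eq_zero {k : ℕ} (hk : n < k) : X n k = 0 := by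
  ext s
  rcases s with i | i
  · simp [X]; omega
  · simp [X]

/-- The vector `y_k`, replaced by zero for `k > n`. -/
def Z (n k : ℕ) : Space n := if k ≤ n then Y n k else 0

theorem Z_eq {k : ℕ} (hk : k ≤ n) : Z n k = Y n k := if_pos hk

theorem Z_eq_zero {k : ℕ} (hk : n < k) : Z n k = 0 := if_neg (by omega)

/-- The basis consists of the chains `X`, `Z` and the isolated vector y_{n+1}. Since `X` and `Z`
vanish beyond n, the shift formulas below hold for every index ≥ 1 without boundary cases. -/
theorem hom_ext {W : Type*} [AddCommGroup W] [Module ℂ W] {f g : Space n →ₗ[ℂ] W}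
    (hX : ∀ i, 1 ≤ i → i ≤ n → f (X n i) = g (X n i))
    (hZ : ∀ j, 1 ≤ j → j ≤ n → f (Z n j) = g (Z n j))
    (hY : f (Y n (n + 1)) = g (Y n (n + 1))) : f = g := by
  refine (Pi.basisFun ℂ (Idx n)).ext fun s => ?_
  rcases s with i | j
  · rw [← X_eq_basisFun]; exact hX _ (by omega) (by omega)
  · rw [← Y_eq_basisFun]
    rcases Nat.lt_or_ge (j : ℕ) n with h | h
    · rw [← Z_eq h]; exact hZ _ (by omega) h
    · rw [show (j : ℕ) = n by omega]; exact hY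

section Table

variable (γ : ℂ) (b : ℕ → ℂ) (β : ℂ)

theorem bracket_basisFun (s t : Idx n) :
    (algebra n γ b β).bracket (Pi.basisFun ℂ (Idx n) s) (Pi.basisFun ℂ (Idx n) t) =
      table n γ b β s t := by
  simp only [algebra, Module.Basis.constr_basis]

theorem bracket_X_X {i k : ℕ} (hi : 1 ≤ i) (hin : i ≤ n) (hk : 1 ≤ k) (hkn : k ≤ n) :
    (algebra n γ b β).bracket (X n i) (X n k) = mulXX n i k := by
  obtain ⟨i, rfl⟩ := Nat.exists_eq_add_of_le' hi
  obtain ⟨k, rfl⟩ := Nat.exists_eq_add_of_le' hk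
  exact (congrArg₂ (fun u v => (algebra n γ b β).bracket u v) (X_eq_basisFun ⟨i, hin⟩)
    (X_eq_basisFun ⟨k, hkn⟩)).trans (bracket_basisFun γ b β _ _)

theorem bracket_Y_X {i k : ℕ} (hi : 1 ≤ i) (hin : i ≤ n + 1) (hk : 1 ≤ k) (hkn : k ≤ n) :
    (algebra n γ b β).bracket (Y n i) (X n k) = mulYX n i k := by
  obtain ⟨i, rfl⟩ := Nat.exists_eq_add_of_le' hi
  obtain ⟨k, rfl⟩ := Nat.exists_eq_add_of_le' hk
  exact (congrArg₂ (fun u v => (algebra n γ b β).bracket u v) (Y_eq_basisFun ⟨i, hin⟩)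
    (X_eq_basisFun ⟨k, hkn⟩)).trans (bracket_basisFun γ b β _ _)

theorem bracket_X_Y {i k : ℕ} (hi : 1 ≤ i) (hin : i ≤ n) (hk : 1 ≤ k) (hkn : k ≤ n + 1) :
    (algebra n γ b β).bracket (X n i) (Y n k) = mulXY n b i k := by
  obtain ⟨i, rfl⟩ := Nat.exists_eq_add_of_le' hi
  obtain ⟨k, rfl⟩ := Nat.exists_eq_add_of_le' hk
  exact (congrArg₂ (fun u v => (algebra n γ b β).bracket u v) (X_eq_basisFun ⟨i, hin⟩)
    (Y_eq_basisFun ⟨k, hkn⟩)).trans (bracket_basisFun γ b β _ _)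

theorem bracket_Y_Y {i k : ℕ} (hi : 1 ≤ i) (hin : i ≤ n + 1) (hk : 1 ≤ k) (hkn : k ≤ n + 1) :
    (algebra n γ b β).bracket (Y n i) (Y n k) = mulYY n γ b β i k := by
  obtain ⟨i, rfl⟩ := Nat.exists_eq_add_of_le' hi
  obtain ⟨k, rfl⟩ := Nat.exists_eq_add_of_le' hk
  exact (congrArg₂ (fun u v => (algebra n γ b β).bracket u v) (Y_eq_basisFun ⟨i, hin⟩)
    (Y_eq_basisFun ⟨k, hkn⟩)).trans (bracket_basisFun γ b β _ _)

theorem bracket_X_Y_one (hn : 2 ≤ n) {i : ℕ} (hi : 1 ≤ i) :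
    (algebra n γ b β).bracket (X n i) (Y n 1) = (1 / 2 : ℂ) • Z n (i + 1) := by
  rcases Nat.lt_or_ge n i with h | h
  · rw [X_eq_zero h, Z_eq_zero (by omega)]; simp
  rw [bracket_X_Y γ b β hi h le_rfl (by omega), mulXY]
  rcases h.lt_or_eq with h' | rfl
  · rw [if_pos ⟨rfl, by omega⟩, Z_eq (by omega)]
  · rw [if_neg (by omega), if_neg (by omega), Z_eq_zero (by omega), smul_zero]

theorem bracket_Z_Y_one (hn : 2 ≤ n) {j : ℕ} (hj : 1 ≤ j) :
    (algebra n γ b β).bracket (Z n j) (Y n 1) = X n j := by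
  rcases Nat.lt_or_ge n j with h | h
  · rw [X_eq_zero h, Z_eq_zero (by omega)]; simp
  rw [Z_eq h, bracket_Y_Y γ b β hj (by omega) le_rfl (by omega), mulYY, if_pos ⟨rfl, h⟩]

theorem bracket_Y_last_Y_one (hn : 2 ≤ n) :
    (algebra n γ b β).bracket (Y n (n + 1)) (Y n 1) = 0 := by
  rw [bracket_Y_Y γ b β (by omega) (by omega) le_rfl (by omega), mulYY, if_neg (by omega),
    if_neg (by omega), if_neg (by omega), if_neg (by omega)]

variable {γ b β} {q : ℕ → ℂ}

/-- The case distinctions of the table are absorbed by `Z`. The last coefficient, which carries β,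
is harmless here because its vector has index n + i > n. -/
theorem bracket_X_Y_last (hn : 2 ≤ n) (hq : ∀ i, i + 1 < (n + 1) / 2 → q i = -2 * b (n / 2 + 2 + i))
    {i : ℕ} (hi : 1 ≤ i) :
    (algebra n γ b β).bracket (X n i) (Y n (n + 1)) =
      (-1 / 2 : ℂ) • ∑ k ∈ Finset.range ((n + 1) / 2), q k • Z n (n / 2 + 1 + k + i) := by
  rcases Nat.lt_or_ge n i with h | h
  · rw [X_eq_zero h, Finset.sum_eq_zero fun k _ => by rw [Z_eq_zero (by omega), smul_zero]]; simp
  have hs : ∑ k ∈ Finset.range ((n + 1) / 2), q k • Z n (n / 2 + 1 + k + i) =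
      ∑ k ∈ Finset.range ((n + 1) / 2 - i), q k • Z n (n / 2 + 1 + k + i) := by
    symm
    refine Finset.sum_subset (Finset.range_mono (by omega)) fun k hk hk' => ?_
    rw [Finset.mem_range] at hk hk'
    rw [Z_eq_zero (by omega), smul_zero]
  rw [hs, bracket_X_Y γ b β hi h (by omega) le_rfl, mulXY, if_neg (by omega), Finset.smul_sum]
  split_ifs with h1
  · refine Finset.sum_nbij' (fun k => k - (n + 4) / 2) (fun k => k + (n + 4) / 2) ?_ ?_ ?_ ?_ ?_
    · intro k hk; rw [Finset.mem_Icc] at hk; rw [Finset.mem_range]; omega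
    · intro k hk; rw [Finset.mem_range] at hk; rw [Finset.mem_Icc]; omega
    · intro k hk; rw [Finset.mem_Icc] at hk; omega
    · intro k _; omega
    · intro k hk
      rw [Finset.mem_Icc] at hk
      rw [hq _ (by omega), Z_eq (by omega), smul_smul,
        show n / 2 + 2 + (k - (n + 4) / 2) = k by omega,
        show n / 2 + 1 + (k - (n + 4) / 2) + i = k - 1 + i by omega]
      congr 1; ring
  · rw [Finset.sum_eq_zero]
    intro k hk
    rw [Finset.mem_range] at hk
    omega

theorem bracket_Z_Y_last (hn : 2 ≤ n) (hq : ∀ i, i + 1 < (n + 1) / 2 → q i = -2 * b (n / 2 + 2 + i))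
    (hq' : q ((n + 1) / 2 - 1) = β) {j : ℕ} (hj : 1 ≤ j) :
    (algebra n γ b β).bracket (Z n j) (Y n (n + 1)) =
      ∑ k ∈ Finset.range ((n + 1) / 2), q k • X n (n / 2 + k + j) := by
  rcases Nat.lt_or_ge n j with h | h
  · rw [Z_eq_zero h, Finset.sum_eq_zero fun k _ => by rw [X_eq_zero (by omega), smul_zero]]; simp
  rw [Z_eq h, bracket_Y_Y γ b β hj (by omega) (by omega) le_rfl, mulYY, if_neg (by omega),
    if_neg (by omega)]
  -- Reindexing by k - [(n+4)/2], with m the number of terms. The term with β has index n - 1 + j,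
  -- so it survives only for j = 1.
  have key : ∀ m, m + 1 ≤ (n + 1) / 2 →
      (-2 : ℂ) • ∑ k ∈ Finset.Icc ((n + 4) / 2) (m + n / 2 + 1), b k • X n (k - 2 + j) =
      ∑ k ∈ Finset.range m, q k • X n (n / 2 + k + j) := by
    intro m hm
    rw [Finset.smul_sum]
    refine Finset.sum_nbij' (fun k => k - (n + 4) / 2) (fun k => k + (n + 4) / 2) ?_ ?_ ?_ ?_ ?_
    · intro k hk; rw [Finset.mem_Icc] at hk; rw [Finset.mem_range]; omega
    · intro k hk; rw [Finset.mem_range] at hk; rw [Finset.mem_Icc]; omega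
    · intro k hk; rw [Finset.mem_Icc] at hk; omega
    · intro k _; omega
    · intro k hk
      rw [Finset.mem_Icc] at hk
      rw [hq _ (by omega), smul_smul, show n / 2 + 2 + (k - (n + 4) / 2) = k by omega,
        show n / 2 + (k - (n + 4) / 2) + j = k - 2 + j by omega]
  split_ifs with h1 h2
  · have e : Finset.Icc ((n + 4) / 2) n =
        Finset.Icc ((n + 4) / 2) (((n + 1) / 2 - 1) + n / 2 + 1) := by congr 1; omega
    rw [show (n + 1) / 2 = ((n + 1) / 2 - 1) + 1 by omega, Finset.sum_range_succ,
      ← key _ (by omega), hq', e, show n / 2 + ((n + 1) / 2 - 1) + j = n by omega]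
    congr 2
    refine Finset.sum_congr rfl fun k hk => ?_
    rw [Finset.mem_Icc] at hk
    rw [show k - 2 + j = k - 1 by omega]
  · rw [show n + 2 - j = ((n + 1) / 2 + 1 - j) + n / 2 + 1 by omega, key _ (by omega)]
    refine Finset.sum_subset (Finset.range_mono (by omega)) fun k hk hk' => ?_
    rw [Finset.mem_range] at hk hk'
    rw [X_eq_zero (by omega), smul_zero]
  · rw [Finset.sum_eq_zero]
    intro k _
    rw [X_eq_zero (by omega), smul_zero]

variable (γ b β)

theorem bracket_Y_last_Y_last (hn : 2 ≤ n) :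
    (algebra n γ b β).bracket (Y n (n + 1)) (Y n (n + 1)) = γ • X n n := by
  rw [bracket_Y_Y γ b β (by omega) (by omega) (by omega) (by omega), mulYY, if_neg (by omega),
    if_pos ⟨rfl, rfl⟩]

theorem bracket_X_X_one (hn : 2 ≤ n) {i : ℕ} (hi : 1 ≤ i) :
    (algebra n γ b β).bracket (X n i) (X n 1) = X n (i + 1) := by
  rcases Nat.lt_or_ge n i with h | h
  · rw [X_eq_zero h, X_eq_zero (k := i + 1) (by omega)]; simp
  rw [bracket_X_X γ b β hi h le_rfl (by omega), mulXX]
  rcases h.lt_or_eq with h' | rfl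
  · rw [if_pos ⟨rfl, by omega⟩]
  · rw [if_neg (by omega), X_eq_zero (by omega)]

theorem bracket_Z_X_one (hn : 2 ≤ n) {i : ℕ} (hi : 1 ≤ i) :
    (algebra n γ b β).bracket (Z n i) (X n 1) = Z n (i + 1) := by
  rcases Nat.lt_or_ge n i with h | h
  · rw [Z_eq_zero h, Z_eq_zero (by omega)]; simp
  rw [Z_eq h, bracket_Y_X γ b β hi (by omega) le_rfl (by omega), mulYX]
  rcases h.lt_or_eq with h' | rfl
  · rw [if_pos ⟨rfl, by omega⟩, Z_eq (by omega)]
  · rw [if_neg (by omega), Z_eq_zero (by omega)]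

theorem bracket_Y_last_X_one (hn : 2 ≤ n) :
    (algebra n γ b β).bracket (Y n (n + 1)) (X n 1) = 0 := by
  rw [bracket_Y_X γ b β (by omega) le_rfl le_rfl (by omega), mulYX, if_neg (by omega)]

/-- Reflects [y_1,y_1] = x_1. Thus right multiplication by any element is built from R_{y_1} and
R_{y_{n+1}}. -/
theorem bracket_X_one (hn : 2 ≤ n) (u : Space n) : (algebra n γ b β).bracket u (X n 1) =
    (2 : ℂ) • (algebra n γ b β).bracket ((algebra n γ b β).bracket u (Y n 1)) (Y n 1) := by
  have : (algebra n γ b β).rightMul (X n 1) =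
      (2 : ℂ) • (algebra n γ b β).rightMul (Y n 1) ∘ₗ (algebra n γ b β).rightMul (Y n 1) := by
    refine hom_ext (fun i hi _ => ?_) (fun j hj _ => ?_) ?_
    · simp [bracket_X_X_one γ b β hn hi, bracket_X_Y_one γ b β hn hi,
        bracket_Z_Y_one γ b β hn (show 1 ≤ i + 1 by omega)]
    · simp [bracket_Z_X_one γ b β hn hj, bracket_X_Y_one γ b β hn hj,
        bracket_Z_Y_one γ b β hn hj]
    · simp [bracket_Y_last_X_one γ b β hn, bracket_Y_last_Y_one γ b β hn]
  exact LinearMap.congr_fun this u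

theorem bracket_X_of_two_le {k : ℕ} (hk : 2 ≤ k) (u : Space n) :
    (algebra n γ b β).bracket u (X n k) = 0 := by
  rcases Nat.lt_or_ge n k with h | h
  · rw [X_eq_zero h]; simp
  have : (algebra n γ b β).rightMul (X n k) = 0 := by
    refine hom_ext (fun i hi hin => ?_) (fun j hj hjn => ?_) ?_
    · rw [SuperProduct.rightMul_apply, bracket_X_X γ b β hi hin (by omega) h, mulXX,
        if_neg (by omega), LinearMap.zero_apply]
    · rw [SuperProduct.rightMul_apply, Z_eq hjn, bracket_Y_X γ b β hj (by omega) (by omega) h,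
        mulYX, if_neg (by omega), LinearMap.zero_apply]
    · rw [SuperProduct.rightMul_apply, bracket_Y_X γ b β (by omega) (by omega) (by omega) h,
        mulYX, if_neg (by omega), LinearMap.zero_apply]
  exact LinearMap.congr_fun this u

theorem bracket_Z_of_two_le {k : ℕ} (hk : 2 ≤ k) (u : Space n) :
    (algebra n γ b β).bracket u (Z n k) = 0 := by
  rcases Nat.lt_or_ge n k with h | h
  · rw [Z_eq_zero h]; simp
  rw [Z_eq h]
  have : (algebra n γ b β).rightMul (Y n k) = 0 := by
    refine hom_ext (fun i hi hin => ?_) (fun j hj hjn => ?_) ?_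
    · rw [SuperProduct.rightMul_apply, bracket_X_Y γ b β hi hin (by omega) (by omega), mulXY,
        if_neg (by omega), if_neg (by omega), LinearMap.zero_apply]
    · rw [SuperProduct.rightMul_apply, Z_eq hjn,
        bracket_Y_Y γ b β hj (by omega) (by omega) (by omega),
        mulYY, if_neg (by omega), if_neg (by omega), if_neg (by omega), if_neg (by omega),
        LinearMap.zero_apply]
    · rw [SuperProduct.rightMul_apply, bracket_Y_Y γ b β (by omega) (by omega) (by omega) (by omega),
        mulYY, if_neg (by omega), if_neg (by omega), if_neg (by omega), if_neg (by omega),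
        LinearMap.zero_apply]
  exact LinearMap.congr_fun this u

/-- The product in terms of the coordinates of the right factor. -/
theorem bracket_eq (hn : 2 ≤ n) (u v : Space n) : (algebra n γ b β).bracket u v =
    v (Sum.inr 0) • (algebra n γ b β).bracket u (Y n 1) +
    v (Sum.inr (Fin.last n)) • (algebra n γ b β).bracket u (Y n (n + 1)) +
    (2 * v (Sum.inl ⟨0, by omega⟩)) •
      (algebra n γ b β).bracket ((algebra n γ b β).bracket u (Y n 1)) (Y n 1) := by
  have : (algebra n γ b β).bracket u =
      (LinearMap.proj (Sum.inr 0)).smulRight ((algebra n γ b β).bracket u (Y n 1)) +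
      (LinearMap.proj (Sum.inr (Fin.last n))).smulRight
        ((algebra n γ b β).bracket u (Y n (n + 1))) +
      (LinearMap.proj (Sum.inl ⟨0, by omega⟩)).smulRight
        ((algebra n γ b β).bracket u (X n 1)) := by
    refine hom_ext (fun i hi hin => ?_) (fun j hj hjn => ?_) ?_
    · rcases hi.eq_or_lt with rfl | h
      · simp [X]
      · rw [bracket_X_of_two_le γ b β h]
        have : 1 ≠ i := by omega
        simp [X, this]
    · rw [Z_eq hjn]
      rcases hj.eq_or_lt with rfl | h
      · have : n ≠ 0 := by omega
        simp [Y, this]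
      · rw [← Z_eq hjn, bracket_Z_of_two_le γ b β h, Z_eq hjn]
        have h1 : 1 ≠ j := by omega
        have h2 : n + 1 ≠ j := by omega
        simp [Y, h1, h2]
    · have : 0 ≠ n := by omega
      simp [Y, this]
  have h1 := LinearMap.congr_fun this v
  rw [bracket_X_one γ b β hn u] at h1
  rw [h1, mul_comm 2, mul_smul]
  rfl

theorem mem_even_iff {v : Space n} :
    v ∈ (algebra n γ b β).part 0 ↔ ∀ j, v (Sum.inr j) = 0 := by
  have e : (algebra n γ b β).part 0 =
      Submodule.span ℂ (Set.range fun i : Fin n => X n (i + 1)) := by simp [algebra]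
  rw [e]
  constructor
  · intro hv j
    have : Submodule.span ℂ (Set.range fun i : Fin n => X n (i + 1)) ≤
        LinearMap.ker (LinearMap.proj (R := ℂ) (φ := fun _ : Idx n => ℂ) (Sum.inr j)) := by
      rw [Submodule.span_le]
      rintro _ ⟨i, rfl⟩
      rfl
    exact this hv
  · intro hv
    have h1 := (Pi.basisFun ℂ (Idx n)).sum_repr v
    rw [Fintype.sum_sum_type] at h1
    simp only [Pi.basisFun_repr, hv, zero_smul, Finset.sum_const_zero, add_zero,
      ← X_eq_basisFun] at h1
    rw [← h1]
    exact sum_mem fun i _ => Submodule.smul_mem _ _ (Submodule.subset_span ⟨i, rfl⟩)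

theorem mem_odd_iff {v : Space n} :
    v ∈ (algebra n γ b β).part 1 ↔ ∀ i, v (Sum.inl i) = 0 := by
  have e : (algebra n γ b β).part 1 =
      Submodule.span ℂ (Set.range fun j : Fin (n + 1) => Y n (j + 1)) := by simp [algebra]
  rw [e]
  constructor
  · intro hv j
    have : Submodule.span ℂ (Set.range fun j : Fin (n + 1) => Y n (j + 1)) ≤
        LinearMap.ker (LinearMap.proj (R := ℂ) (φ := fun _ : Idx n => ℂ) (Sum.inl j)) := by
      rw [Submodule.span_le]
      rintro _ ⟨i, rfl⟩
      rfl
    exact this hv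
  · intro hv
    have h1 := (Pi.basisFun ℂ (Idx n)).sum_repr v
    rw [Fintype.sum_sum_type] at h1
    simp only [Pi.basisFun_repr, hv, zero_smul, Finset.sum_const_zero, zero_add,
      ← Y_eq_basisFun] at h1
    rw [← h1]
    exact sum_mem fun i _ => Submodule.smul_mem _ _ (Submodule.subset_span ⟨i, rfl⟩)

theorem isInternal : DirectSum.IsInternal (algebra n γ b β).part := by
  refine (DirectSum.isInternal_submodule_iff_isCompl _ (i := 0) (j := 1) (by decide)
    (Set.eq_univ_of_forall (by decide)).symm).2 ⟨?_, ?_⟩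
  · rw [Submodule.disjoint_def]
    intro v h0 h1
    rw [mem_even_iff] at h0
    rw [mem_odd_iff] at h1
    ext (s | s)
    · exact h1 s
    · exact h0 s
  · rw [codisjoint_iff, eq_top_iff]
    intro v _
    have e : v = (Sum.elim (fun i => v (Sum.inl i)) fun _ => 0 : Space n) +
        (Sum.elim (fun _ => 0) fun j => v (Sum.inr j) : Space n) := by
      ext (s | s) <;> simp
    rw [e]
    exact add_mem (Submodule.mem_sup_left ((mem_even_iff γ b β).2 fun j => rfl))
      (Submodule.mem_sup_right ((mem_odd_iff γ b β).2 fun j => rfl))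

variable {γ b β}

theorem X_mem_even (i : ℕ) : X n i ∈ (algebra n γ b β).part 0 :=
  (mem_even_iff γ b β).2 fun _ => rfl

theorem Y_mem_odd (i : ℕ) : Y n i ∈ (algebra n γ b β).part 1 :=
  (mem_odd_iff γ b β).2 fun _ => rfl

theorem Z_mem_odd (i : ℕ) : Z n i ∈ (algebra n γ b β).part 1 := by
  rw [Z]
  split_ifs
  · exact Y_mem_odd i
  · exact zero_mem _

theorem Z_apply_zero {k : ℕ} (hk : 2 ≤ k) : Z n k (Sum.inr 0) = 0 := by
  rw [Z]
  split_ifs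
  · have : 1 ≠ k := by omega
    simp [Y, this]
  · rfl

theorem Z_apply_last (k : ℕ) : Z n k (Sum.inr (Fin.last n)) = 0 := by
  rw [Z]
  split_ifs
  · have : n + 1 ≠ k := by omega
    simp [Y, this]
  · rfl

theorem X_apply_zero {k : ℕ} (hn : 0 < n) (hk : 2 ≤ k) : X n k (Sum.inl ⟨0, hn⟩) = 0 := by
  have : 1 ≠ k := by omega
  simp [X, this]

end Table

end LeibFamily

/-! ### The family is presented by two odd generators -/

namespace LeibFamily

variable {n : ℕ}

/-- The coefficients of `[y_1, y_{n+1}]` at `x_{[n/2]+1}, …, x_n`. -/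
noncomputable def coefficient (n : ℕ) (b : ℕ → ℂ) (β : ℂ) (i : ℕ) : ℂ :=
  if i + 1 = (n + 1) / 2 then β else -2 * b (n / 2 + 2 + i)

section Operators

variable (γ : ℂ) (b : ℕ → ℂ) (β : ℂ)

theorem rightMul_last_X (hn : 2 ≤ n) {i : ℕ} (hi : 1 ≤ i) :
    (algebra n γ b β).bracket (X n i) (Y n (n + 1)) = (-1 / 2 : ℂ) •
      ∑ k ∈ Finset.range ((n + 1) / 2), coefficient n b β k • Z n (n / 2 + 1 + k + i) :=
  bracket_X_Y_last hn (fun i hi => if_neg (by omega)) hi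

theorem rightMul_last_Z (hn : 2 ≤ n) {j : ℕ} (hj : 1 ≤ j) :
    (algebra n γ b β).bracket (Z n j) (Y n (n + 1)) =
      ∑ k ∈ Finset.range ((n + 1) / 2), coefficient n b β k • X n (n / 2 + k + j) :=
  bracket_Z_Y_last hn (fun i hi => if_neg (by omega)) (if_pos (by omega)) hj

theorem anticomm (hn : 2 ≤ n) (u : Space n) :
    (algebra n γ b β).bracket ((algebra n γ b β).bracket u (Y n 1)) (Y n (n + 1)) =
      -(algebra n γ b β).bracket ((algebra n γ b β).bracket u (Y n (n + 1))) (Y n 1) := by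
  have : (algebra n γ b β).rightMul (Y n (n + 1)) ∘ₗ (algebra n γ b β).rightMul (Y n 1) =
      -((algebra n γ b β).rightMul (Y n 1) ∘ₗ (algebra n γ b β).rightMul (Y n (n + 1))) := by
    refine hom_ext (fun i hi _ => ?_) (fun j hj _ => ?_) ?_
    · simp only [LinearMap.neg_apply, LinearMap.comp_apply, SuperProduct.rightMul_apply,
        bracket_X_Y_one γ b β hn hi, rightMul_last_X γ b β hn hi, map_smul,
        rightMul_last_Z γ b β hn (show 1 ≤ i + 1 by omega), map_sum]
      rw [← neg_smul]
      congr 1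
      · norm_num
      · refine Finset.sum_congr rfl fun k _ => ?_
        rw [bracket_Z_Y_one γ b β hn (by omega)]
        congr 2; ring
    · simp only [LinearMap.neg_apply, LinearMap.comp_apply, SuperProduct.rightMul_apply,
        bracket_Z_Y_one γ b β hn hj, rightMul_last_X γ b β hn hj, map_smul,
        rightMul_last_Z γ b β hn hj, map_sum]
      rw [Finset.smul_sum, ← Finset.sum_neg_distrib]
      refine Finset.sum_congr rfl fun k _ => ?_
      rw [bracket_X_Y_one γ b β hn (by omega), smul_smul, smul_smul, ← neg_smul,
        show n / 2 + 1 + k + j = n / 2 + k + j + 1 by ring]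
      congr 1; ring
    · simp only [LinearMap.neg_apply, LinearMap.comp_apply, SuperProduct.rightMul_apply,
        bracket_Y_last_Y_one γ b β hn, bracket_Y_last_Y_last γ b β hn, map_smul,
        bracket_X_Y_one γ b β hn (show 1 ≤ n by omega), map_zero]
      rw [Z_eq_zero (by omega)]; simp
  exact LinearMap.congr_fun this u

theorem bracket_last_last (hn : 2 ≤ n) (u : Space n) :
    (algebra n γ b β).bracket ((algebra n γ b β).bracket u (Y n (n + 1))) (Y n (n + 1)) = 0 := by
  have : (algebra n γ b β).rightMul (Y n (n + 1)) ∘ₗ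
      (algebra n γ b β).rightMul (Y n (n + 1)) = 0 := by
    refine hom_ext (fun i hi _ => ?_) (fun j hj _ => ?_) ?_
    · simp only [LinearMap.zero_apply, LinearMap.comp_apply, SuperProduct.rightMul_apply,
        rightMul_last_X γ b β hn hi, map_smul, map_sum]
      rw [Finset.sum_eq_zero, smul_zero]
      intro k _
      rw [rightMul_last_Z γ b β hn (by omega), Finset.sum_eq_zero, smul_zero]
      intro m _
      rw [X_eq_zero (by omega), smul_zero]
    · simp only [LinearMap.zero_apply, LinearMap.comp_apply, SuperProduct.rightMul_apply,
        rightMul_last_Z γ b β hn hj, map_smul, map_sum]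
      rw [Finset.sum_eq_zero]
      intro k _
      rw [rightMul_last_X γ b β hn (by omega), Finset.sum_eq_zero, smul_zero, smul_zero]
      intro m _
      rw [Z_eq_zero (by omega), smul_zero]
    · simp only [LinearMap.zero_apply, LinearMap.comp_apply, SuperProduct.rightMul_apply,
        bracket_Y_last_Y_last γ b β hn, map_smul]
      rw [rightMul_last_X γ b β hn (by omega), Finset.sum_eq_zero, smul_zero, smul_zero]
      intro m _
      rw [Z_eq_zero (by omega), smul_zero]
  exact LinearMap.congr_fun this u

/-- Only the coordinates at y_1, y_{n+1} and x_1 of a right factor matter in `bracket_eq`. This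
lemma and the next show that a product [v,w] can act only through its x_1-coordinate. -/
theorem bracket_one_apply (hn : 2 ≤ n) (u : Space n) :
    (algebra n γ b β).bracket u (Y n 1) (Sum.inr 0) = 0 ∧
    (algebra n γ b β).bracket u (Y n 1) (Sum.inr (Fin.last n)) = 0 ∧
    (algebra n γ b β).bracket u (Y n 1) (Sum.inl ⟨0, by omega⟩) = u (Sum.inr 0) := by
  refine ⟨?_, ?_, ?_⟩
  · have : LinearMap.proj (R := ℂ) (φ := fun _ : Idx n => ℂ) (Sum.inr 0) ∘ₗ
        (algebra n γ b β).rightMul (Y n 1) = 0 := by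
      refine hom_ext (fun i hi _ => ?_) (fun j hj _ => ?_) ?_
      · simp [bracket_X_Y_one γ b β hn hi, Z_apply_zero (show 2 ≤ i + 1 by omega)]
      · simp [bracket_Z_Y_one γ b β hn hj, X]
      · simp [bracket_Y_last_Y_one γ b β hn]
    exact LinearMap.congr_fun this u
  · have : LinearMap.proj (R := ℂ) (φ := fun _ : Idx n => ℂ) (Sum.inr (Fin.last n)) ∘ₗ
        (algebra n γ b β).rightMul (Y n 1) = 0 := by
      refine hom_ext (fun i hi _ => ?_) (fun j hj _ => ?_) ?_
      · simp [bracket_X_Y_one γ b β hn hi, Z_apply_last]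
      · simp [bracket_Z_Y_one γ b β hn hj, X]
      · simp [bracket_Y_last_Y_one γ b β hn]
    exact LinearMap.congr_fun this u
  · have : LinearMap.proj (R := ℂ) (φ := fun _ : Idx n => ℂ) (Sum.inl ⟨0, by omega⟩) ∘ₗ
        (algebra n γ b β).rightMul (Y n 1) = LinearMap.proj (Sum.inr 0) := by
      refine hom_ext (fun i hi _ => ?_) (fun j hj hjn => ?_) ?_
      · have := (mem_odd_iff γ b β).1 (Z_mem_odd (n := n) (i + 1)) ⟨0, by omega⟩
        rw [LinearMap.comp_apply, SuperProduct.rightMul_apply, bracket_X_Y_one γ b β hn hi]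
        simp [this, X]
      · rw [LinearMap.comp_apply, SuperProduct.rightMul_apply, bracket_Z_Y_one γ b β hn hj, Z_eq hjn]
        simp [X, Y]
      · have : 0 ≠ n := by omega
        rw [LinearMap.comp_apply, SuperProduct.rightMul_apply, bracket_Y_last_Y_one γ b β hn]
        simp [Y, this]
    exact LinearMap.congr_fun this u

theorem bracket_last_apply (hn : 2 ≤ n) (u : Space n) :
    (algebra n γ b β).bracket u (Y n (n + 1)) (Sum.inr 0) = 0 ∧
    (algebra n γ b β).bracket u (Y n (n + 1)) (Sum.inr (Fin.last n)) = 0 ∧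
    (algebra n γ b β).bracket u (Y n (n + 1)) (Sum.inl ⟨0, by omega⟩) = 0 := by
  refine ⟨?_, ?_, ?_⟩
  · have : LinearMap.proj (R := ℂ) (φ := fun _ : Idx n => ℂ) (Sum.inr 0) ∘ₗ
        (algebra n γ b β).rightMul (Y n (n + 1)) = 0 := by
      refine hom_ext (fun i hi _ => ?_) (fun j hj _ => ?_) ?_
      · simp only [LinearMap.comp_apply, SuperProduct.rightMul_apply, rightMul_last_X γ b β hn hi,
          LinearMap.proj_apply, Pi.smul_apply, Finset.sum_apply, LinearMap.zero_apply]
        rw [Finset.sum_eq_zero fun k _ => by rw [Z_apply_zero (by omega), smul_zero], smul_zero]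
      · simp [rightMul_last_Z γ b β hn hj, X]
      · simp [bracket_Y_last_Y_last γ b β hn, X]
    exact LinearMap.congr_fun this u
  · have : LinearMap.proj (R := ℂ) (φ := fun _ : Idx n => ℂ) (Sum.inr (Fin.last n)) ∘ₗ
        (algebra n γ b β).rightMul (Y n (n + 1)) = 0 := by
      refine hom_ext (fun i hi _ => ?_) (fun j hj _ => ?_) ?_
      · simp [rightMul_last_X γ b β hn hi, Z_apply_last]
      · simp [rightMul_last_Z γ b β hn hj, X]
      · simp [bracket_Y_last_Y_last γ b β hn, X]
    exact LinearMap.congr_fun this u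
  · have : LinearMap.proj (R := ℂ) (φ := fun _ : Idx n => ℂ) (Sum.inl ⟨0, by omega⟩) ∘ₗ
        (algebra n γ b β).rightMul (Y n (n + 1)) = 0 := by
      refine hom_ext (fun i hi _ => ?_) (fun j hj hjn => ?_) ?_
      · simp only [LinearMap.comp_apply, SuperProduct.rightMul_apply, rightMul_last_X γ b β hn hi,
          LinearMap.proj_apply, Pi.smul_apply, Finset.sum_apply, LinearMap.zero_apply]
        rw [Finset.sum_eq_zero fun k _ => by
          rw [(mem_odd_iff γ b β).1 (Z_mem_odd (n := n) _) ⟨0, by omega⟩, smul_zero], smul_zero]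
      · simp only [LinearMap.comp_apply, SuperProduct.rightMul_apply, rightMul_last_Z γ b β hn hj,
          LinearMap.proj_apply, Pi.smul_apply, Finset.sum_apply, LinearMap.zero_apply]
        rw [Finset.sum_eq_zero fun k _ => by rw [X_apply_zero _ (by omega), smul_zero]]
      · rw [LinearMap.comp_apply, SuperProduct.rightMul_apply, bracket_Y_last_Y_last γ b β hn,
          LinearMap.proj_apply, Pi.smul_apply, X_apply_zero _ hn, smul_zero, LinearMap.zero_apply]
    exact LinearMap.congr_fun this u

theorem map_mem_of_even {S : Submodule ℂ (Space n)} (f : Space n →ₗ[ℂ] Space n)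
    (h : ∀ i, 1 ≤ i → f (X n i) ∈ S) {u : Space n} (hu : u ∈ (algebra n γ b β).part 0) :
    f u ∈ S := by
  have e : (algebra n γ b β).part 0 =
      Submodule.span ℂ (Set.range fun i : Fin n => X n (i + 1)) := by simp [algebra]
  rw [e] at hu
  have : Submodule.span ℂ (Set.range fun i : Fin n => X n (i + 1)) ≤ S.comap f := by
    rw [Submodule.span_le]
    rintro _ ⟨i, rfl⟩
    exact h _ (by omega)
  exact this hu

theorem map_mem_of_odd {S : Submodule ℂ (Space n)} (f : Space n →ₗ[ℂ] Space n)
    (h : ∀ i, 1 ≤ i → f (Z n i) ∈ S) (h' : f (Y n (n + 1)) ∈ S) {u : Space n}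
    (hu : u ∈ (algebra n γ b β).part 1) : f u ∈ S := by
  have e : (algebra n γ b β).part 1 =
      Submodule.span ℂ (Set.range fun j : Fin (n + 1) => Y n (j + 1)) := by simp [algebra]
  rw [e] at hu
  have : Submodule.span ℂ (Set.range fun j : Fin (n + 1) => Y n (j + 1)) ≤ S.comap f := by
    rw [Submodule.span_le]
    rintro _ ⟨i, rfl⟩
    rcases Nat.lt_or_ge (i : ℕ) n with hi | hi
    · have := h (i + 1) (by omega)
      rwa [Z_eq hi] at this
    · rw [SetLike.mem_coe, Submodule.mem_comap]
      simp only [show (i : ℕ) = n by omega]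
      exact h'
  exact this hu

theorem bracket_mem_part (hn : 2 ≤ n) (a c : ZMod 2) (u v : Space n)
    (hu : u ∈ (algebra n γ b β).part a) (hv : v ∈ (algebra n γ b β).part c) :
    (algebra n γ b β).bracket u v ∈ (algebra n γ b β).part (a + c) := by
  have h01 : ∀ u ∈ (algebra n γ b β).part 0,
      (algebra n γ b β).bracket u (Y n 1) ∈ (algebra n γ b β).part 1 := fun u hu =>
    map_mem_of_even γ b β ((algebra n γ b β).rightMul (Y n 1)) (fun i hi => by
      rw [SuperProduct.rightMul_apply, bracket_X_Y_one γ b β hn hi]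
      exact Submodule.smul_mem _ _ (Z_mem_odd _)) hu
  have h11 : ∀ u ∈ (algebra n γ b β).part 1,
      (algebra n γ b β).bracket u (Y n 1) ∈ (algebra n γ b β).part 0 := fun u hu =>
    map_mem_of_odd γ b β ((algebra n γ b β).rightMul (Y n 1)) (fun i hi => by
      rw [SuperProduct.rightMul_apply, bracket_Z_Y_one γ b β hn hi]
      exact X_mem_even _) (by
      rw [SuperProduct.rightMul_apply, bracket_Y_last_Y_one γ b β hn]
      exact zero_mem _) hu
  have h01' : ∀ u ∈ (algebra n γ b β).part 0,
      (algebra n γ b β).bracket u (Y n (n + 1)) ∈ (algebra n γ b β).part 1 := fun u hu =>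
    map_mem_of_even γ b β ((algebra n γ b β).rightMul (Y n (n + 1))) (fun i hi => by
      rw [SuperProduct.rightMul_apply, rightMul_last_X γ b β hn hi]
      exact Submodule.smul_mem _ _ (sum_mem fun k _ => Submodule.smul_mem _ _ (Z_mem_odd _))) hu
  have h11' : ∀ u ∈ (algebra n γ b β).part 1,
      (algebra n γ b β).bracket u (Y n (n + 1)) ∈ (algebra n γ b β).part 0 := fun u hu =>
    map_mem_of_odd γ b β ((algebra n γ b β).rightMul (Y n (n + 1))) (fun i hi => by
      rw [SuperProduct.rightMul_apply, rightMul_last_Z γ b β hn hi]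
      exact sum_mem fun k _ => Submodule.smul_mem _ _ (X_mem_even _)) (by
      rw [SuperProduct.rightMul_apply, bracket_Y_last_Y_last γ b β hn]
      exact Submodule.smul_mem _ _ (X_mem_even _)) hu
  rw [bracket_eq γ b β hn]
  fin_cases c
  · have hv' := (mem_even_iff γ b β).1 hv
    rw [hv', hv', zero_smul, zero_smul, zero_add, zero_add]
    refine Submodule.smul_mem _ _ ?_
    fin_cases a
    · exact h11 _ (h01 _ hu)
    · exact h01 _ (h11 _ hu)
  · have hv' := (mem_odd_iff γ b β).1 hv
    rw [hv', mul_zero, zero_smul, add_zero]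
    fin_cases a
    · exact add_mem (Submodule.smul_mem _ _ (h01 _ hu)) (Submodule.smul_mem _ _ (h01' _ hu))
    · exact add_mem (Submodule.smul_mem _ _ (h11 _ hu)) (Submodule.smul_mem _ _ (h11' _ hu))

/-- By `bracket_eq` both sides are combinations of words in R_{y_1} and R_{y_{n+1}}. With these
anticommuting and R_{y_{n+1}}² = 0, the identity becomes a comparison of coefficients for each pair
of parities. -/
theorem isLeibnizSuperalgebra (hn : 2 ≤ n) : (algebra n γ b β).IsLeibnizSuperalgebra := by
  refine ⟨isInternal γ b β, bracket_mem_part γ b β hn, fun a c u v w hv hw => ?_⟩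
  have hanti := anticomm γ b β hn
  have hll := bracket_last_last γ b β hn
  have h1 : (algebra n γ b β).bracket u ((algebra n γ b β).bracket v w) =
      (2 * (w (Sum.inr 0) * v (Sum.inr 0))) •
        (algebra n γ b β).bracket ((algebra n γ b β).bracket u (Y n 1)) (Y n 1) := by
    obtain ⟨p1, p2, p3⟩ := bracket_one_apply γ b β hn v
    obtain ⟨l1, l2, l3⟩ := bracket_last_apply γ b β hn v
    obtain ⟨r1, r2, r3⟩ := bracket_one_apply γ b β hn ((algebra n γ b β).bracket v (Y n 1))
    rw [bracket_eq γ b β hn u ((algebra n γ b β).bracket v w), bracket_eq γ b β hn v w]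
    simp only [Pi.add_apply, Pi.smul_apply, p1, p2, p3, l1, l2, l3, r1, r2, r3, smul_eq_mul,
      mul_zero, add_zero, zero_smul, zero_add]
  rw [h1, bracket_eq γ b β hn (((algebra n γ b β).bracket u) v) w,
    bracket_eq γ b β hn (((algebra n γ b β).bracket u) w) v, bracket_eq γ b β hn u v,
    bracket_eq γ b β hn u w]
  simp only [map_add, map_smul, LinearMap.add_apply, LinearMap.smul_apply, hanti, hll, map_neg,
    LinearMap.neg_apply, smul_neg, smul_zero]
  fin_cases a <;> fin_cases c
  · have hv' := (mem_even_iff γ b β).1 hv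
    have hw' := (mem_even_iff γ b β).1 hw
    change _ = _ - (-1 : ℂ) ^ ((0 : ZMod 2).val * (0 : ZMod 2).val) • _
    simp only [hv', hw', ZMod.val_zero, zero_mul, pow_zero]
    module
  · have hv' := (mem_even_iff γ b β).1 hv
    have hw' := (mem_odd_iff γ b β).1 hw
    change _ = _ - (-1 : ℂ) ^ ((0 : ZMod 2).val * (1 : ZMod 2).val) • _
    simp only [hv', hw', ZMod.val_zero, zero_mul, pow_zero]
    module
  · have hv' := (mem_odd_iff γ b β).1 hv
    have hw' := (mem_even_iff γ b β).1 hw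
    change _ = _ - (-1 : ℂ) ^ ((1 : ZMod 2).val * (0 : ZMod 2).val) • _
    simp only [hv', hw', ZMod.val_zero, mul_zero, pow_zero]
    module
  · have hv' := (mem_odd_iff γ b β).1 hv
    have hw' := (mem_odd_iff γ b β).1 hw
    have e : (-1 : ℂ) ^ ((1 : ZMod 2).val * (1 : ZMod 2).val) = -1 := by
      rw [show (1 : ZMod 2).val * (1 : ZMod 2).val = 1 by decide, pow_one]
    simp only [hv', hw']
    change _ = _ - (-1 : ℂ) ^ ((1 : ZMod 2).val * (1 : ZMod 2).val) • _
    rw [e]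
    module

/-- The factor s = √2 absorbs the ½ in [x_i,y_1]: the chain of s y_1 is s y_1, 2 x_1, s y_2, 2 x_2,
…, without growing powers of two, so the table coefficients are directly those of the presentation.
-/
theorem isPresentedBy (hn : 2 ≤ n) {s : ℂ} (hs : s * s = 2) :
    (algebra n γ b β).IsPresentedBy n γ (coefficient n b β) (s • Y n 1) (s • Y n (n + 1)) := by
  have hs0 : s ≠ 0 := by rintro rfl; simp at hs
  have hpow : ∀ i, ((algebra n γ b β).rightMul (s • Y n 1) ^ (2 * i)) (s • Y n 1) =
        s • Z n (i + 1) ∧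
      ((algebra n γ b β).rightMul (s • Y n 1) ^ (2 * i + 1)) (s • Y n 1) =
        (2 : ℂ) • X n (i + 1) := by
    have hstep : ∀ i, (algebra n γ b β).rightMul (s • Y n 1) (s • Z n (i + 1)) =
        (2 : ℂ) • X n (i + 1) := by
      intro i
      rw [SuperProduct.rightMul_apply, map_smul, map_smul, LinearMap.smul_apply,
        bracket_Z_Y_one γ b β hn (by omega), smul_smul, hs]
    intro i
    induction i with
    | zero =>
      have := hstep 0
      rw [zero_add, Z_eq (by omega)] at this
      exact ⟨by rw [zero_add, Z_eq (by omega)]; simp, by simpa using this⟩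
    | succ i ih =>
      have h1 : ((algebra n γ b β).rightMul (s • Y n 1) ^ (2 * (i + 1))) (s • Y n 1) =
          s • Z n (i + 1 + 1) := by
        rw [show 2 * (i + 1) = 2 * i + 1 + 1 by ring, pow_succ', Module.End.mul_apply, ih.2,
          SuperProduct.rightMul_apply, map_smul, map_smul, LinearMap.smul_apply,
          bracket_X_Y_one γ b β hn (by omega), smul_smul, smul_smul]
        congr 1; ring
      refine ⟨h1, ?_⟩
      rw [pow_succ', Module.End.mul_apply, h1, hstep]
  have hX : X n n ≠ 0 := by
    intro h
    have := congrFun h (Sum.inl ⟨n - 1, by omega⟩)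
    simp [X] at this
    omega
  have hY : Y n (n + 1) ≠ 0 := by
    intro h
    have := congrFun h (Sum.inr (Fin.last n))
    simp [Y] at this
  have htop := (hpow (n - 1)).2
  rw [show 2 * (n - 1) + 1 = 2 * n - 1 by omega, show n - 1 + 1 = n by omega] at htop
  refine ⟨isLeibnizSuperalgebra γ b β hn, ?_, Submodule.smul_mem _ _ (Y_mem_odd _),
    Submodule.smul_mem _ _ (Y_mem_odd _), smul_ne_zero hs0 hY, ?_, ?_, ?_, ?_, ?_⟩
  · simp; ring
  · simp [bracket_Y_last_Y_one γ b β hn]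
  · rw [(hpow n).1, Z_eq_zero (by omega), smul_zero]
  · rw [htop]
    exact smul_ne_zero two_ne_zero hX
  · rw [SuperProduct.oddPoly, map_sum, map_smul, map_smul, LinearMap.smul_apply, smul_smul, hs,
      ← Z_eq (show 1 ≤ n by omega), rightMul_last_Z γ b β hn le_rfl, Finset.smul_sum,
      Z_eq (show 1 ≤ n by omega)]
    refine Finset.sum_congr rfl fun k _ => ?_
    rw [cyclicMap_C_mul, cyclicMap_X_pow,
      show 2 * (n / 2) + 1 + 2 * k = 2 * (n / 2 + k) + 1 by ring, (hpow _).2, smul_comm]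
  · rw [htop, map_smul, map_smul, LinearMap.smul_apply, smul_smul, hs,
      bracket_Y_last_Y_last γ b β hn, smul_comm]

/-- The coefficients of the presentation of `L n p`. -/
noncomputable def presCoeff (n : ℕ) (p : ℕ → ℂ) (i : ℕ) : ℂ :=
  if i + 1 = (n + 1) / 2 then p (i + 1) else -2 * p (i + 1)

theorem exists_isPresentedBy_L (hn : 2 ≤ n) (p : ℕ → ℂ) :
    ∃ y y', (L n p).IsPresentedBy n (p 0) (presCoeff n p) y y' := by
  obtain ⟨s, hs⟩ := IsAlgClosed.exists_pow_nat_eq (2 : ℂ) two_pos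
  have h := isPresentedBy (p 0) (fun k => p (k + 1 - (n + 4) / 2)) (p ((n + 1) / 2)) hn
    (s := s) (by rw [← pow_two, hs])
  have e : coefficient n (fun k => p (k + 1 - (n + 4) / 2)) (p ((n + 1) / 2)) = presCoeff n p := by
    funext i
    rw [coefficient, presCoeff]
    split_ifs with h1
    · rw [h1]
    · rw [show n / 2 + 2 + i + 1 - (n + 4) / 2 = i + 1 by omega]
  rw [e] at h
  exact ⟨_, _, h⟩

end Operators

end LeibFamily

/-! ### Change of generators -/

namespace SuperProduct

open Polynomial

/-- The even polynomial `P` with `X * P = oddPoly n q`. -/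
noncomputable def evenPoly (n : ℕ) (q : ℕ → ℂ) : ℂ[X] :=
  ∑ i ∈ Finset.range ((n + 1) / 2), C (q i) * X ^ (2 * (n / 2) + 2 * i)

theorem X_mul_evenPoly (n : ℕ) (q : ℕ → ℂ) : X * evenPoly n q = oddPoly n q := by
  rw [evenPoly, oddPoly, Finset.mul_sum]
  exact Finset.sum_congr rfl fun i _ => by ring

theorem X_pow_dvd_evenPoly (n : ℕ) (q : ℕ → ℂ) : X ^ (2 * (n / 2)) ∣ evenPoly n q :=
  Finset.dvd_sum fun i _ => (pow_dvd_pow _ (by omega)).mul_left _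

/-- The lowest exponent of the product is 4 [n/2] + 1, which equals 2n - 1 for odd n and exceeds 2n
for even n. This is where the parity of n enters the classification. -/
theorem X_pow_dvd_evenPoly_mul_oddPoly_sub (n : ℕ) (q q' : ℕ → ℂ) :
    X ^ (2 * n) ∣ evenPoly n q * oddPoly n q' -
      C (if Odd n then q 0 * q' 0 else 0) * X ^ (2 * n - 1) := by
  split_ifs with hn
  · obtain ⟨h, rfl⟩ := hn
    have h1 : X ^ (2 * h + 2) ∣ evenPoly (2 * h + 1) q - C (q 0) * X ^ (2 * h) := by
      rw [evenPoly, show (2 * h + 1 + 1) / 2 = h + 1 by omega, show (2 * h + 1) / 2 = h by omega,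
        Finset.sum_range_succ', mul_zero, add_zero, add_sub_cancel_right]
      exact Finset.dvd_sum fun i _ => (pow_dvd_pow _ (by omega)).mul_left _
    obtain ⟨r, hr⟩ := h1
    obtain ⟨r', hr'⟩ : X ^ (2 * h + 2) ∣ evenPoly (2 * h + 1) q' - C (q' 0) * X ^ (2 * h) := by
      rw [evenPoly, show (2 * h + 1 + 1) / 2 = h + 1 by omega, show (2 * h + 1) / 2 = h by omega,
        Finset.sum_range_succ', mul_zero, add_zero, add_sub_cancel_right]
      exact Finset.dvd_sum fun i _ => (pow_dvd_pow _ (by omega)).mul_left _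
    rw [sub_eq_iff_eq_add] at hr hr'
    rw [← X_mul_evenPoly, hr, hr', show 2 * (2 * h + 1) - 1 = 4 * h + 1 by omega, C_mul]
    exact ⟨X * (X ^ 2 * r * r' + r * C (q' 0) + r' * C (q 0)), by ring⟩
  · rw [Nat.not_odd_iff_even] at hn
    obtain ⟨h, rfl⟩ := hn
    rw [map_zero, zero_mul, sub_zero]
    have h1 := mul_dvd_mul (X_pow_dvd_evenPoly (h + h) q)
      (X_pow_dvd_oddPoly (h + h) q' (k := 2 * h) (by omega))
    refine dvd_trans ?_ h1
    rw [← pow_add]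
    exact pow_dvd_pow _ (by omega)

/-- Equivalence of the parameters of presentations. -/
def ParamRel (n : ℕ) (g : ℂ) (q : ℕ → ℂ) (g' : ℂ) (q' : ℕ → ℂ) : Prop :=
  ∃ A D B : ℂ, A ≠ 0 ∧ D ≠ 0 ∧ D ^ 2 * g' = A ^ (2 * n) * g ∧
    (∀ i, i + 1 < (n + 1) / 2 → D * q' i = A ^ (2 * (n / 2) + 1 + 2 * i) * q i) ∧
    D * q' ((n + 1) / 2 - 1) = A ^ (2 * n - 1) * q ((n + 1) / 2 - 1) +
      D * B * (g' - if Odd n then q' 0 ^ 2 else 0)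

section Change

variable {V : Type*} [AddCommGroup V] [Module ℂ V] {L : SuperProduct V} {n : ℕ} {g : ℂ}
  {q : ℕ → ℂ} {y y' : V}

theorem pow_apply_of_sq {b β : V →ₗ[ℂ] V} {A : ℂ} (h : ∀ u, β (β u) = A ^ 2 • b (b u))
    (k : ℕ) (u : V) : (β ^ (2 * k)) u = A ^ (2 * k) • (b ^ (2 * k)) u := by
  induction k generalizing u with
  | zero => simp
  | succ k ih =>
    rw [show 2 * (k + 1) = 2 * k + 1 + 1 by ring, pow_succ, pow_succ, Module.End.mul_apply,
      Module.End.mul_apply, h, map_smul, ih, pow_succ b, pow_succ b, Module.End.mul_apply,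
      Module.End.mul_apply, smul_smul]
    congr 1; ring

/-- An odd polynomial in β is an even one applied after β, and even polynomials in β are polynomials
in b. The intended case is b = R_y and β = R_z for the new generator z. -/
theorem cyclicMap_oddPoly_of_sq {b β : V →ₗ[ℂ] V} {A : ℂ} (h : ∀ u, β (β u) = A ^ 2 • b (b u))
    (z : V) (n : ℕ) (q : ℕ → ℂ) : cyclicMap β z (oddPoly n q) =
      aeval b (evenPoly n fun i => A ^ (2 * (n / 2) + 2 * i) * q i) (β z) := by
  rw [oddPoly, evenPoly, map_sum, map_sum, LinearMap.sum_apply]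
  refine Finset.sum_congr rfl fun i _ => ?_
  rw [cyclicMap_C_mul, cyclicMap_X_pow,
    show 2 * (n / 2) + 1 + 2 * i = 2 * (n / 2 + i) + 1 by ring, pow_succ, Module.End.mul_apply,
    pow_apply_of_sq h,
    map_mul, map_pow, aeval_C, aeval_X, show 2 * (n / 2) + 2 * i = 2 * (n / 2 + i) by ring,
    smul_smul, Module.End.mul_apply, Module.algebraMap_end_apply, mul_comm]

namespace IsPresentedBy

/-- On the cyclic part R_{y'}² multiplies by P(X) P(-X) = -P², of order at least 2n. -/
theorem bracket_bracket_right (h : L.IsPresentedBy n g q y y') (hn : 2 ≤ n) (u : V) :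
    L.bracket (L.bracket u y') y' = 0 := by
  obtain ⟨f, c, rfl⟩ := h.exists_eq u
  simp only [map_add, map_smul, LinearMap.add_apply, LinearMap.smul_apply, h.bracket_right,
    h.bracket_cyclicMap, ← cyclicMap_X_pow]
  have h1 : X ^ (2 * n) ∣ (f.comp (-X) * oddPoly n q).comp (-X) * oddPoly n q := by
    rw [mul_comp, oddPoly_comp_neg, mul_assoc, neg_mul]
    exact ((X_pow_dvd_oddPoly_mul n q q).neg_right).mul_left _
  have h2 : X ^ (2 * n) ∣ (X ^ (2 * n - 1) : ℂ[X]).comp (-X) * oddPoly n q := by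
    rw [X_pow_comp, neg_pow, mul_assoc]
    refine Dvd.dvd.mul_left ?_ _
    have := mul_dvd_mul (dvd_refl (X ^ (2 * n - 1) : ℂ[X])) (X_pow_dvd_oddPoly n q (k := 1) (by omega))
    rwa [← pow_add, Nat.sub_add_cancel (by omega)] at this
  rw [h.cyclicMap_eq_zero_iff.2 h1, h.cyclicMap_eq_zero_iff.2 h2]
  simp

/-- The chain vector of degree k acquires the factor A^(k+1), and y' the factor D. -/
theorem scale (h : L.IsPresentedBy n g q y y') {A D : ℂ} (hA : A ≠ 0) (hD : D ≠ 0) {g₁ : ℂ}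
    {q₁ : ℕ → ℂ} (hg : D ^ 2 * g = A ^ (2 * n) * g₁)
    (hq : ∀ i < (n + 1) / 2, D * q i = A ^ (2 * (n / 2) + 1 + 2 * i) * q₁ i) :
    L.IsPresentedBy n g₁ q₁ (A • y) (D • y') := by
  have hn := h.pos
  have hR : L.rightMul (A • y) = A • L.rightMul y := by
    ext u; simp
  have hpow : ∀ k, (L.rightMul (A • y) ^ k) (A • y) = A ^ (k + 1) • (L.rightMul y ^ k) y := by
    intro k
    rw [hR, _root_.smul_pow, LinearMap.smul_apply, map_smul, smul_smul, pow_succ]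
  refine ⟨h.isLeibniz, h.finrank_eq, Submodule.smul_mem _ _ h.mem, Submodule.smul_mem _ _ h.mem',
    smul_ne_zero hD h.ne_zero, ?_, ?_, ?_, ?_, ?_⟩
  · simp [h.bracket_eq_zero]
  · rw [hpow, h.pow_eq_zero, smul_zero]
  · rw [hpow]
    exact smul_ne_zero (_root_.pow_ne_zero _ hA) h.pow_ne_zero
  · rw [map_smul, map_smul, LinearMap.smul_apply, h.bracket_left, oddPoly, oddPoly, map_sum, map_sum,
      smul_smul, Finset.smul_sum]
    refine Finset.sum_congr rfl fun i hi => ?_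
    rw [cyclicMap_C_mul, cyclicMap_C_mul, cyclicMap_X_pow, cyclicMap_X_pow, hpow, smul_smul,
      smul_smul]
    congr 1
    have := hq i (Finset.mem_range.1 hi)
    rw [pow_succ]
    linear_combination A * this
  · rw [map_smul, map_smul, LinearMap.smul_apply, h.bracket_right, hpow, smul_smul, smul_smul,
      smul_smul, Nat.sub_add_cancel (by omega)]
    congr 1
    linear_combination hg

/-- R_z² = R_y² by anticommutation and R_{y'}² = 0, so the chain changes only through R_z z. The
correction of y' cancels [y',z] = B g R_y^(2n-1) y. In the top degree [z,z'] gains B g, while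
re-expanding P in the chain of z costs B q_0² if n is odd. -/
theorem shear (h : L.IsPresentedBy n g q y y') (hn : 2 ≤ n) (B : ℂ) {q₁ : ℕ → ℂ}
    (hq : ∀ i, i + 1 < (n + 1) / 2 → q₁ i = q i)
    (hq' : q₁ ((n + 1) / 2 - 1) = q ((n + 1) / 2 - 1) + B * (g - if Odd n then q 0 ^ 2 else 0)) :
    L.IsPresentedBy n g q₁ (y + B • y')
      (y' - (B * g) • (L.rightMul y ^ (2 * n - 2)) y) := by
  set z := y + B • y' with hz
  set z' := y' - (B * g) • (L.rightMul y ^ (2 * n - 2)) y with hz'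
  have hR : ∀ u, L.rightMul z u = L.bracket u y + B • L.bracket u y' := by
    intro u; simp [hz]
  have hR' : ∀ u, L.bracket u z' = L.bracket u y' := by
    intro u
    rw [hz', map_sub, map_smul, h.isLeibniz.bracket_pow h.mem _ (by omega), smul_zero, sub_zero]
  have hsq : ∀ u, L.rightMul z (L.rightMul z u) =
      (1 : ℂ) ^ 2 • L.rightMul y (L.rightMul y u) := by
    intro u
    simp only [hR, rightMul_apply, map_add, map_smul, LinearMap.add_apply, LinearMap.smul_apply,
      h.anticomm, h.bracket_bracket_right hn]
    simp
  have hXP : ∀ k, 2 * n ≤ k + 2 → X ^ (2 * n) ∣ X ^ k * oddPoly n q := by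
    intro k hk
    have := mul_dvd_mul (dvd_refl (X ^ k : ℂ[X])) (X_pow_dvd_oddPoly n q (k := 2) (by omega))
    rw [← pow_add] at this
    exact (pow_dvd_pow _ hk).trans this
  have hdpow : ∀ k, 2 * n ≤ k + 2 → L.bracket ((L.rightMul y ^ k) y) y' = 0 := by
    intro k hk
    rw [← cyclicMap_X_pow, h.bracket_cyclicMap, h.cyclicMap_eq_zero_iff, X_pow_comp, neg_pow,
      mul_assoc]
    exact (hXP k hk).mul_left _
  have hbpow : ∀ k, L.bracket ((L.rightMul y ^ k) y) y = (L.rightMul y ^ (k + 1)) y := by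
    intro k
    rw [pow_succ', Module.End.mul_apply, rightMul_apply]
  have hβz : L.rightMul z z = cyclicMap (L.rightMul y) y
      (X + C B * oddPoly n q + C (B ^ 2 * g) * X ^ (2 * n - 1)) := by
    rw [hR, map_add (cyclicMap _ _), map_add (cyclicMap _ _), cyclicMap_C_mul, cyclicMap_C_mul,
      cyclicMap_X_pow, ← h.bracket_left, ← pow_one X, cyclicMap_X_pow, pow_one, rightMul_apply, hz]
    simp only [map_add, map_smul, LinearMap.add_apply, LinearMap.smul_apply, h.bracket_eq_zero,
      h.bracket_right]
    module
  have htop : (L.rightMul z ^ (2 * n - 1)) z = (L.rightMul y ^ (2 * n - 1)) y := by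
    rw [show 2 * n - 1 = 2 * (n - 1) + 1 by omega, pow_succ, Module.End.mul_apply,
      pow_apply_of_sq hsq, hβz, one_pow, one_smul, ← cyclicMap_X_pow_mul, ← cyclicMap_X_pow,
      ← sub_eq_zero, ← map_sub, h.cyclicMap_eq_zero_iff]
    have e : X ^ (2 * (n - 1)) * (X + C B * oddPoly n q + C (B ^ 2 * g) * X ^ (2 * (n - 1) + 1)) -
        X ^ (2 * (n - 1) + 1) = C B * (X ^ (2 * (n - 1)) * oddPoly n q) +
          C (B ^ 2 * g) * X ^ (2 * (n - 1) + 1 + 2 * (n - 1)) := by ring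
    rw [show 2 * n - 1 = 2 * (n - 1) + 1 by omega, e]
    exact dvd_add ((hXP _ (by omega)).mul_left _) ((pow_dvd_pow _ (by omega)).mul_left _)
  have hmem : (L.rightMul y ^ (2 * n - 2)) y ∈ L.part 1 := by
    have := (h.isLeibniz.pow_mem_even h.mem (n - 1)).1
    rwa [show 2 * (n - 1) = 2 * n - 2 by omega] at this
  refine ⟨h.isLeibniz, h.finrank_eq, add_mem h.mem (Submodule.smul_mem _ _ h.mem'),
    sub_mem h.mem' (Submodule.smul_mem _ _ hmem), ?_, ?_, ?_, ?_, ?_, ?_⟩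
  · intro h0
    have h1 : cyclicMap (L.rightMul y) y (C (-(B * g)) * X ^ (2 * n - 2)) + (1 : ℂ) • y' = 0 := by
      rw [cyclicMap_C_mul, cyclicMap_X_pow, ← h0, hz']
      module
    exact one_ne_zero (h.indep h1).2
  · rw [← rightMul_apply, hR, hz']
    simp only [map_sub, map_smul, LinearMap.sub_apply, LinearMap.smul_apply, h.bracket_eq_zero,
      h.bracket_right]
    rw [hdpow _ (by omega), hbpow, show 2 * n - 2 + 1 = 2 * n - 1 by omega]
    module
  · rw [pow_apply_of_sq hsq, h.pow_apply_eq_zero, smul_zero]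
  · rw [htop]; exact h.pow_ne_zero
  · rw [cyclicMap_oddPoly_of_sq hsq, hβz, ← cyclicMap_mul, hR', hz, map_add, LinearMap.add_apply,
      map_smul, LinearMap.smul_apply, h.bracket_left, h.bracket_right, ← cyclicMap_X_pow,
      smul_smul, ← cyclicMap_C_mul, ← map_add, ← sub_eq_zero, ← map_sub, h.cyclicMap_eq_zero_iff]
    simp only [one_pow, one_mul]
    have h1 := X_pow_dvd_evenPoly_mul_oddPoly_sub n q₁ q
    have h2 : oddPoly n q₁ = oddPoly n q +
        C (B * (g - if Odd n then q 0 ^ 2 else 0)) * X ^ (2 * n - 1) := by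
      rw [oddPoly, oddPoly, show (n + 1) / 2 = (n + 1) / 2 - 1 + 1 by omega, Finset.sum_range_succ,
        Finset.sum_range_succ, hq', map_add, add_mul,
        show 2 * (n / 2) + 1 + 2 * ((n + 1) / 2 - 1) = 2 * n - 1 by omega, add_assoc]
      congr 1
      refine Finset.sum_congr rfl fun i hi => ?_
      rw [Finset.mem_range] at hi
      rw [hq i (by omega)]
    have h3 : (if Odd n then q₁ 0 * q 0 else 0) = if Odd n then q 0 ^ 2 else 0 := by
      split_ifs with ho
      · obtain ⟨k, rfl⟩ := ho
        rw [hq 0 (by omega), pow_two]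
      · rfl
    rw [h3] at h1
    obtain ⟨r, hr⟩ := h1
    obtain ⟨r', hr'⟩ : X ^ (2 * n) ∣ evenPoly n q₁ * X ^ (2 * n - 1) := by
      have := mul_dvd_mul (X_pow_dvd_evenPoly n q₁) (dvd_refl (X ^ (2 * n - 1) : ℂ[X]))
      rw [← pow_add] at this
      exact (pow_dvd_pow _ (by omega)).trans this
    refine ⟨-(C B * r) - C (B ^ 2 * g) * r', ?_⟩
    rw [mul_sub, mul_neg, mul_left_comm, ← hr, mul_left_comm, ← hr', mul_add, mul_add,
      mul_comm (evenPoly n q₁) X, X_mul_evenPoly, h2]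
    simp only [C_mul, C_sub]
    ring
  · rw [hR', hz', map_sub, LinearMap.sub_apply, map_smul, LinearMap.smul_apply, hdpow _ (by omega),
      smul_zero, sub_zero, htop, h.bracket_right]

theorem of_paramRel {g₁ : ℂ} {q₁ : ℕ → ℂ} (h : L.IsPresentedBy n g q y y') (hn : 2 ≤ n)
    (hr : ParamRel n g₁ q₁ g q) : ∃ z z', L.IsPresentedBy n g₁ q₁ z z' := by
  obtain ⟨A, D, B, hA, hD, hg, hq, hq'⟩ := hr
  -- `ParamRel` expresses the given last coefficient through the wanted one, so the shear is undone
  -- before scaling.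
  have h1 := h.shear hn (-B) (q₁ := fun i => if i + 1 < (n + 1) / 2 then q i else
    q ((n + 1) / 2 - 1) + -B * (g - if Odd n then q 0 ^ 2 else 0))
    (fun i hi => if_pos hi) (if_neg (by omega))
  refine ⟨_, _, h1.scale hA hD hg fun i hi => ?_⟩
  by_cases h2 : i + 1 < (n + 1) / 2
  · rw [if_pos h2, hq i h2]
  · rw [if_neg h2, show i = (n + 1) / 2 - 1 by omega,
      show 2 * (n / 2) + 1 + 2 * ((n + 1) / 2 - 1) = 2 * n - 1 by omega]
    linear_combination hq'

/-- Any second pair of generators is z = F(R_y²) y + B y', z' = E(R_y²) y + D y'. Only A = F(0), B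
and D act from the right; the higher part of F enters as a factor that is a unit modulo X^(2n) and
cancels on comparing [z,z'], and [z',z] = 0 forces E into the top even degree. -/
theorem paramRel {g₁ : ℂ} {q₁ : ℕ → ℂ} {z z' : V} (h : L.IsPresentedBy n g q y y') (hn : 2 ≤ n)
    (h₁ : L.IsPresentedBy n g₁ q₁ z z') : ParamRel n g₁ q₁ g q := by
  obtain ⟨F, B, hz⟩ := h.mem_odd_iff.1 h₁.mem
  obtain ⟨E, D, hz'⟩ := h.mem_odd_iff.1 h₁.mem'
  have hc0 : ∀ f : ℂ[X], (expand ℂ 2 f).coeff 1 = 0 := fun f => by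
    rw [coeff_expand two_pos, if_neg (by omega)]
  have hcomp : ∀ f : ℂ[X], (expand ℂ 2 f).comp (-X) = expand ℂ 2 f := fun f => by
    rw [expand_eq_comp_X_pow, comp_assoc, X_pow_comp, neg_sq]
  set Fe := expand ℂ 2 F with hFe
  set Ee := expand ℂ 2 E with hEe
  set A := Fe.coeff 0 with hA
  set P := oddPoly n q with hP
  set ev := cyclicMap (L.rightMul y) y with hev
  have hR : ∀ u, L.rightMul z u = A • L.bracket u y + B • L.bracket u y' := by
    intro u
    rw [rightMul_apply, hz, h.bracket_eq, hc0]
    simp [hA]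
  have hsq : ∀ u, L.rightMul z (L.rightMul z u) = A ^ 2 • L.rightMul y (L.rightMul y u) := by
    intro u
    simp only [hR, rightMul_apply, map_add, map_smul, LinearMap.add_apply, LinearMap.smul_apply,
      h.anticomm, h.bracket_bracket_right hn]
    module
  have hRe : ∀ (G : ℂ[X]) (c : ℂ), L.rightMul z (ev (expand ℂ 2 G) + c • y') =
      ev (expand ℂ 2 G * (C A * X + C B * P) + C (B * c * g) * X ^ (2 * n - 1)) := by
    intro G c
    have e : expand ℂ 2 G * (C A * X + C B * P) + C (B * c * g) * X ^ (2 * n - 1) =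
        C A * (X * expand ℂ 2 G) + C B * (expand ℂ 2 G * P) + C (B * c * g) * X ^ (2 * n - 1) := by
      ring
    rw [e, hR, map_add ev, map_add ev, hev, cyclicMap_C_mul, cyclicMap_C_mul, cyclicMap_C_mul,
      cyclicMap_X_pow]
    simp only [map_add, map_smul, LinearMap.add_apply, LinearMap.smul_apply, h.bracket_eq_zero,
      h.bracket_right, h.bracket_cyclicMap, hcomp, cyclicMap_X_mul, rightMul_apply]
    module
  -- R_z² = A² R_y², so A = 0 would shorten the chain of z.
  have hA0 : A ≠ 0 := by
    intro h0
    apply h₁.pow_ne_zero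
    rw [show 2 * n - 1 = 2 * (n - 1) + 1 by omega, pow_succ, Module.End.mul_apply,
      pow_apply_of_sq hsq, h0, zero_pow (by omega), zero_smul]
  have hXP : ∀ (k) (f : ℂ[X]), 2 * n ≤ k + 2 → X ^ k ∣ f → X ^ (2 * n) ∣ f * P := by
    intro k f hk hf
    have := mul_dvd_mul hf (X_pow_dvd_oddPoly n q (k := 2) (by omega))
    rw [← pow_add] at this
    exact (pow_dvd_pow _ hk).trans this
  have hunit : ∀ (k) (f G : ℂ[X]), f.coeff 0 ≠ 0 → X ^ k ∣ f * G → X ^ k ∣ G := fun k f G h0 h1 =>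
    prime_X.pow_dvd_of_dvd_mul_left k (fun h2 => h0 (X_dvd_iff.1 h2)) h1
  have hP0 : (evenPoly n q).coeff 0 = 0 := X_pow_dvd_iff.1 (X_pow_dvd_evenPoly n q) 0 (by omega)
  have hAP : ∀ (k) (G : ℂ[X]), X ^ (k + 1) ∣ G * (C A * X + C B * P) → X ^ k ∣ G := by
    intro k G hG
    rw [hP, ← X_mul_evenPoly, show G * (C A * X + C B * (X * evenPoly n q)) =
      X * ((C A + C B * evenPoly n q) * G) by ring, pow_succ'] at hG
    refine hunit k _ _ ?_ ((mul_dvd_mul_iff_left X_ne_zero).1 hG)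
    rw [coeff_add, coeff_C_mul, hP0, mul_zero, add_zero, coeff_C_zero]
    exact hA0
  have hzz' := h₁.bracket_eq_zero
  rw [← rightMul_apply, hz', hRe, hev, h.cyclicMap_eq_zero_iff] at hzz'
  have hE : X ^ (2 * n - 2) ∣ Ee := by
    refine hAP _ _ ?_
    rw [show 2 * n - 2 + 1 = 2 * n - 1 by omega]
    exact (dvd_add_left ((dvd_refl _).mul_left _)).1
      ((pow_dvd_pow _ (Nat.sub_le _ _)).trans hzz')
  have hR' : ∀ u, L.bracket u z' = D • L.bracket u y' := by
    intro u
    rw [hz', h.bracket_eq, hc0, X_pow_dvd_iff.1 hE 0 (by omega)]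
    simp
  -- With D = 0 the polynomial E is divisible by X^(2n-1), hence, being even, by X^(2n), and z'
  -- would vanish.
  have hD0 : D ≠ 0 := by
    intro h0
    rw [h0, mul_zero, zero_mul, map_zero, zero_mul, add_zero] at hzz'
    apply h₁.ne_zero
    rw [hz', h0, zero_smul, add_zero, hev, h.cyclicMap_eq_zero_iff]
    have h1 : X ^ (2 * n - 1) ∣ Ee :=
      hAP _ _ (by rwa [Nat.sub_add_cancel (by omega)])
    rw [X_pow_dvd_iff] at h1 ⊢
    intro k hk
    by_cases h2 : k < 2 * n - 1
    · exact h1 k h2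
    · rw [hEe, coeff_expand two_pos, if_neg (by omega)]
  obtain ⟨F₁, hF₁⟩ : X ∣ Fe - C A := by
    rw [X_dvd_iff, coeff_sub, coeff_C_zero, sub_self]
  rw [sub_eq_iff_eq_add] at hF₁
  have hFX : X ^ (2 * n) ∣ Fe * X ^ (2 * n - 1) - C A * X ^ (2 * n - 1) := by
    refine ⟨F₁, ?_⟩
    rw [hF₁]
    nth_rw 3 [show 2 * n = 2 * n - 1 + 1 by omega]
    ring
  have hzz : L.rightMul z z = ev (Fe * (C A * X + C B * P) +
      C (B * B * g) * X ^ (2 * n - 1)) := by rw [← hRe F B, ← hFe, ← hz]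
  have hg : D ^ 2 * g = A ^ (2 * n) * g₁ := by
    have e := h₁.bracket_right
    rw [hR', show 2 * n - 1 = 2 * (n - 1) + 1 by omega, pow_succ, Module.End.mul_apply,
      pow_apply_of_sq hsq] at e
    rw [hzz, hev, ← cyclicMap_X_pow_mul, hz', map_add, LinearMap.add_apply, h.bracket_cyclicMap,
      hcomp, h.cyclicMap_eq_zero_iff.2 (hXP _ _ (by omega) hE), zero_add, map_smul,
      LinearMap.smul_apply, h.bracket_right, ← cyclicMap_X_pow, ← cyclicMap_C_mul,
      ← cyclicMap_C_mul, ← cyclicMap_C_mul, ← cyclicMap_C_mul, ← cyclicMap_C_mul, ← sub_eq_zero,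
      ← map_sub, h.cyclicMap_eq_zero_iff] at e
    have h1 := X_pow_dvd_iff.1 e (2 * n - 1) (by omega)
    rw [hP, ← X_mul_evenPoly, show Fe * (C A * X + C B * (X * evenPoly n q)) +
      C (B * B * g) * X ^ (2 * n - 1) = X * (Fe * (C A + C B * evenPoly n q) +
        C (B * B * g) * X ^ (2 * n - 2)) by
          rw [show 2 * n - 1 = 2 * n - 2 + 1 by omega]; ring, ← mul_assoc (X ^ _), ← pow_succ,
      show 2 * (n - 1) + 1 = 2 * n - 1 by omega, coeff_sub, coeff_C_mul, coeff_C_mul,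
      coeff_C_mul_X_pow, if_pos rfl, coeff_C_mul, coeff_C_mul, coeff_X_pow_mul', if_pos le_rfl,
      Nat.sub_self, coeff_add, mul_coeff_zero, coeff_add, coeff_C_mul, hP0, coeff_C_zero,
      coeff_C_mul, coeff_X_pow, if_neg (by omega)] at h1
    rw [show 2 * n = 2 * (n - 1) + 1 + 1 by omega, pow_succ, pow_succ]
    linear_combination h1
  -- The shear relative to the leading coefficient A is B / A; the sign comes from solving for the
  -- old last coefficient.
  refine ⟨A, D, -B / A, hA0, hD0, hg, ?_⟩
  have hmain : X ^ (2 * n) ∣ C D * P - C A * oddPoly n (fun i => A ^ (2 * (n / 2) + 2 * i) * q₁ i) +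
      C (D * B * g / A - B * if Odd n then A ^ (2 * (n / 2)) * q₁ 0 * q 0 else 0) *
        X ^ (2 * n - 1) := by
    have e := h₁.bracket_left
    rw [hR', cyclicMap_oddPoly_of_sq hsq] at e
    rw [hzz, hev, ← cyclicMap_mul, hz, hev, map_add, LinearMap.add_apply, h.bracket_cyclicMap, hcomp,
      map_smul, LinearMap.smul_apply, h.bracket_right, ← cyclicMap_X_pow, smul_smul,
      ← cyclicMap_C_mul, ← map_add, ← cyclicMap_C_mul, ← sub_eq_zero, ← map_sub,
      h.cyclicMap_eq_zero_iff] at e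
    have hK := X_pow_dvd_evenPoly_mul_oddPoly_sub n (fun i => A ^ (2 * (n / 2) + 2 * i) * q₁ i) q
    rw [mul_zero, add_zero] at hK
    rw [← hFe, ← hP] at e
    rw [← hP] at hK
    rw [← X_mul_evenPoly]
    set Q := evenPoly n fun i => A ^ (2 * (n / 2) + 2 * i) * q₁ i
    set K := if Odd n then A ^ (2 * (n / 2)) * q₁ 0 * q 0 else 0
    have hQX : X ^ (2 * n) ∣ Q * X ^ (2 * n - 1) := by
      have := mul_dvd_mul (X_pow_dvd_evenPoly n fun i => A ^ (2 * (n / 2) + 2 * i) * q₁ i)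
        (dvd_refl (X ^ (2 * n - 1) : ℂ[X]))
      rw [← pow_add] at this
      exact (pow_dvd_pow _ (by omega)).trans this
    -- Fe has nonzero constant term A, so it may be cancelled modulo X^(2n). The multiples added
    -- next replace Q P and Fe X^(2n-1) by their top-degree terms.
    refine hunit _ Fe _ hA0 ?_
    have hdiv : C (D * B * g / A) * C A = C D * C B * C g := by
      rw [← C_mul, div_mul_cancel₀ _ hA0, C_mul, C_mul]
    have e' := dvd_add (dvd_add (dvd_add e (hK.mul_left (Fe * C B)))
      (hFX.mul_left (C (D * B * g / A)))) (hQX.mul_left (C (B * B * g)))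
    convert e' using 1
    simp only [C_sub, C_mul]
    linear_combination X ^ (2 * n - 1) * hdiv
  have hcoe : ∀ i < (n + 1) / 2, D * q i - A * (A ^ (2 * (n / 2) + 2 * i) * q₁ i) +
      (if i + 1 < (n + 1) / 2 then 0 else
        D * B * g / A - B * if Odd n then A ^ (2 * (n / 2)) * q₁ 0 * q 0 else 0) = 0 := by
    intro i hi
    have := X_pow_dvd_iff.1 hmain (2 * (n / 2) + 1 + 2 * i) (by omega)
    have hodd : Odd (2 * (n / 2) + 1 + 2 * i) := ⟨n / 2 + i, by ring⟩
    rw [coeff_add, coeff_sub, coeff_C_mul, coeff_C_mul, hP, coeff_oddPoly _ _ (by omega),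
      coeff_oddPoly _ _ (by omega), if_pos ⟨hodd, by omega⟩, if_pos ⟨hodd, by omega⟩,
      coeff_C_mul_X_pow, Nat.add_sub_cancel_left, Nat.mul_div_cancel_left _ two_pos] at this
    refine Eq.trans ?_ this
    congr 1
    by_cases hi' : i + 1 < (n + 1) / 2
    · rw [if_pos hi', if_neg (by omega)]
    · rw [if_neg hi', if_pos (show 2 * (n / 2) + 1 + 2 * i = 2 * n - 1 by omega)]
  have hlow : ∀ i, i + 1 < (n + 1) / 2 → D * q i = A ^ (2 * (n / 2) + 1 + 2 * i) * q₁ i := by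
    intro i hi
    have := hcoe i (by omega)
    rw [if_pos hi] at this
    rw [show 2 * (n / 2) + 1 + 2 * i = 2 * (n / 2) + 2 * i + 1 by ring, pow_succ]
    linear_combination this
  refine ⟨hlow, ?_⟩
  have h1 := hcoe ((n + 1) / 2 - 1) (by omega)
  rw [if_neg (by omega)] at h1
  rw [show 2 * n - 1 = 2 * (n / 2) + 2 * ((n + 1) / 2 - 1) + 1 by omega, pow_succ]
  by_cases ho : Odd n
  · rw [if_pos ho] at h1 ⊢
    obtain ⟨k, hk⟩ := ho
    have h2 := hlow 0 (by omega)
    rw [mul_zero, add_zero, pow_succ] at h2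
    field_simp at h1 ⊢
    linear_combination h1 - B * q 0 * h2
  · rw [if_neg ho] at h1 ⊢
    field_simp at h1 ⊢
    linear_combination h1

end IsPresentedBy

end Change

end SuperProduct

/-! ### Isomorphism as equivalence of parameter vectors -/

namespace SuperProduct

open Polynomial

section Map

variable {V : Type*} [AddCommGroup V] [Module ℂ V] {L : SuperProduct V} {n : ℕ} {g : ℂ}
  {q : ℕ → ℂ} {y y' : V}

theorem map_cyclicMap {V' : Type*} [AddCommGroup V'] [Module ℂ V'] {b : V →ₗ[ℂ] V}
    {b' : V' →ₗ[ℂ] V'} {f : V →ₗ[ℂ] V'} (hf : ∀ u, f (b u) = b' (f u)) (z : V) (p : ℂ[X]) :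
    f (cyclicMap b z p) = cyclicMap b' (f z) p := by
  induction p using Polynomial.induction_on' with
  | add p r hp hr => rw [map_add, map_add, map_add, hp, hr]
  | monomial k a =>
    rw [← C_mul_X_pow_eq_monomial, cyclicMap_C_mul, cyclicMap_C_mul, map_smul, cyclicMap_X_pow,
      cyclicMap_X_pow]
    congr 1
    induction k with
    | zero => rfl
    | succ k ih => rw [pow_succ', pow_succ', Module.End.mul_apply, Module.End.mul_apply, hf, ih]

theorem IsPresentedBy.exists_of_isomorphic (h : L.IsPresentedBy n g q y y') {V' : Type*}
    [AddCommGroup V'] [Module ℂ V'] {L' : SuperProduct V'} (hL' : L'.IsLeibnizSuperalgebra)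
    (e : L.Isomorphic L') : ∃ z z', L'.IsPresentedBy n g q z z' := by
  obtain ⟨f, hf, hb⟩ := e
  have hc : ∀ p, f (cyclicMap (L.rightMul y) y p) = cyclicMap (L'.rightMul (f y)) (f y) p :=
    map_cyclicMap (f := f.toLinearMap) (fun u => hb u y) y
  have hpow : ∀ k, (L'.rightMul (f y) ^ k) (f y) = f ((L.rightMul y ^ k) y) := fun k => by
    rw [← cyclicMap_X_pow, ← hc, cyclicMap_X_pow]
  refine ⟨f y, f y', hL', ?_, hf _ _ h.mem, hf _ _ h.mem', ?_, ?_, ?_, ?_, ?_, ?_⟩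
  · rw [← f.finrank_eq, h.finrank_eq]
  · exact fun h0 => h.ne_zero (f.map_eq_zero_iff.1 h0)
  · rw [← hb, h.bracket_eq_zero, map_zero]
  · rw [hpow, h.pow_eq_zero, map_zero]
  · rw [hpow]
    exact fun h0 => h.pow_ne_zero (f.map_eq_zero_iff.1 h0)
  · rw [← hb, h.bracket_left, hc]
  · rw [← hb, h.bracket_right, map_smul, hpow]

end Map

end SuperProduct

namespace LeibFamily

open SuperProduct

/-- The equivalence of parameter vectors `p`, `p'` that describes isomorphism. -/
def Rel (n : ℕ) (p p' : ℕ → ℂ) : Prop :=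
  ParamRel n (p 0) (presCoeff n p) (p' 0) (presCoeff n p')

variable {n : ℕ}

/-- An isomorphism carries the presentation of one superalgebra to a second presentation of the
other, and two presentations of the same superalgebra are compared by `paramRel`. Conversely
`of_paramRel` produces equal presentations. -/
theorem isomorphic_iff_rel (hn : 2 ≤ n) {p p' : ℕ → ℂ} :
    (L n p).Isomorphic (L n p') ↔ Rel n p p' := by
  obtain ⟨y, y', h⟩ := exists_isPresentedBy_L hn p
  obtain ⟨z, z', h'⟩ := exists_isPresentedBy_L hn p'
  constructor
  · intro e
    obtain ⟨w, w', h₁⟩ := h.exists_of_isomorphic h'.isLeibniz e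
    exact h'.paramRel hn h₁
  · intro r
    obtain ⟨w, w', h₁⟩ := h'.of_paramRel hn r
    exact h.isomorphic h₁

theorem isomorphic_trans {V V' V'' : Type*} [AddCommGroup V] [Module ℂ V] [AddCommGroup V']
    [Module ℂ V'] [AddCommGroup V''] [Module ℂ V''] {L : SuperProduct V} {L' : SuperProduct V'}
    {L'' : SuperProduct V''} : L.Isomorphic L' → L'.Isomorphic L'' → L.Isomorphic L'' := by
  rintro ⟨f, hf, hf'⟩ ⟨g, hg, hg'⟩
  exact ⟨f.trans g, fun a x hx => hg a _ (hf a x hx), fun x y => by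
    simp only [LinearEquiv.trans_apply, hf', hg']⟩

theorem Rel.trans (hn : 2 ≤ n) {p p' p'' : ℕ → ℂ} (h : Rel n p p') (h' : Rel n p' p'') :
    Rel n p p'' := by
  rw [← isomorphic_iff_rel hn] at *
  exact isomorphic_trans h h'

theorem Rel.symm (hn : 2 ≤ n) {p p' : ℕ → ℂ} (h : Rel n p p') : Rel n p' p := by
  obtain ⟨y, y', h₀⟩ := exists_isPresentedBy_L hn p
  obtain ⟨z, z', h₁⟩ := exists_isPresentedBy_L hn p'
  obtain ⟨w, w', h₂⟩ := h₁.of_paramRel hn h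
  exact h₂.paramRel hn h₁

/-- For odd n all exponents of A differ from n by even numbers, so A enters only through t = A² and
ε = A^n / D. The factor -2 in `presCoeff` turns the square of the first coefficient into 4 p₁²; q ≥
2 ensures that p₁ is not the last parameter. -/
theorem rel_two_mul_sub_one_iff {q : ℕ} (hq : 2 ≤ q) {p p' : ℕ → ℂ} : Rel (2 * q - 1) p p' ↔
    ∃ t ε B : ℂ, t ≠ 0 ∧ ε ≠ 0 ∧ p' 0 = ε ^ 2 * p 0 ∧
      (∀ i, i + 1 < q → p' (i + 1) = ε * t ^ i * p (i + 1)) ∧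
      p' q = ε * t ^ (q - 1) * p q + B * (p' 0 - 4 * p' 1 ^ 2) := by
  have hl : (2 * q - 1 + 1) / 2 = q := by omega
  have hh : (2 * q - 1) / 2 = q - 1 := by omega
  have hodd : Odd (2 * q - 1) := ⟨q - 1, by omega⟩
  rw [Rel, ParamRel]
  simp only [hl, hh, if_pos hodd, presCoeff, Nat.sub_add_cancel (show 1 ≤ q by omega), if_true,
    zero_add, if_neg (show ¬ 1 = q by omega)]
  constructor
  · rintro ⟨A, D, B, hA, hD, h0, h1, h2⟩
    refine ⟨A ^ 2, A ^ (2 * q - 1) / D, B, pow_ne_zero _ hA, div_ne_zero (pow_ne_zero _ hA) hD, ?_,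
      fun i hi => ?_, ?_⟩
    · rw [mul_comm 2 (2 * q - 1), pow_mul] at h0
      field_simp
      linear_combination h0
    · have := h1 i hi
      rw [if_neg (by omega), if_neg (by omega),
        show 2 * (q - 1) + 1 + 2 * i = (2 * q - 1) + 2 * i by omega, pow_add, pow_mul] at this
      field_simp
      linear_combination (-1 / 2 : ℂ) * this
    · rw [show 2 * (2 * q - 1) - 1 = (2 * q - 1) + 2 * (q - 1) by omega, pow_add, pow_mul] at h2
      field_simp
      linear_combination h2
  · rintro ⟨t, ε, B, ht, hε, h0, h1, h2⟩
    obtain ⟨A, rfl⟩ := IsAlgClosed.exists_pow_nat_eq t two_pos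
    have hA : A ≠ 0 := fun h => ht (by rw [h, zero_pow two_ne_zero])
    refine ⟨A, A ^ (2 * q - 1) / ε, B, hA, div_ne_zero (pow_ne_zero _ hA) hε, ?_,
      fun i hi => ?_, ?_⟩
    · rw [mul_comm 2 (2 * q - 1), pow_mul, h0]
      field_simp
    · rw [if_neg (by omega), if_neg (by omega), h1 i hi,
        show 2 * (q - 1) + 1 + 2 * i = (2 * q - 1) + 2 * i by omega, pow_add, pow_mul]
      field_simp
    · rw [show 2 * (2 * q - 1) - 1 = (2 * q - 1) + 2 * (q - 1) by omega, pow_add, pow_mul, h2]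
      field_simp
      ring

/-- Here ε = A^n / D, and odd powers of A remain, so that A cannot be replaced by its square in
general. -/
theorem rel_two_mul_iff {q : ℕ} (hq : 1 ≤ q) {p p' : ℕ → ℂ} : Rel (2 * q) p p' ↔
    ∃ A ε B : ℂ, A ≠ 0 ∧ ε ≠ 0 ∧ p' 0 = ε ^ 2 * p 0 ∧
      (∀ i, i + 1 < q → p' (i + 1) = ε * A ^ (2 * i + 1) * p (i + 1)) ∧
      p' q = ε * A ^ (2 * q - 1) * p q + B * p' 0 := by
  have hl : (2 * q + 1) / 2 = q := by omega
  have hh : (2 * q) / 2 = q := by omega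
  have hodd : ¬ Odd (2 * q) := by simp
  rw [Rel, ParamRel]
  simp only [hl, hh, if_neg hodd, presCoeff, Nat.sub_add_cancel hq, if_true, sub_zero]
  constructor
  · rintro ⟨A, D, B, hA, hD, h0, h1, h2⟩
    refine ⟨A, A ^ (2 * q) / D, B, hA, div_ne_zero (pow_ne_zero _ hA) hD, ?_,
      fun i hi => ?_, ?_⟩
    · rw [mul_comm 2 (2 * q), pow_mul] at h0
      field_simp
      linear_combination h0
    · have := h1 i hi
      rw [if_neg (by omega), if_neg (by omega),
        show 2 * q + 1 + 2 * i = 2 * q + (2 * i + 1) by omega, pow_add] at this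
      field_simp
      linear_combination (-1 / 2 : ℂ) * this
    · rw [show 2 * (2 * q) - 1 = 2 * q + (2 * q - 1) by omega, pow_add] at h2
      field_simp
      linear_combination h2
  · rintro ⟨A, ε, B, hA, hε, h0, h1, h2⟩
    refine ⟨A, A ^ (2 * q) / ε, B, hA, div_ne_zero (pow_ne_zero _ hA) hε, ?_,
      fun i hi => ?_, ?_⟩
    · rw [mul_comm 2 (2 * q), pow_mul A (2 * q) 2, h0]
      field_simp
    · rw [if_neg (by omega), if_neg (by omega), h1 i hi,
        show 2 * q + 1 + 2 * i = 2 * q + (2 * i + 1) by omega, pow_add _ (2 * q)]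
      field_simp
    · rw [show 2 * (2 * q) - 1 = 2 * q + (2 * q - 1) by omega, pow_add, h2]
      field_simp

end LeibFamily

/-! ### Roots of unity and normalised vectors -/

namespace LeibFamily

section Roots

theorem S_pow_self (m : ℕ) {t : ℕ} (ht : 0 < t) : S m t ^ t = 1 := by
  have ht' : (t : ℂ) ≠ 0 := Nat.cast_ne_zero.2 ht.ne'
  rw [S, ← Complex.exp_nat_mul, Complex.exp_eq_one_iff]
  exact ⟨m, by field_simp; push_cast; ring⟩

theorem exists_eq_S {t : ℕ} (ht : 0 < t) {z : ℂ} (hz : z ^ t = 1) : ∃ m < t, z = S m t := by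
  have : NeZero t := ⟨ht.ne'⟩
  obtain ⟨m, hm, rfl⟩ := (Complex.isPrimitiveRoot_exp t ht.ne').eq_pow_of_pow_eq_one hz
  refine ⟨m, hm, ?_⟩
  rw [S, ← Complex.exp_nat_mul]
  congr 1; ring

theorem cpow_mul_S_pow (δ : ℂ) (m : ℕ) {j : ℕ} (hj : 0 < j) :
    (δ ^ (1 / (j : ℂ)) * S m j) ^ j = δ := by
  rw [mul_pow, S_pow_self m hj, mul_one, one_div, Complex.cpow_nat_inv_pow _ hj.ne']

theorem exists_eq_cpow_mul_S {δ t : ℂ} (hδ : δ ≠ 0) {j : ℕ} (hj : 0 < j) (ht : t ^ j = δ) :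
    ∃ m < j, t = δ ^ (1 / (j : ℂ)) * S m j := by
  have h0 : (δ ^ (1 / (j : ℂ))) ^ j = δ := by
    rw [one_div, Complex.cpow_nat_inv_pow _ hj.ne']
  have h1 : δ ^ (1 / (j : ℂ)) ≠ 0 := fun h => hδ (by rw [← h0, h, zero_pow hj.ne'])
  obtain ⟨m, hm, e⟩ := exists_eq_S hj (z := t / δ ^ (1 / (j : ℂ))) (by
    rw [div_pow, h0, ht, div_self hδ])
  exact ⟨m, hm, by rw [← e, mul_div_cancel₀ _ h1]⟩

end Roots

section Normal

/-- The vector of length `k` with leading coordinate one at `j` and the later ones from `α`. -/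
def normVec (j k : ℕ) (α : ℕ → ℂ) (i : ℕ) : ℂ :=
  if k < i ∨ i < j then 0 else if i = j then 1 else α i

/-- The vector of length `k` whose first two nonzero coordinates, both one, are at `j` and at
`j + s`, and whose later ones are those of `α`. -/
def normVecTwo (s j k : ℕ) (α : ℕ → ℂ) (i : ℕ) : ℂ :=
  if k < i ∨ i < j then 0 else if i = j then 1 else if i < j + s then 0
  else if i = j + s then 1 else α i

variable {j k s : ℕ} {α : ℕ → ℂ}

/-- The j-th coordinate fits the general pattern since δ · δ = 1. Thus V⁰ runs through rescalings of
a single vector by ε = δ and the j-th roots t of δ. -/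
theorem V0_eq {δ : ℂ} (hδ : δ = 1 ∨ δ = -1) (m : ℕ) (hj : 1 ≤ j) (i : ℕ) :
    V0 δ m j k α i = δ * (δ ^ (1 / (j : ℂ)) * S m j) ^ i * normVec j k α i := by
  rw [V0, normVec]
  split_ifs with h1 h2
  · rw [mul_zero]
  · rw [h2, cpow_mul_S_pow δ m hj]
    rcases hδ with rfl | rfl <;> norm_num
  · rfl

theorem V1_eq (m : ℕ) (hj : 1 ≤ j) (i : ℕ) :
    V1 m j k α i = S m j ^ i * normVec j k α i := by
  rw [V1, normVec]
  split_ifs with h1 h2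
  · rw [mul_zero]
  · rw [h2, S_pow_self m hj, one_mul]
  · rfl

theorem V2_eq (m : ℕ) (hj : 1 ≤ j) (i : ℕ) :
    V2 m j k α i = S m (2 * j - 1) ^ (2 * i - 1) * normVec j k α i := by
  rw [V2, normVec]
  split_ifs with h1 h2
  · rw [mul_zero]
  · rw [h2, S_pow_self m (by omega), one_mul]
  · rfl

theorem W_eq (m : ℕ) (hs : 1 ≤ s) (i : ℕ) :
    W m s j k α i = S m s ^ (i - j) * normVecTwo s j k α i := by
  rw [W, normVecTwo]
  split_ifs with h1 h2 h3 h4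
  · rw [mul_zero]
  · rw [h2, Nat.sub_self, pow_zero, one_mul]
  · rw [mul_zero]
  · rw [h4, Nat.add_sub_cancel_left, S_pow_self m hs, one_mul]
  · rw [show i - j = s + (i - (j + s)) by omega, pow_add, S_pow_self m hs, one_mul]

/-- `v` is a vector of length `k` with leading coordinate one, or zero. -/
def IsNorm (k : ℕ) (v : ℕ → ℂ) : Prop :=
  ∃ j, 1 ≤ j ∧ j ≤ k + 1 ∧ (∀ i, 1 ≤ i → i < j ∨ k < i → v i = 0) ∧ (j ≤ k → v j = 1)

/-- `v` is a vector of length `k` whose first two nonzero coordinates are equal to one. -/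
def IsNormTwo (k : ℕ) (v : ℕ → ℂ) : Prop :=
  (∀ i, 1 ≤ i → v i = 0) ∨ ∃ j s, 1 ≤ j ∧ j ≤ k ∧ 1 ≤ s ∧ s ≤ k + 1 - j ∧
    (∀ i, 1 ≤ i → i < j ∨ k < i ∨ (j < i ∧ i < j + s) → v i = 0) ∧ v j = 1 ∧
      (j + s ≤ k → v (j + s) = 1)

theorem isNorm_of_eq_mul_normVec (hj : 1 ≤ j) (hjk : j ≤ k + 1) {c v : ℕ → ℂ}
    (hc : j ≤ k → c j = 1) (hv : ∀ i, 1 ≤ i → v i = c i * normVec j k α i) : IsNorm k v := by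
  refine ⟨j, hj, hjk, fun i hi h => ?_, fun h => ?_⟩
  · rw [hv i hi, normVec, if_pos (by omega), mul_zero]
  · rw [hv j hj, hc h, normVec, if_neg (by omega), if_pos rfl, one_mul]

theorem isNormTwo_of_eq_mul_normVecTwo (hj : 1 ≤ j) (hjk : j ≤ k) (hs : 1 ≤ s)
    (hsk : s ≤ k + 1 - j) {c v : ℕ → ℂ} (hc : c j = 1) (hc' : j + s ≤ k → c (j + s) = 1)
    (hv : ∀ i, 1 ≤ i → v i = c i * normVecTwo s j k α i) : IsNormTwo k v := by
  refine Or.inr ⟨j, s, hj, hjk, hs, hsk, fun i hi h => ?_, ?_, fun h => ?_⟩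
  · rw [hv i hi, normVecTwo]
    by_cases h1 : k < i ∨ i < j
    · rw [if_pos h1, mul_zero]
    · rw [if_neg h1, if_neg (by omega), if_pos (by omega), mul_zero]
  · rw [hv j hj, hc, normVecTwo, if_neg (by omega), if_pos rfl, one_mul]
  · rw [hv _ (by omega), hc' h, normVecTwo, if_neg (by omega), if_neg (by omega), if_neg (by omega),
      if_pos rfl, one_mul]

theorem IsNorm.apply_eq_zero {v : ℕ → ℂ} (h : IsNorm k v) {i : ℕ} (hi : k < i) : v i = 0 := by
  obtain ⟨j, -, -, h, -⟩ := h
  exact h i (by omega) (Or.inr hi)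

theorem IsNormTwo.apply_eq_zero {v : ℕ → ℂ} (h : IsNormTwo k v) {i : ℕ} (hi : k < i) :
    v i = 0 := by
  obtain h | ⟨j, s, -, -, -, -, h, -⟩ := h
  · exact h i (by omega)
  · exact h i (by omega) (Or.inr (Or.inl hi))

theorem IsNorm.eq_mul_normVec {c v : ℕ → ℂ} (h : IsNorm k v)
    (hv : ∀ i, 1 ≤ i → i ≤ k → v i = c i * normVec j k α i) (i : ℕ) (hi : 1 ≤ i) :
    v i = c i * normVec j k α i := by
  rcases le_or_gt i k with h1 | h1
  · exact hv i hi h1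
  · rw [h.apply_eq_zero h1, normVec, if_pos (Or.inl h1), mul_zero]

theorem IsNormTwo.eq_mul_normVecTwo {c v : ℕ → ℂ} (h : IsNormTwo k v)
    (hv : ∀ i, 1 ≤ i → i ≤ k → v i = c i * normVecTwo s j k α i) (i : ℕ) (hi : 1 ≤ i) :
    v i = c i * normVecTwo s j k α i := by
  rcases le_or_gt i k with h1 | h1
  · exact hv i hi h1
  · rw [h.apply_eq_zero h1, normVecTwo, if_pos (Or.inl h1), mul_zero]

/-- Nonzero factors do not move the leading position, and both leading coordinates are one. -/
theorem IsNorm.coeff_eq_one {c v : ℕ → ℂ} (h : IsNorm k v) (hc : ∀ i, c i ≠ 0)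
    (hv : ∀ i, 1 ≤ i → i ≤ k → v i = c i * normVec j k α i) (hj : 1 ≤ j) (hjk : j ≤ k) :
    c j = 1 := by
  obtain ⟨j', hj', -, h0, h1⟩ := h
  have hvj : v j = c j := by
    rw [hv j hj hjk, normVec, if_neg (by omega), if_pos rfl, mul_one]
  rcases lt_trichotomy j' j with h2 | rfl | h2
  · have := hv j' hj' (by omega)
    rw [h1 (by omega), normVec, if_pos (Or.inr h2), mul_zero] at this
    exact absurd this one_ne_zero
  · rw [← hvj, h1 hjk]
  · exact absurd (hvj.symm.trans (h0 j hj (Or.inl h2))) (hc j)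

theorem IsNormTwo.coeff_eq_one {c v : ℕ → ℂ} (h : IsNormTwo k v) (hc : ∀ i, c i ≠ 0)
    (hv : ∀ i, 1 ≤ i → i ≤ k → v i = c i * normVecTwo s j k α i) (hj : 1 ≤ j) (hjk : j ≤ k)
    (hs : 1 ≤ s) : c j = 1 ∧ (j + s ≤ k → c (j + s) = 1) := by
  have hvj : v j = c j := by
    rw [hv j hj hjk, normVecTwo, if_neg (by omega), if_pos rfl, mul_one]
  have hvs : j + s ≤ k → v (j + s) = c (j + s) := fun h => by
    rw [hv _ (by omega) h, normVecTwo, if_neg (by omega), if_neg (by omega), if_neg (by omega),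
      if_pos rfl, mul_one]
  obtain h | ⟨j', s', hj', hjk', hs', -, h0, h1, h2⟩ := h
  · exact absurd (hvj.symm.trans (h j hj)) (hc j)
  obtain rfl : j' = j := by
    rcases lt_trichotomy j' j with h3 | h3 | h3
    · have := hv j' hj' (by omega)
      rw [h1, normVecTwo, if_pos (Or.inr h3), mul_zero] at this
      exact absurd this one_ne_zero
    · exact h3
    · exact absurd (hvj.symm.trans (h0 j hj (Or.inl h3))) (hc j)
  refine ⟨hvj.symm.trans h1, fun hjs => ?_⟩
  rcases lt_trichotomy s' s with h3 | rfl | h3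
  · have := hv (j' + s') (by omega) (by omega)
    rw [h2 (by omega), normVecTwo, if_neg (by omega), if_neg (by omega), if_pos (by omega),
      mul_zero] at this
    exact absurd this one_ne_zero
  · rw [← hvs hjs, h2 hjs]
  · exact absurd ((hvs hjs).symm.trans
      (h0 (j' + s) (by omega) (Or.inr (Or.inr (by omega))))) (hc _)

/-- The two normalised coordinates give c t^j = 1 and c t^(j+s) = 1, hence t^s = 1. If j + s exceeds
k there is only the unit vector, and any m will do. -/
theorem IsNormTwo.exists_eq_W {v : ℕ → ℂ} {c t : ℂ} (h : IsNormTwo k v) (ht : t ≠ 0) (hc : c ≠ 0)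
    (hv : ∀ i, 1 ≤ i → i ≤ k → v i = c * t ^ i * normVecTwo s j k α i) (hj : 1 ≤ j)
    (hjk : j ≤ k) (hs : 1 ≤ s) : ∃ m < s, ∀ i, 1 ≤ i → v i = W m s j k α i := by
  have hv' := h.eq_mul_normVecTwo (c := fun i => c * t ^ i) hv
  obtain ⟨h1, h2⟩ := h.coeff_eq_one (c := fun i => c * t ^ i)
    (fun i => mul_ne_zero hc (pow_ne_zero _ ht)) hv hj hjk hs
  by_cases hjs : j + s ≤ k
  · have h3 := h2 hjs
    rw [pow_add, ← mul_assoc, h1, one_mul] at h3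
    obtain ⟨m, hm, rfl⟩ := exists_eq_S hs h3
    refine ⟨m, hm, fun i hi => ?_⟩
    rw [W_eq m hs, hv' i hi]
    by_cases hij : i < j
    · rw [normVecTwo, if_pos (Or.inr hij), mul_zero, mul_zero]
    · obtain ⟨r, rfl⟩ := Nat.exists_eq_add_of_le (not_lt.1 hij)
      rw [Nat.add_sub_cancel_left, pow_add, ← mul_assoc, h1, one_mul]
  · refine ⟨0, hs, fun i hi => ?_⟩
    rw [W_eq 0 hs, hv' i hi]
    rcases eq_or_ne i j with rfl | hij
    · rw [h1, Nat.sub_self, pow_zero]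
    · have : normVecTwo s j k α i = 0 := by
        rw [normVecTwo]
        split_ifs <;> first | rfl | omega
      rw [this, mul_zero, mul_zero]

/-- Choose t with t^(e j) = 1 / (ε v_j) at the first nonzero coordinate j, or j = k + 1 for the zero
vector. The exponents e are i for odd n and 2i - 1 for even n. -/
theorem exists_smul_eq_normVec (v : ℕ → ℂ) (k : ℕ) {ε : ℂ} (hε : ε ≠ 0) {e : ℕ → ℕ}
    (he : ∀ i, 1 ≤ i → 0 < e i) : ∃ (j : ℕ) (t : ℂ) (α : ℕ → ℂ), 1 ≤ j ∧ j ≤ k + 1 ∧ t ≠ 0 ∧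
      ∀ i, 1 ≤ i → i ≤ k → normVec j k α i = ε * t ^ e i * v i := by
  classical
  by_cases h : ∃ i, 1 ≤ i ∧ i ≤ k ∧ v i ≠ 0
  · obtain ⟨h1, h2, h3⟩ := Nat.find_spec h
    have hmin : ∀ i, 1 ≤ i → i ≤ k → i < Nat.find h → v i = 0 := fun i hi hik hlt => by
      by_contra h0
      exact Nat.find_min h hlt ⟨hi, hik, h0⟩
    generalize Nat.find h = j at *
    obtain ⟨t, ht⟩ := IsAlgClosed.exists_pow_nat_eq (1 / (ε * v j)) (he j h1)
    have hne : ε * v j ≠ 0 := mul_ne_zero hε h3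
    refine ⟨j, t, fun i => ε * t ^ e i * v i, h1, by omega, fun h0 => ?_, fun i hi hik => ?_⟩
    · rw [h0, zero_pow (he j h1).ne'] at ht
      exact one_div_ne_zero hne ht.symm
    · rw [normVec]
      split_ifs with h4 h5
      · rw [hmin i hi hik (by omega), mul_zero]
      · rw [h5, ht]
        field_simp
      · rfl
  · refine ⟨k + 1, 1, 0, by omega, le_rfl, one_ne_zero, fun i hi hik => ?_⟩
    rw [normVec, if_pos (by omega)]
    by_contra h0
    exact h ⟨i, hi, hik, fun h1 => h0 (by rw [h1, mul_zero])⟩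

/-- Two free scalings normalise two coordinates: t^s = v_j / v_(j+s), then c = 1 / (t^j v_j). -/
theorem exists_smul_eq_normVecTwo (v : ℕ → ℂ) (k : ℕ) : (∀ i, 1 ≤ i → i ≤ k → v i = 0) ∨
    ∃ (j s : ℕ) (c t : ℂ) (α : ℕ → ℂ), 1 ≤ j ∧ j ≤ k ∧ 1 ≤ s ∧ s ≤ k + 1 - j ∧ c ≠ 0 ∧ t ≠ 0 ∧
      ∀ i, 1 ≤ i → i ≤ k → normVecTwo s j k α i = c * t ^ i * v i := by
  classical
  by_cases h : ∃ i, 1 ≤ i ∧ i ≤ k ∧ v i ≠ 0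
  swap
  · left
    intro i hi hik
    by_contra h0
    exact h ⟨i, hi, hik, h0⟩
  right
  obtain ⟨h1, h2, h3⟩ := Nat.find_spec h
  have hmin : ∀ i, 1 ≤ i → i ≤ k → i < Nat.find h → v i = 0 := fun i hi hik hlt => by
    by_contra h0
    exact Nat.find_min h hlt ⟨hi, hik, h0⟩
  generalize Nat.find h = j at *
  by_cases h' : ∃ s, 1 ≤ s ∧ j + s ≤ k ∧ v (j + s) ≠ 0
  · obtain ⟨h4, h5, h6⟩ := Nat.find_spec h'
    have hmin' : ∀ s, 1 ≤ s → j + s ≤ k → s < Nat.find h' → v (j + s) = 0 :=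
      fun i hi hik hlt => by
        by_contra h0
        exact Nat.find_min h' hlt ⟨hi, hik, h0⟩
    generalize Nat.find h' = s at *
    obtain ⟨t, ht⟩ := IsAlgClosed.exists_pow_nat_eq (v j / v (j + s)) (n := s) (by omega)
    have ht0 : t ≠ 0 := by
      rintro rfl
      rw [zero_pow (by omega)] at ht
      exact div_ne_zero h3 h6 ht.symm
    refine ⟨j, s, 1 / (t ^ j * v j), t, fun i => 1 / (t ^ j * v j) * t ^ i * v i, h1, h2, h4,
      by omega, one_div_ne_zero (mul_ne_zero (pow_ne_zero _ ht0) h3), ht0, fun i hi hik => ?_⟩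
    rw [normVecTwo]
    split_ifs with h7 h8 h9 h10
    · rw [hmin i hi hik (by omega), mul_zero]
    · rw [h8]
      field_simp
    · obtain ⟨r, rfl⟩ := Nat.exists_eq_add_of_lt (show j < i by omega)
      rw [add_assoc, hmin' (r + 1) (by omega) (by omega) (by omega), mul_zero]
    · rw [h10, pow_add, ht]
      field_simp
    · rfl
  · refine ⟨j, k + 1 - j, 1 / v j, 1, 0, h1, h2, by omega, le_rfl, one_div_ne_zero h3,
      one_ne_zero, fun i hi hik => ?_⟩
    rw [normVecTwo]
    split_ifs with h7 h8 h9 h10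
    · rw [hmin i hi hik (by omega), mul_zero]
    · rw [h8]
      field_simp
      simp
    · obtain ⟨r, rfl⟩ := Nat.exists_eq_add_of_lt (show j < i by omega)
      by_contra h0
      exact h' ⟨r + 1, by omega, by omega, fun h1 => h0 (by rw [add_assoc, h1, mul_zero])⟩
    · omega
    · omega

end Normal

end LeibFamily

/-! ### The list for odd n -/

namespace LeibFamily

theorem pvec2_add_one (g c : ℂ) (v : ℕ → ℂ) {i : ℕ} (hi : 1 ≤ i) :
    pvec2 g c v (i + 1) = v i := by
  obtain ⟨i, rfl⟩ := Nat.exists_eq_add_of_le' hi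
  rfl

theorem eq_pvec2 {p : ℕ → ℂ} {g c : ℂ} {v : ℕ → ℂ} (h0 : p 0 = g) (h1 : p 1 = c)
    (h : ∀ i, 1 ≤ i → p (i + 1) = v i) : p = pvec2 g c v := by
  funext i
  rcases i with _ | _ | i
  · exact h0
  · exact h1
  · exact h (i + 1) (by omega)

theorem eq_pvec1 {p : ℕ → ℂ} {g : ℂ} {v : ℕ → ℂ} (h0 : p 0 = g)
    (h : ∀ i, 1 ≤ i → p i = v i) : p = pvec1 g v := by
  funext i
  rcases i with _ | i
  · exact h0
  · exact h (i + 1) (by omega)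

theorem pvec1_apply (g : ℂ) (v : ℕ → ℂ) {i : ℕ} (hi : 1 ≤ i) : pvec1 g v i = v i := by
  obtain ⟨i, rfl⟩ := Nat.exists_eq_add_of_le' hi
  rfl

section OddCase

variable {q : ℕ}

/-- The parameter vectors that occur in `oddList q`. -/
def IsOddNormal (q : ℕ) (p : ℕ → ℂ) : Prop :=
  (p 0 = 1 ∧ 4 * p 1 ^ 2 ≠ 1 ∧ IsNorm (q - 2) fun i => p (i + 1)) ∨
  (p 0 = 1 ∧ 4 * p 1 ^ 2 = 1 ∧ IsNorm (q - 1) fun i => p (i + 1)) ∨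
  (p 0 = 0 ∧ p 1 = 1 ∧ IsNorm (q - 2) fun i => p (i + 1)) ∨
  (p 0 = 0 ∧ p 1 = 0 ∧ IsNormTwo (q - 1) fun i => p (i + 1))

theorem rel_odd_iff (hq : 2 ≤ q) {p p' : ℕ → ℂ} : Rel (2 * q - 1) p p' ↔
    ∃ t ε B : ℂ, t ≠ 0 ∧ ε ≠ 0 ∧ p' 0 = ε ^ 2 * p 0 ∧ p' 1 = ε * p 1 ∧
      (∀ i, 1 ≤ i → i ≤ q - 2 → p' (i + 1) = ε * t ^ i * p (i + 1)) ∧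
      p' (q - 1 + 1) = ε * t ^ (q - 1) * p (q - 1 + 1) + B * (p' 0 - 4 * p' 1 ^ 2) := by
  rw [rel_two_mul_sub_one_iff hq]
  constructor
  · rintro ⟨t, ε, B, ht, hε, h0, h1, h2⟩
    refine ⟨t, ε, B, ht, hε, h0, ?_, fun i _ hi => h1 i (by omega), ?_⟩
    · have := h1 0 (by omega)
      rwa [pow_zero, mul_one] at this
    · rwa [Nat.sub_add_cancel (by omega)]
  · rintro ⟨t, ε, B, ht, hε, h0, h1, h2, h3⟩
    refine ⟨t, ε, B, ht, hε, h0, fun i hi => ?_, ?_⟩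
    · rcases Nat.eq_zero_or_pos i with rfl | h
      · rwa [pow_zero, mul_one]
      · exact h2 i h (by omega)
    · rwa [Nat.sub_add_cancel (by omega)] at h3

theorem rel_odd_of_eq (hq : 2 ≤ q) {p p' : ℕ → ℂ} {t ε : ℂ} (ht : t ≠ 0) (hε : ε ≠ 0)
    (h0 : p' 0 = ε ^ 2 * p 0) (h1 : p' 1 = ε * p 1)
    (h : ∀ i, 1 ≤ i → p' (i + 1) = ε * t ^ i * p (i + 1)) : Rel (2 * q - 1) p p' :=
  (rel_odd_iff hq).2 ⟨t, ε, 0, ht, hε, h0, h1, fun i hi _ => h i hi, by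
    rw [h _ (by omega), zero_mul, add_zero]⟩

/-- The multiplier of B is 1 - 4 b². If it is nonzero the last coordinate has been cleared and the
vector has length q - 2; otherwise B has no effect and the length is q - 1. -/
theorem oddEntry_one_eq (hq : 2 ≤ q) {b : ℂ} {j k : ℕ} (α : ℕ → ℂ)
    (hb : 4 * b ^ 2 ≠ 1 ∧ k = q - 2 ∨ 4 * b ^ 2 = 1 ∧ k = q - 1) (hj : 1 ≤ j) (hjk : j ≤ k + 1) :
    {p | ∃ (δ : ℂ) (m : ℕ), (δ = 1 ∨ δ = -1) ∧ m < j ∧ p = pvec2 1 (δ * b) (V0 δ m j k α)} =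
      {p' | IsOddNormal q p' ∧ Rel (2 * q - 1) (pvec2 1 b (normVec j k α)) p'} := by
  have hsq : ∀ δ : ℂ, δ = 1 ∨ δ = -1 → δ ^ 2 = 1 := fun δ h => by
    rcases h with rfl | rfl <;> norm_num
  ext p'
  constructor
  · rintro ⟨δ, m, hδ, -, rfl⟩
    have hV : ∀ i, 1 ≤ i → pvec2 1 (δ * b) (V0 δ m j k α) (i + 1) =
        δ * (δ ^ (1 / (j : ℂ)) * S m j) ^ i * normVec j k α i := fun i hi => by
      rw [pvec2_add_one _ _ _ hi, V0_eq hδ m hj]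
    have hδ0 : δ ≠ 0 := by rcases hδ with rfl | rfl <;> norm_num
    have ht := cpow_mul_S_pow δ m hj
    have hnorm := isNorm_of_eq_mul_normVec hj hjk
      (fun _ => by rw [ht, ← pow_two, hsq δ hδ]) hV
    refine ⟨?_, rel_odd_of_eq hq (t := δ ^ (1 / (j : ℂ)) * S m j) (ε := δ) ?_ hδ0 ?_ rfl ?_⟩
    · rcases hb with ⟨hb, rfl⟩ | ⟨hb, rfl⟩
      · exact Or.inl ⟨rfl, by change 4 * (δ * b) ^ 2 ≠ 1; rwa [mul_pow, hsq δ hδ, one_mul], hnorm⟩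
      · exact Or.inr (Or.inl
          ⟨rfl, by change 4 * (δ * b) ^ 2 = 1; rwa [mul_pow, hsq δ hδ, one_mul], hnorm⟩)
    · intro h0
      rw [h0, zero_pow (by omega)] at ht
      exact hδ0 ht.symm
    · change (1 : ℂ) = δ ^ 2 * 1
      rw [hsq δ hδ, one_mul]
    · intro i hi
      rw [hV i hi, pvec2_add_one _ _ _ hi]
  · rintro ⟨hn, hr⟩
    obtain ⟨t, ε, B, ht, hε, h0, h1, h2, h3⟩ := (rel_odd_iff hq).1 hr
    change p' 0 = ε ^ 2 * 1 at h0
    change p' 1 = ε * b at h1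
    have hp0 : p' 0 = 1 := by
      rcases hn with h | h | h | h
      · exact h.1
      · exact h.1
      · exact absurd (h0.symm.trans h.1) (mul_ne_zero (pow_ne_zero _ hε) one_ne_zero)
      · exact absurd (h0.symm.trans h.1) (mul_ne_zero (pow_ne_zero _ hε) one_ne_zero)
    have hε2 : ε ^ 2 = 1 := by rw [← mul_one (ε ^ 2), ← h0, hp0]
    have hp1 : 4 * p' 1 ^ 2 = 4 * b ^ 2 := by rw [h1, mul_pow, hε2, one_mul]
    obtain ⟨hnorm, hv⟩ : IsNorm k (fun i => p' (i + 1)) ∧ ∀ i, 1 ≤ i → i ≤ k →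
        p' (i + 1) = ε * t ^ i * normVec j k α i := by
      rcases hb with ⟨hb, rfl⟩ | ⟨hb, rfl⟩
      · refine ⟨?_, fun i hi hik => by rw [h2 i hi hik, pvec2_add_one _ _ _ hi]⟩
        rcases hn with h | h | h | h
        · exact h.2.2
        · exact absurd (hp1.symm.trans h.2.1) hb
        · exact absurd (hp0.symm.trans h.1) one_ne_zero
        · exact absurd (hp0.symm.trans h.1) one_ne_zero
      · refine ⟨?_, fun i hi hik => ?_⟩
        · rcases hn with h | h | h | h
          · exact absurd (hp1.trans hb) h.2.1
          · exact h.2.2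
          · exact absurd (hp0.symm.trans h.1) one_ne_zero
          · exact absurd (hp0.symm.trans h.1) one_ne_zero
        · rcases Nat.lt_or_ge (q - 2) i with h | h
          · rw [show i = q - 1 by omega, h3, hp0, hp1, hb, sub_self, mul_zero, add_zero,
              pvec2_add_one _ _ _ (by omega)]
          · rw [h2 i hi h, pvec2_add_one _ _ _ hi]
    have hε' : ε = 1 ∨ ε = -1 := by simpa using hε2
    have hv' := hnorm.eq_mul_normVec (c := fun i => ε * t ^ i) hv
    by_cases hjk' : j ≤ k
    · have ht1 : ε * t ^ j = 1 :=
        hnorm.coeff_eq_one (c := fun i => ε * t ^ i)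
          (fun i => mul_ne_zero hε (pow_ne_zero _ ht)) hv hj hjk'
      -- From ε t^j = 1 and ε² = 1 it follows that t^j = ε, so t is the principal root of ε times a
      -- root of unity.
      obtain ⟨m, hm, rfl⟩ := exists_eq_cpow_mul_S hε hj (t := t)
        (by linear_combination ε * ht1 - t ^ j * hε2)
      exact ⟨ε, m, hε', hm, eq_pvec2 hp0 h1 fun i hi => by rw [V0_eq hε' m hj]; exact hv' i hi⟩
    · refine ⟨ε, 0, hε', by omega, eq_pvec2 hp0 h1 fun i hi => ?_⟩
      have h5 : normVec j k α i = 0 := if_pos (by omega)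
      have := hv' i hi
      rw [h5, mul_zero] at this
      rw [V0_eq hε' 0 hj, h5, mul_zero]
      exact this

/-- The normalisation p₁ = 1 fixes ε = 1, so no sign remains; B again clears the last coordinate. -/
theorem oddEntry_two_eq (hq : 2 ≤ q) {j : ℕ} (α : ℕ → ℂ) (hj : 1 ≤ j) (hjk : j ≤ q - 1) :
    {p | ∃ m : ℕ, m < j ∧ p = pvec2 0 1 (V1 m j (q - 2) α)} =
      {p' | IsOddNormal q p' ∧ Rel (2 * q - 1) (pvec2 0 1 (normVec j (q - 2) α)) p'} := by
  ext p'
  constructor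
  · rintro ⟨m, -, rfl⟩
    have hV : ∀ i, 1 ≤ i → pvec2 0 1 (V1 m j (q - 2) α) (i + 1) =
        S m j ^ i * normVec j (q - 2) α i := fun i hi => by
      rw [pvec2_add_one _ _ _ hi, V1_eq m hj]
    have ht := S_pow_self m hj
    refine ⟨Or.inr (Or.inr (Or.inl ⟨rfl, rfl,
      isNorm_of_eq_mul_normVec hj (by omega) (fun _ => ht) hV⟩)),
      rel_odd_of_eq hq (t := S m j) (ε := 1) ?_ one_ne_zero ?_ ?_ ?_⟩
    · intro h0
      rw [h0, zero_pow (by omega)] at ht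
      exact zero_ne_one ht
    · exact (mul_zero _).symm
    · exact (mul_one _).symm
    · intro i hi
      rw [hV i hi, pvec2_add_one _ _ _ hi, one_mul]
  · rintro ⟨hn, hr⟩
    obtain ⟨t, ε, B, ht, hε, h0, h1, h2, -⟩ := (rel_odd_iff hq).1 hr
    change p' 0 = ε ^ 2 * 0 at h0
    change p' 1 = ε * 1 at h1
    rw [mul_zero] at h0
    rw [mul_one] at h1
    obtain ⟨hp1, hnorm⟩ : p' 1 = 1 ∧ IsNorm (q - 2) fun i => p' (i + 1) := by
      rcases hn with h | h | h | h
      · exact absurd (h0.symm.trans h.1) zero_ne_one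
      · exact absurd (h0.symm.trans h.1) zero_ne_one
      · exact h.2
      · exact absurd (h1.symm.trans h.2.1) hε
    obtain rfl : ε = 1 := h1.symm.trans hp1
    have hv : ∀ i, 1 ≤ i → i ≤ q - 2 → p' (i + 1) = t ^ i * normVec j (q - 2) α i := fun i hi hik => by
      rw [h2 i hi hik, pvec2_add_one _ _ _ hi, one_mul]
    have hv' := hnorm.eq_mul_normVec (c := fun i => t ^ i) hv
    by_cases hjk' : j ≤ q - 2
    · obtain ⟨m, hm, rfl⟩ := exists_eq_S hj
        (hnorm.coeff_eq_one (fun i => pow_ne_zero i ht) hv hj hjk')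
      exact ⟨m, hm, eq_pvec2 h0 h1 fun i hi => by rw [V1_eq m hj]; exact hv' i hi⟩
    · refine ⟨0, by omega, eq_pvec2 h0 h1 fun i hi => ?_⟩
      have h5 : normVec j (q - 2) α i = 0 := if_pos (by omega)
      have := hv' i hi
      rw [h5, mul_zero] at this
      rw [V1_eq 0 hj, h5, mul_zero]
      exact this

/-- With p₀ = p₁ = 0 the multiplier of B is zero, and ε and t are both free, which allows two
coordinates to be normalised. -/
theorem oddEntry_three_eq (hq : 2 ≤ q) {j s : ℕ} (α : ℕ → ℂ) (hj : 1 ≤ j) (hjk : j ≤ q - 1)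
    (hs : 1 ≤ s) (hsk : s ≤ q - j) :
    {p | ∃ m : ℕ, m < s ∧ p = pvec2 0 0 (W m s j (q - 1) α)} =
      {p' | IsOddNormal q p' ∧ Rel (2 * q - 1) (pvec2 0 0 (normVecTwo s j (q - 1) α)) p'} := by
  ext p'
  constructor
  · rintro ⟨m, -, rfl⟩
    have ht := S_pow_self m hs
    have ht0 : S m s ≠ 0 := fun h0 => by
      rw [h0, zero_pow (by omega)] at ht
      exact zero_ne_one ht
    have hV : ∀ i, 1 ≤ i → pvec2 0 0 (W m s j (q - 1) α) (i + 1) =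
        S m s ^ (i - j) * normVecTwo s j (q - 1) α i := fun i hi => by
      rw [pvec2_add_one _ _ _ hi, W_eq m hs]
    refine ⟨Or.inr (Or.inr (Or.inr ⟨rfl, rfl, isNormTwo_of_eq_mul_normVecTwo hj hjk hs (by omega)
      (c := fun i => S m s ^ (i - j)) ?_ (fun _ => ?_) hV⟩)),
      rel_odd_of_eq hq (t := S m s) (ε := (S m s ^ j)⁻¹) ht0 (inv_ne_zero (pow_ne_zero _ ht0)) ?_ ?_ ?_⟩
    · rw [Nat.sub_self, pow_zero]
    · rw [Nat.add_sub_cancel_left, ht]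
    · exact (mul_zero _).symm
    · exact (mul_zero _).symm
    · intro i hi
      rw [hV i hi, pvec2_add_one _ _ _ hi]
      by_cases hij : i < j
      · rw [normVecTwo, if_pos (Or.inr hij), mul_zero, mul_zero]
      · obtain ⟨r, rfl⟩ := Nat.exists_eq_add_of_le (not_lt.1 hij)
        rw [Nat.add_sub_cancel_left, pow_add, inv_mul_cancel_left₀ (pow_ne_zero _ ht0)]
  · rintro ⟨hn, hr⟩
    obtain ⟨t, ε, B, ht, hε, h0, h1, h2, h3⟩ := (rel_odd_iff hq).1 hr
    change p' 0 = ε ^ 2 * 0 at h0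
    change p' 1 = ε * 0 at h1
    rw [mul_zero] at h0 h1
    have hnorm : IsNormTwo (q - 1) fun i => p' (i + 1) := by
      rcases hn with h | h | h | h
      · exact absurd (h0.symm.trans h.1) zero_ne_one
      · exact absurd (h0.symm.trans h.1) zero_ne_one
      · exact absurd (h1.symm.trans h.2.1) zero_ne_one
      · exact h.2.2
    have hv : ∀ i, 1 ≤ i → i ≤ q - 1 →
        p' (i + 1) = ε * t ^ i * normVecTwo s j (q - 1) α i := fun i hi hik => by
      rcases Nat.lt_or_ge (q - 2) i with h | h
      · rw [show i = q - 1 by omega, h3, h0, h1, pvec2_add_one _ _ _ (by omega)]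
        ring
      · rw [h2 i hi h, pvec2_add_one _ _ _ hi]
    obtain ⟨m, hm, hW⟩ := hnorm.exists_eq_W ht hε hv hj hjk hs
    exact ⟨m, hm, eq_pvec2 h0 h1 hW⟩

theorem isOddNormal_and_rel_zero_iff (hq : 2 ≤ q) {p : ℕ → ℂ} :
    IsOddNormal q p ∧ Rel (2 * q - 1) (fun _ => 0) p ↔ p = fun _ => 0 := by
  constructor
  · rintro ⟨hn, hr⟩
    obtain ⟨t, ε, B, ht, hε, h0, h1, h2, h3⟩ := (rel_odd_iff hq).1 hr
    rw [mul_zero] at h0 h1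
    have hnorm : IsNormTwo (q - 1) fun i => p (i + 1) := by
      rcases hn with h | h | h | h
      · exact absurd (h0.symm.trans h.1) zero_ne_one
      · exact absurd (h0.symm.trans h.1) zero_ne_one
      · exact absurd (h1.symm.trans h.2.1) zero_ne_one
      · exact h.2.2
    funext i
    rcases i with _ | _ | i
    · exact h0
    · exact h1
    · rcases lt_trichotomy (i + 1) (q - 1) with h | h | h
      · rw [h2 (i + 1) (by omega) (by omega), mul_zero]
      · rw [h, h3, h0, h1]
        ring
      · exact hnorm.apply_eq_zero h
  · rintro rfl
    exact ⟨Or.inr (Or.inr (Or.inr ⟨rfl, rfl, Or.inl fun _ _ => rfl⟩)),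
      rel_odd_of_eq hq one_ne_zero one_ne_zero (mul_zero _).symm (mul_zero _).symm
        fun _ _ => (mul_zero _).symm⟩

/-- Each entry is the intersection of one equivalence class with the normal vectors, a condition on
p that is the same for all entries. Distinct entries therefore cannot contain equivalent vectors. -/
theorem exists_eq_of_mem_oddList (hq : 2 ≤ q) {C : Set (ℕ → ℂ)} (hC : C ∈ oddList q) :
    ∃ r, C = {p | IsOddNormal q p ∧ Rel (2 * q - 1) r p} := by
  obtain ((((⟨b, j, α, hb, hb', hj, hjk, rfl⟩ | ⟨j, α, hj, hjk, rfl⟩) | ⟨j, α, hj, hjk, rfl⟩) |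
    ⟨j, s, α, hj, hjk, hs, hsk, rfl⟩) | rfl) := hC
  · refine ⟨_, oddEntry_one_eq hq α (Or.inl ⟨fun h => ?_, rfl⟩) hj (by omega)⟩
    have h1 : (b - 1 / 2) * (b - -(1 / 2)) = 0 := by linear_combination h / 4
    rcases mul_eq_zero.1 h1 with h2 | h2
    · exact hb (sub_eq_zero.1 h2)
    · exact hb' (sub_eq_zero.1 h2)
  · exact ⟨_, oddEntry_one_eq hq α (Or.inr ⟨by norm_num, rfl⟩) hj (by omega)⟩
  · exact ⟨_, oddEntry_two_eq hq α hj hjk⟩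
  · exact ⟨_, oddEntry_three_eq hq α hj hjk hs hsk⟩
  · exact ⟨fun _ => 0, Set.ext fun p => (isOddNormal_and_rel_zero_iff hq).symm⟩

theorem exists_mem_oddList (hq : 2 ≤ q) (p : ℕ → ℂ) :
    ∃ C ∈ oddList q, ∃ p' ∈ C, Rel (2 * q - 1) p p' := by
  by_cases hp0 : p 0 = 0
  · by_cases hp1 : p 1 = 0
    · rcases exists_smul_eq_normVecTwo (fun i => p (i + 1)) (q - 1) with h |
        ⟨j, s, c, t, α, hj, hjk, hs, hsk, hc, ht, h⟩
      · refine ⟨_, Or.inr rfl, _, rfl, (rel_odd_iff hq).2 ⟨1, 1, 0, one_ne_zero, one_ne_zero, ?_, ?_,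
          fun i hi hik => ?_, ?_⟩⟩
        · rw [hp0, mul_zero]
        · rw [hp1, mul_zero]
        · rw [h i hi (by omega), mul_zero]
        · rw [h (q - 1) (by omega) le_rfl, mul_zero, zero_mul, zero_add]
      · have hr : Rel (2 * q - 1) p (pvec2 0 0 (normVecTwo s j (q - 1) α)) := by
          refine (rel_odd_iff hq).2 ⟨t, c, 0, ht, hc, ?_, ?_, fun i hi hik => ?_, ?_⟩
          · rw [hp0, mul_zero]; rfl
          · rw [hp1, mul_zero]; rfl
          · rw [pvec2_add_one _ _ _ hi, h i hi (by omega)]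
          · rw [pvec2_add_one _ _ _ (by omega), h _ (by omega) le_rfl, zero_mul, add_zero]
        refine ⟨_, Or.inl (Or.inr ⟨j, s, α, hj, hjk, hs, by omega, rfl⟩),
          pvec2 0 0 (W 0 s j (q - 1) α), ⟨0, hs, rfl⟩, hr.trans (by omega) ?_⟩
        have := (oddEntry_three_eq hq α hj hjk hs (by omega)).subset ⟨0, hs, rfl⟩
        exact this.2
    · obtain ⟨j, t, α, hj, hjk, ht, h⟩ := exists_smul_eq_normVec (fun i => p (i + 1)) (q - 2)
        (ε := (p 1)⁻¹) (inv_ne_zero hp1) (e := id) (fun i hi => hi)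
      have hr : Rel (2 * q - 1) p (pvec2 0 1 (normVec j (q - 2) α)) := by
        -- The multiplier of B is -4, which determines B so that the last coordinate becomes zero.
        refine (rel_odd_iff hq).2 ⟨t, (p 1)⁻¹, (p 1)⁻¹ * t ^ (q - 1) * p (q - 1 + 1) / 4, ht,
          inv_ne_zero hp1, ?_, ?_, fun i hi hik => ?_, ?_⟩
        · rw [hp0, mul_zero]; rfl
        · rw [inv_mul_cancel₀ hp1]; rfl
        · rw [pvec2_add_one _ _ _ hi, h i hi hik]; rfl
        · rw [pvec2_add_one _ _ _ (by omega), normVec, if_pos (by omega)]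
          change _ = _ + _ * (0 - 4 * 1 ^ 2)
          ring
      refine ⟨_, Or.inl (Or.inl (Or.inr ⟨j, α, hj, by omega, rfl⟩)), pvec2 0 1 (V1 0 j (q - 2) α),
        ⟨0, hj, rfl⟩, hr.trans (by omega) ?_⟩
      have := (oddEntry_two_eq hq α hj (by omega)).subset ⟨0, hj, rfl⟩
      exact this.2
  · by_cases hp1 : 4 * p 1 ^ 2 = p 0
    · have hp1' : p 1 ≠ 0 := fun h0 => hp0 (by rw [← hp1, h0]; ring)
      -- On the locus 4 p₁² = p₀ this ε makes p₀ = 1 and p₁ = ½ simultaneously.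
      have hε : 1 / (2 * p 1) ≠ 0 := one_div_ne_zero (mul_ne_zero two_ne_zero hp1')
      obtain ⟨j, t, α, hj, hjk, ht, h⟩ := exists_smul_eq_normVec (fun i => p (i + 1)) (q - 1) hε
        (e := id) (fun i hi => hi)
      have hr : Rel (2 * q - 1) p (pvec2 1 (1 / 2) (normVec j (q - 1) α)) := by
        refine (rel_odd_iff hq).2 ⟨t, _, 0, ht, hε, ?_, ?_, fun i hi hik => ?_, ?_⟩
        · rw [← hp1]
          change (1 : ℂ) = _
          field_simp
          norm_num
        · change (1 / 2 : ℂ) = _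
          field_simp
        · rw [pvec2_add_one _ _ _ hi, h i hi (by omega)]; rfl
        · rw [pvec2_add_one _ _ _ (by omega), h _ (by omega) le_rfl, zero_mul, add_zero]; rfl
      have hmem : pvec2 1 (1 * (1 / 2)) (V0 1 0 j (q - 1) α) ∈ {p | ∃ (δ : ℂ) (m : ℕ),
          (δ = 1 ∨ δ = -1) ∧ m < j ∧ p = pvec2 1 (δ * (1 / 2)) (V0 δ m j (q - 1) α)} :=
        ⟨1, 0, Or.inl rfl, hj, rfl⟩
      refine ⟨_, Or.inl (Or.inl (Or.inl (Or.inr ⟨j, α, hj, by omega, rfl⟩))), _, hmem,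
        hr.trans (by omega) ?_⟩
      rw [oddEntry_one_eq hq α (Or.inr ⟨by norm_num, rfl⟩) hj hjk] at hmem
      exact hmem.2
    · obtain ⟨ε, hε2⟩ := IsAlgClosed.exists_pow_nat_eq (1 / p 0) two_pos
      have hε : ε ≠ 0 := fun h0 => by
        rw [h0, zero_pow two_ne_zero] at hε2
        exact one_div_ne_zero hp0 hε2.symm
      have hε1 : ε ^ 2 * p 0 = 1 := by rw [hε2, one_div_mul_cancel hp0]
      have hb : 1 - 4 * (ε * p 1) ^ 2 ≠ 0 := fun h0 => hp1 (by
        apply mul_left_cancel₀ (pow_ne_zero 2 hε)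
        linear_combination hε1.symm - h0)
      obtain ⟨j, t, α, hj, hjk, ht, h⟩ := exists_smul_eq_normVec (fun i => p (i + 1)) (q - 2) hε
        (e := id) (fun i hi => hi)
      have hr : Rel (2 * q - 1) p (pvec2 1 (ε * p 1) (normVec j (q - 2) α)) := by
        refine (rel_odd_iff hq).2 ⟨t, ε,
          -(ε * t ^ (q - 1) * p (q - 1 + 1)) / (1 - 4 * (ε * p 1) ^ 2), ht, hε, hε1.symm, rfl,
          fun i hi hik => ?_, ?_⟩
        · rw [pvec2_add_one _ _ _ hi, h i hi (by omega)]; rfl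
        · rw [pvec2_add_one _ _ _ (by omega), normVec, if_pos (by omega)]
          change _ = _ + _ * (1 - 4 * (ε * p 1) ^ 2)
          rw [div_mul_cancel₀ _ hb]
          ring
      have hmem : pvec2 1 (1 * (ε * p 1)) (V0 1 0 j (q - 2) α) ∈ {p' | ∃ (δ : ℂ) (m : ℕ),
          (δ = 1 ∨ δ = -1) ∧ m < j ∧ p' = pvec2 1 (δ * (ε * p 1)) (V0 δ m j (q - 2) α)} :=
        ⟨1, 0, Or.inl rfl, hj, rfl⟩
      refine ⟨_, Or.inl (Or.inl (Or.inl (Or.inl ⟨ε * p 1, j, α, fun h0 => hb ?_, fun h0 => hb ?_, hj,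
        by omega, rfl⟩))), _, hmem, hr.trans (by omega) ?_⟩
      · rw [h0]; norm_num
      · rw [h0]; norm_num
      · rw [oddEntry_one_eq hq α (Or.inl ⟨fun h0 => hb (by rw [h0, sub_self]), rfl⟩) hj hjk] at hmem
        exact hmem.2

end OddCase

end LeibFamily

/-! ### The list for even n -/

namespace LeibFamily

section EvenCase

variable {q : ℕ}

/-- The parameter vectors that occur in `evenList q`. -/
def IsEvenNormal (q : ℕ) (p : ℕ → ℂ) : Prop :=
  (p 0 = 1 ∧ IsNorm (q - 1) p) ∨ (p 0 = 0 ∧ IsNormTwo q p)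

theorem rel_even_iff (hq : 1 ≤ q) {p p' : ℕ → ℂ} : Rel (2 * q) p p' ↔
    ∃ A ε B : ℂ, A ≠ 0 ∧ ε ≠ 0 ∧ p' 0 = ε ^ 2 * p 0 ∧
      (∀ i, 1 ≤ i → i ≤ q - 1 → p' i = ε * A ^ (2 * i - 1) * p i) ∧
      p' q = ε * A ^ (2 * q - 1) * p q + B * p' 0 := by
  rw [rel_two_mul_iff hq]
  constructor
  · rintro ⟨A, ε, B, hA, hε, h0, h1, h2⟩
    refine ⟨A, ε, B, hA, hε, h0, fun i hi hiq => ?_, h2⟩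
    obtain ⟨i, rfl⟩ := Nat.exists_eq_add_of_le' hi
    exact h1 i (by omega)
  · rintro ⟨A, ε, B, hA, hε, h0, h1, h2⟩
    exact ⟨A, ε, B, hA, hε, h0, fun i hi => h1 (i + 1) (by omega) (by omega), h2⟩

/-- Without p₀ the parameter B is idle and ε is free, so ε A^(2i-1) can be written c t^i with t = A²
and c = ε / A. -/
theorem rel_even_iff_of_zero (hq : 1 ≤ q) {p p' : ℕ → ℂ} (hp : p 0 = 0) : Rel (2 * q) p p' ↔
    ∃ t c : ℂ, t ≠ 0 ∧ c ≠ 0 ∧ p' 0 = 0 ∧ ∀ i, 1 ≤ i → i ≤ q → p' i = c * t ^ i * p i := by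
  rw [rel_even_iff hq]
  constructor
  · rintro ⟨A, ε, B, hA, hε, h0, h1, h2⟩
    rw [hp, mul_zero] at h0
    refine ⟨A ^ 2, ε * A⁻¹, pow_ne_zero _ hA, mul_ne_zero hε (inv_ne_zero hA), h0,
      fun i hi hiq => ?_⟩
    have h3 : p' i = ε * A ^ (2 * i - 1) * p i := by
      rcases Nat.lt_or_ge (q - 1) i with h | h
      · rw [show i = q by omega, h2, h0, mul_zero, add_zero]
      · exact h1 i hi h
    rw [h3, ← pow_mul]
    nth_rw 2 [show 2 * i = 2 * i - 1 + 1 by omega]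
    rw [pow_succ]
    field_simp
  · rintro ⟨t, c, ht, hc, h0, h1⟩
    obtain ⟨A, rfl⟩ := IsAlgClosed.exists_pow_nat_eq t two_pos
    have hA : A ≠ 0 := fun h => ht (by rw [h, zero_pow two_ne_zero])
    have h2 : ∀ i, 1 ≤ i → i ≤ q → p' i = c * A * A ^ (2 * i - 1) * p i := fun i hi hiq => by
      rw [h1 i hi hiq, mul_assoc c A, ← pow_succ', ← pow_mul, Nat.sub_add_cancel (by omega)]
    exact ⟨A, c * A, 0, hA, mul_ne_zero hc hA, by rw [h0, hp, mul_zero],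
      fun i hi hiq => h2 i hi (by omega), by rw [h2 q hq le_rfl, zero_mul, add_zero]⟩

theorem evenEntry_one_eq (hq : 1 ≤ q) {j : ℕ} (α : ℕ → ℂ) (hj : 1 ≤ j) (hjk : j ≤ q) :
    {p | ∃ m : ℕ, m < 2 * j - 1 ∧ p = pvec1 1 (V2 m j (q - 1) α)} =
      {p' | IsEvenNormal q p' ∧ Rel (2 * q) (pvec1 1 (normVec j (q - 1) α)) p'} := by
  ext p'
  constructor
  · rintro ⟨m, -, rfl⟩
    have hV : ∀ i, 1 ≤ i → pvec1 1 (V2 m j (q - 1) α) i =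
        S m (2 * j - 1) ^ (2 * i - 1) * normVec j (q - 1) α i := fun i hi => by
      rw [pvec1_apply _ _ hi, V2_eq m hj]
    have ht := S_pow_self m (show 0 < 2 * j - 1 by omega)
    refine ⟨Or.inl ⟨rfl, isNorm_of_eq_mul_normVec hj (by omega) (fun _ => ht) hV⟩,
      (rel_even_iff hq).2 ⟨S m (2 * j - 1), 1, 0, ?_, one_ne_zero, ?_, fun i hi _ => ?_, ?_⟩⟩
    · intro h0
      rw [h0, zero_pow (by omega)] at ht
      exact zero_ne_one ht
    · change (1 : ℂ) = 1 ^ 2 * 1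
      norm_num
    · rw [hV i hi, pvec1_apply _ _ hi, one_mul]
    · rw [hV q hq, pvec1_apply _ _ hq, one_mul, zero_mul, add_zero]
  · rintro ⟨hn, hr⟩
    obtain ⟨A, ε, B, hA, hε, h0, h1, -⟩ := (rel_even_iff hq).1 hr
    change p' 0 = ε ^ 2 * 1 at h0
    obtain ⟨hp0, hnorm⟩ : p' 0 = 1 ∧ IsNorm (q - 1) p' := by
      rcases hn with h | h
      · exact h
      · exact absurd (h0.symm.trans h.1) (mul_ne_zero (pow_ne_zero _ hε) one_ne_zero)
    have hε2 : ε = 1 ∨ ε = -1 := by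
      rw [hp0, mul_one] at h0
      simpa using h0.symm
    have hεA : ε * A ≠ 0 := mul_ne_zero hε hA
    have hv : ∀ i, 1 ≤ i → i ≤ q - 1 →
        p' i = (ε * A) ^ (2 * i - 1) * normVec j (q - 1) α i := fun i hi hik => by
      -- The exponents are odd, so the sign ε = ±1 is absorbed into A; this is why no δ occurs for
      -- even n.
      have hodd : ε ^ (2 * i - 1) = ε := by
        rcases hε2 with rfl | rfl
        · rw [one_pow]
        · exact Odd.neg_one_pow ⟨i - 1, by omega⟩
      rw [h1 i hi hik, pvec1_apply _ _ hi, mul_pow, hodd]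
    have hv' := hnorm.eq_mul_normVec (c := fun i => (ε * A) ^ (2 * i - 1)) hv
    by_cases hjk' : j ≤ q - 1
    · obtain ⟨m, hm, h3⟩ := exists_eq_S (show 0 < 2 * j - 1 by omega)
        (hnorm.coeff_eq_one (c := fun i => (ε * A) ^ (2 * i - 1))
          (fun i => pow_ne_zero _ hεA) hv hj hjk')
      exact ⟨m, hm, eq_pvec1 hp0 fun i hi => by rw [V2_eq m hj, ← h3, hv' i hi]⟩
    · refine ⟨0, by omega, eq_pvec1 hp0 fun i hi => ?_⟩
      have h5 : normVec j (q - 1) α i = 0 := if_pos (by omega)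
      rw [V2_eq 0 hj, hv' i hi, h5, mul_zero, mul_zero]

theorem evenEntry_two_eq (hq : 1 ≤ q) {j s : ℕ} (α : ℕ → ℂ) (hj : 1 ≤ j) (hjk : j ≤ q)
    (hs : 1 ≤ s) (hsk : s ≤ q + 1 - j) :
    {p | ∃ m : ℕ, m < s ∧ p = pvec1 0 (W m s j q α)} =
      {p' | IsEvenNormal q p' ∧ Rel (2 * q) (pvec1 0 (normVecTwo s j q α)) p'} := by
  ext p'
  constructor
  · rintro ⟨m, -, rfl⟩
    have ht := S_pow_self m hs
    have ht0 : S m s ≠ 0 := fun h0 => by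
      rw [h0, zero_pow (by omega)] at ht
      exact zero_ne_one ht
    have hV : ∀ i, 1 ≤ i → pvec1 0 (W m s j q α) i =
        S m s ^ (i - j) * normVecTwo s j q α i := fun i hi => by
      rw [pvec1_apply _ _ hi, W_eq m hs]
    refine ⟨Or.inr ⟨rfl, isNormTwo_of_eq_mul_normVecTwo hj hjk hs hsk
      (c := fun i => S m s ^ (i - j)) ?_ (fun _ => ?_) hV⟩,
      (rel_even_iff_of_zero hq rfl).2 ⟨S m s, (S m s ^ j)⁻¹, ht0,
        inv_ne_zero (pow_ne_zero _ ht0), rfl, fun i hi _ => ?_⟩⟩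
    · rw [Nat.sub_self, pow_zero]
    · rw [Nat.add_sub_cancel_left, ht]
    · rw [hV i hi, pvec1_apply _ _ hi]
      by_cases hij : i < j
      · rw [normVecTwo, if_pos (Or.inr hij), mul_zero, mul_zero]
      · obtain ⟨r, rfl⟩ := Nat.exists_eq_add_of_le (not_lt.1 hij)
        rw [Nat.add_sub_cancel_left, pow_add, inv_mul_cancel_left₀ (pow_ne_zero _ ht0)]
  · rintro ⟨hn, hr⟩
    obtain ⟨t, c, ht, hc, h0, h1⟩ := (rel_even_iff_of_zero hq rfl).1 hr
    have hnorm : IsNormTwo q p' := by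
      rcases hn with h | h
      · exact absurd (h0.symm.trans h.1) zero_ne_one
      · exact h.2
    obtain ⟨m, hm, hW⟩ := hnorm.exists_eq_W (j := j) (s := s) (α := α) ht hc
      (fun i hi hik => by rw [h1 i hi hik, pvec1_apply _ _ hi]) hj hjk hs
    exact ⟨m, hm, eq_pvec1 h0 hW⟩

theorem isEvenNormal_and_rel_zero_iff (hq : 1 ≤ q) {p : ℕ → ℂ} :
    IsEvenNormal q p ∧ Rel (2 * q) (fun _ => 0) p ↔ p = fun _ => 0 := by
  rw [rel_even_iff_of_zero hq rfl]
  constructor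
  · rintro ⟨hn, t, c, ht, hc, h0, h1⟩
    have hnorm : IsNormTwo q p := by
      rcases hn with h | h
      · exact absurd (h0.symm.trans h.1) zero_ne_one
      · exact h.2
    funext i
    rcases Nat.eq_zero_or_pos i with rfl | hi
    · exact h0
    · rcases le_or_gt i q with h | h
      · rw [h1 i hi h, mul_zero]
      · exact hnorm.apply_eq_zero h
  · rintro rfl
    exact ⟨Or.inr ⟨rfl, Or.inl fun _ _ => rfl⟩, 1, 1, one_ne_zero, one_ne_zero, rfl,
      fun _ _ _ => (mul_zero _).symm⟩

theorem exists_eq_of_mem_evenList (hq : 1 ≤ q) {C : Set (ℕ → ℂ)} (hC : C ∈ evenList q) :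
    ∃ r, C = {p | IsEvenNormal q p ∧ Rel (2 * q) r p} := by
  obtain ((⟨j, α, hj, hjk, rfl⟩ | ⟨j, s, α, hj, hjk, hs, hsk, rfl⟩) | rfl) := hC
  · exact ⟨_, evenEntry_one_eq hq α hj hjk⟩
  · exact ⟨_, evenEntry_two_eq hq α hj hjk hs hsk⟩
  · exact ⟨fun _ => 0, Set.ext fun p => (isEvenNormal_and_rel_zero_iff hq).symm⟩

theorem exists_mem_evenList (hq : 1 ≤ q) (p : ℕ → ℂ) :
    ∃ C ∈ evenList q, ∃ p' ∈ C, Rel (2 * q) p p' := by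
  by_cases hp0 : p 0 = 0
  · rcases exists_smul_eq_normVecTwo p q with h | ⟨j, s, c, t, α, hj, hjk, hs, hsk, hc, ht, h⟩
    · exact ⟨_, Or.inr rfl, _, rfl, (rel_even_iff_of_zero hq hp0).2 ⟨1, 1, one_ne_zero, one_ne_zero,
        rfl, fun i hi hik => by rw [h i hi hik, mul_zero]⟩⟩
    · have hr : Rel (2 * q) p (pvec1 0 (normVecTwo s j q α)) :=
        (rel_even_iff_of_zero hq hp0).2 ⟨t, c, ht, hc, rfl, fun i hi hik => by
          rw [pvec1_apply _ _ hi, h i hi hik]⟩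
      have := (evenEntry_two_eq hq α hj hjk hs hsk).subset ⟨0, hs, rfl⟩
      exact ⟨_, Or.inl (Or.inr ⟨j, s, α, hj, hjk, hs, hsk, rfl⟩), pvec1 0 (W 0 s j q α),
        ⟨0, hs, rfl⟩, hr.trans (by omega) this.2⟩
  · obtain ⟨ε, hε2⟩ := IsAlgClosed.exists_pow_nat_eq (1 / p 0) two_pos
    have hε : ε ≠ 0 := fun h0 => by
      rw [h0, zero_pow two_ne_zero] at hε2
      exact one_div_ne_zero hp0 hε2.symm
    obtain ⟨j, t, α, hj, hjk, ht, h⟩ := exists_smul_eq_normVec p (q - 1) hε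
      (e := fun i => 2 * i - 1) (fun i hi => by omega)
    have hr : Rel (2 * q) p (pvec1 1 (normVec j (q - 1) α)) := by
      -- After normalising p₀ to one, B is simply added to the last coordinate and clears it.
      refine (rel_even_iff hq).2 ⟨t, ε, -(ε * t ^ (2 * q - 1) * p q), ht, hε, ?_,
        fun i hi hik => ?_, ?_⟩
      · rw [hε2, one_div_mul_cancel hp0]; rfl
      · rw [pvec1_apply _ _ hi, h i hi hik]
      · rw [pvec1_apply _ _ hq, normVec, if_pos (by omega)]
        change _ = _ + _ * 1
        ring
    have hj' : 0 < 2 * j - 1 := by omega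
    have := (evenEntry_one_eq hq α hj (by omega)).subset ⟨0, hj', rfl⟩
    exact ⟨_, Or.inl (Or.inl ⟨j, α, hj, by omega, rfl⟩), pvec1 1 (V2 0 j (q - 1) α),
      ⟨0, hj', rfl⟩, hr.trans (by omega) this.2⟩

end EvenCase

/-! ### Entries of the list as equivalence classes -/

section List

variable {n : ℕ}

theorem exists_eq_of_mem_list (hn : 2 ≤ n) : ∃ N : (ℕ → ℂ) → Prop, ∀ C ∈ list n,
    ∃ r, C = {p | N p ∧ Rel n r p} := by
  rcases Nat.even_or_odd' n with ⟨k, rfl | rfl⟩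
  · refine ⟨IsEvenNormal k, fun C hC => ?_⟩
    rw [list, if_neg (by simp), Nat.mul_div_cancel_left _ two_pos] at hC
    exact exists_eq_of_mem_evenList (by omega) hC
  · refine ⟨IsOddNormal (k + 1), fun C hC => ?_⟩
    rw [list, if_pos ⟨k, rfl⟩, show (2 * k + 1 + 1) / 2 = k + 1 by omega] at hC
    exact exists_eq_of_mem_oddList (by omega) hC

theorem exists_mem_list (hn : 2 ≤ n) (p : ℕ → ℂ) : ∃ C ∈ list n, ∃ p' ∈ C, Rel n p p' := by
  rcases Nat.even_or_odd' n with ⟨k, rfl | rfl⟩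
  · rw [list, if_neg (by simp), Nat.mul_div_cancel_left _ two_pos]
    exact exists_mem_evenList (by omega) p
  · rw [list, if_pos ⟨k, rfl⟩, show (2 * k + 1 + 1) / 2 = k + 1 by omega]
    exact exists_mem_oddList (q := k + 1) (by omega) p

/-- Entries are the traces of equivalence classes on one fixed set of normal vectors, so related
members force equal traces. -/
theorem rel_iff_eq (hn : 2 ≤ n) {C C' : Set (ℕ → ℂ)} (hC : C ∈ list n) (hC' : C' ∈ list n)
    {p p' : ℕ → ℂ} (hp : p ∈ C) (hp' : p' ∈ C') : Rel n p p' ↔ C = C' := by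
  obtain ⟨N, hN⟩ := exists_eq_of_mem_list hn
  obtain ⟨r, rfl⟩ := hN C hC
  obtain ⟨r', rfl⟩ := hN C' hC'
  constructor
  · intro h
    have hr : Rel n r r' := (hp.2.trans hn h).trans hn (hp'.2.symm hn)
    ext p''
    exact ⟨fun h' => ⟨h'.1, (hr.symm hn).trans hn h'.2⟩, fun h' => ⟨h'.1, hr.trans hn h'.2⟩⟩
  · intro h
    rw [← h] at hp'
    exact (hp.2.symm hn).trans hn hp'.2

theorem exists_presCoeff_eq (g : ℂ) (q : ℕ → ℂ) :
    ∃ p : ℕ → ℂ, p 0 = g ∧ presCoeff n p = q := by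
  refine ⟨fun i => if i = 0 then g else if i = (n + 1) / 2 then q (i - 1) else -q (i - 1) / 2,
    if_pos rfl, funext fun i => ?_⟩
  rw [presCoeff, Nat.add_sub_cancel, if_neg i.succ_ne_zero]
  split_ifs with h
  · rfl
  · ring

end List

end LeibFamily

theorem theorem3p3 (n m : ℕ) (hn : 2 ≤ n) (hm : m = n + 1) :
    -- every listed superalgebra belongs to the class that is classified
    (∀ C ∈ LeibFamily.list n, ∀ p ∈ C, (LeibFamily.L n p).InClass n m) ∧
    -- two listed superalgebras are isomorphic if and only if they stand in the same entry of the list,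
    -- that is, if they differ by the choice of the root of unity and of the sign
    (∀ C ∈ LeibFamily.list n, ∀ C' ∈ LeibFamily.list n, ∀ p ∈ C, ∀ p' ∈ C',
      ((LeibFamily.L n p).Isomorphic (LeibFamily.L n p') ↔ C = C')) ∧
    -- every superalgebra of the class is isomorphic to exactly one entry of the list
    (∀ (V : Type u) [AddCommGroup V] [Module ℂ V] (L : SuperProduct V), L.InClass n m →
      ∃! C : Set (ℕ → ℂ), C ∈ LeibFamily.list n ∧
        ∃ p ∈ C, L.Isomorphic (LeibFamily.L n p)) := by
  subst hm
  refine ⟨fun C _ p _ => ?_, fun C hC C' hC' p hp p' hp' => ?_, fun V _ _ L hL => ?_⟩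
  · obtain ⟨y, y', h⟩ := LeibFamily.exists_isPresentedBy_L hn p
    exact h.inClass
  · rw [LeibFamily.isomorphic_iff_rel hn, LeibFamily.rel_iff_eq hn hC hC' hp hp']
  · obtain ⟨g, q, y, y', h⟩ := hL.exists_isPresentedBy hn
    obtain ⟨p, rfl, rfl⟩ := LeibFamily.exists_presCoeff_eq (n := n) g q
    obtain ⟨z, z', h₁⟩ := LeibFamily.exists_isPresentedBy_L hn p
    obtain ⟨C, hC, r, hr, hpr⟩ := LeibFamily.exists_mem_list hn p
    refine ⟨C, ⟨hC, r, hr, LeibFamily.isomorphic_trans (h.isomorphic h₁)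
      ((LeibFamily.isomorphic_iff_rel hn).2 hpr)⟩, ?_⟩
    rintro C' ⟨hC', r', hr', hiso⟩
    -- Uniqueness: the second isomorphism transports the presentation of L, and comparison of
    -- parameters relates r' to p and hence to r.
    rw [← LeibFamily.rel_iff_eq hn hC' hC hr' hr]
    obtain ⟨w, w', h₂⟩ := LeibFamily.exists_isPresentedBy_L hn r'
    obtain ⟨x, x', h₃⟩ := h.exists_of_isomorphic h₂.isLeibniz hiso
    exact LeibFamily.Rel.trans hn (LeibFamily.Rel.symm hn (h₂.paramRel hn h₃)) hpr
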